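/- **Setting.** Let $N\ge 0$, $M>0$, $\varepsilon_0>0$, let $X^\varepsilon\in\mathbb R$ with $X^\varepsilon\to\infty$ as $\varepsilon\to0^+$, and let $A^\varepsilon(x,\lambda)$, $0\le\varepsilon<\varepsilon_0$, $x\in\mathbb R$, be complex $N\times N$ matrices, analytic in $\lambda$ on $|\lambda|<M$ and, for $|\lambda|\le M$, $C^1$ in $x$ and $X^\varepsilon$-periodic in $x$ if $\varepsilon>0$. Assume that there are a matrix $A^0_\infty(\lambda)$ and constants $C_0$, $\nu>0$, $\bar\theta>0$ such that for all $|\lambda|\le M$ $$|A^0(x,\lambda)-A^0_\infty(\lambda)|\le C_0e^{-\nu|x|}\quad(x\in\mathbb R),\qquad |A^\varepsilon(x,\lambda)-A^0(x,\lambda)|\le C_0e^{-\bar\theta X^\varepsilon/2}\quad(|x|\le X^\varepsilon/2,\ 0<\varepsilon<\varepsilon_0).$$ For $0<\varepsilon<\varepsilon_0$ and $|\gamma|=1$, the $\gamma$-eigenvalues of the periodic wave are the zeros $\lambda$ of the periodic Evans function $E^\varepsilon(\lambda,\gamma)=\det(\Psi^\varepsilon(X^\varepsilon,\lambda)-\gamma\,\mathrm{Id})$,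 where $\Psi^\varepsilon$ is the solution operator of $W'=A^\varepsilon(x,\lambda)W$ with $\Psi^\varepsilon(0,\lambda)=\mathrm{Id}$. The domains of hyperbolicity are the connected components $\Lambda$ of the set of all $\lambda$ with $|\lambda|<M$ for which $A^0_\infty(\lambda)$ has no eigenvalue $i\kappa$, $\kappa\in\mathbb R$. On such $\Lambda$ the homoclinic Evans function is $$D^0_\Lambda(\lambda)=\frac{\det\big(P_-(0)R^-_\infty,\;P_+(0)R^+_\infty\big)}{\det\big(R^-_\infty,R^+_\infty\big)},$$ where the columns of $R^-_\infty$ and $R^+_\infty$ are bases of the unstable and stable subspaces of $A^0_\infty(\lambda)$, and $P_+$ on $x\ge0$ and $P_-$ on $x\le0$ solve $P_\pm'=A^0P_\pm-P_\pm A^0_\infty$ with $|P_\pm(x)-\mathrm{Id}|\le c\,e^{-\eta|x|}$ for some $c$ and $\eta>0$; the value does not depend on these choices. **Isolated arc.** Let $k_*\in\mathbb R$, let $I\subset\mathbb R$ be a neighborhood of $k_*$, and let $\lambda_j:I\to\mathbb C$ satisfy $ik\in\sigma(A^0_\infty(\lambda_j(k)))$ for $k\in I$. Put $\lambda_*=\lambda_j(k_*)$.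 Assume that $|\lambda_*|<M$, that $\lambda_j$ is differentiable at $k_*$ with $\lambda_j'(k_*)\neq0$, and that $ik_*$ is an algebraically simple eigenvalue of $A^0_\infty(\lambda_*)$ and its only purely imaginary one. Let $\mu_c(\lambda)$ be the analytic eigenvalue of $A^0_\infty(\lambda)$ near $\lambda_*$ with $\mu_c(\lambda_*)=ik_*$. Let $\Lambda_1,\Lambda_2$ be the domains of hyperbolicity with $\lambda_*\in\overline{\Lambda_1}\cap\overline{\Lambda_2}$ such that, near $\lambda_*$, $\operatorname{Re}\mu_c>0$ on $\Lambda_1$ and $\operatorname{Re}\mu_c<0$ on $\Lambda_2$. The functions $D^0_r=D^0_{\Lambda_r}$ extend analytically to a neighborhood of $\lambda_*$; let $d_r=D^0_r(\lambda_*)=\lim_{\Lambda_r\ni\lambda\to\lambda_*}D^0_r(\lambda)$, $r=1,2$, and assume that $d_1\ne0$ and $d_2\neq0$. **Statement.** There is $C_1>0$ such that for every $C>0$ there are $C_2>0$ and $X_0>0$ such that the following holds for all $0<\varepsilon<\varepsilon_0$ with $X^\varepsilon\ge X_0$ and all $k\in\mathbb R$. Write $\gamma=e^{ikX^\varepsilon}$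 and $$\mathcal L_k=\{\lambda_j(\kappa):\kappa\in I,\ \kappa\equiv k \bmod 2\pi/X^\varepsilon\},\qquad \delta^\varepsilon=\frac{\ln(d_2/d_1)}{\mu_c'(\lambda_*)\,X^\varepsilon},$$ with $\ln$ the principal logarithm. 1. For every $\gamma$-eigenvalue $\lambda\in B(\lambda_*,C/X^\varepsilon)$ there is $m\in\mathcal L_k$ with $$|\lambda-m|\le \frac{C_1}{X^\varepsilon}\qquad\text{and}\qquad |\lambda-(m+\delta^\varepsilon)|\le\frac{C_2}{(X^\varepsilon)^2}.$$ 2. Conversely, for every $m\in\mathcal L_k\cap B(\lambda_*,C/X^\varepsilon)$ there is a $\gamma$-eigenvalue $\lambda$ satisfying the same two estimates. In particular, since $k$ is arbitrary, every point of the arc in $B(\lambda_*,C/X^\varepsilon)$ is within $C_1/X^\varepsilon$ of the periodic spectrum. -/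

import Mathlib

open Filter Topology

/-- The fundamental matrix of `W' = B(x) W`: `Ψ(0) = Id`, `Ψ' = B Ψ` on the whole line. -/
def IsSolutionOperator {N : ℕ} (B Ψ : ℝ → Matrix (Fin N) (Fin N) ℂ) : Prop :=
  Ψ 0 = 1 ∧ ∀ (x : ℝ) (i j : Fin N), HasDerivAt (fun y => Ψ y i j) ((B x * Ψ x) i j) x

/-- The solution operator of `W' = B(x) W` normalized at `x = 0`; for continuous `B` it exists
and is unique. -/
noncomputable def solutionOperator {N : ℕ} (B : ℝ → Matrix (Fin N) (Fin N) ℂ) :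
    ℝ → Matrix (Fin N) (Fin N) ℂ :=
  Classical.epsilon (IsSolutionOperator B)

/-- The periodic Evans function `E(γ) = det (Ψ(X) - γ Id)` of the `X`-periodic system
`W' = B(x) W`. -/
noncomputable def periodicEvans {N : ℕ} (B : ℝ → Matrix (Fin N) (Fin N) ℂ) (X : ℝ) (γ : ℂ) : ℂ :=
  (solutionOperator B X - γ • (1 : Matrix (Fin N) (Fin N) ℂ)).det

/-- The `γ`-eigenvalues of the `X`-periodic family `W' = B(x, l) W`: the `l` with `E(l, γ) = 0`. -/
def gammaEigenvalues {N : ℕ} (B : ℝ → ℂ → Matrix (Fin N) (Fin N) ℂ) (X : ℝ) (γ : ℂ) : Set ℂ :=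
  {l | periodicEvans (fun x => B x l) X γ = 0}

/-- Standing assumptions on the first-order eigenvalue systems `W' = A ε x l W`, for spectral
parameters `|l| ≤ M`; `ε = 0` is the homoclinic limit, and `0 < ε < ε₀` are the periodic waves,
of period `X ε`. Estimates on matrices are stated entrywise, which is equivalent to an estimate
in any matrix norm up to a change of the constant. -/
structure HomoclinicLimit {N : ℕ} (M ε₀ : ℝ) (X : ℝ → ℝ)
    (A : ℝ → ℝ → ℂ → Matrix (Fin N) (Fin N) ℂ) (Ainf : ℂ → Matrix (Fin N) (Fin N) ℂ) : Prop where
  eps_pos : 0 < ε₀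
  analytic : ∀ ε ∈ Set.Ico 0 ε₀, ∀ (x : ℝ) (i j : Fin N),
    AnalyticOnNhd ℂ (fun l => A ε x l i j) (Metric.ball 0 M)
  smooth : ∀ ε ∈ Set.Ico 0 ε₀, ∀ l : ℂ, ‖l‖ ≤ M → ∀ i j : Fin N,
    ContDiff ℝ 1 (fun x => A ε x l i j)
  periodic : ∀ ε ∈ Set.Ioo 0 ε₀, ∀ l : ℂ, ‖l‖ ≤ M → ∀ x : ℝ, A ε (x + X ε) l = A ε x l
  /-- the periods tend to infinity -/
  period_tendsto : Tendsto X (𝓝[>] 0) atTop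
  /-- exponential approach of the homoclinic coefficients to their limit -/
  decay : ∃ C ν : ℝ, 0 < ν ∧ ∀ l : ℂ, ‖l‖ ≤ M → ∀ (x : ℝ) (i j : Fin N),
    ‖A 0 x l i j - Ainf l i j‖ ≤ C * Real.exp (-ν * |x|)
  /-- exponential closeness, over one period, of periodic and homoclinic coefficients -/
  close : ∃ C θ : ℝ, 0 < θ ∧ ∀ ε ∈ Set.Ioo 0 ε₀, ∀ l : ℂ, ‖l‖ ≤ M →
    ∀ x : ℝ, |x| ≤ X ε / 2 → ∀ i j : Fin N,
      ‖A ε x l i j - A 0 x l i j‖ ≤ C * Real.exp (-θ * X ε / 2)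

/-- The sum of the generalized eigenspaces of `B` for eigenvalues of negative real part. -/
noncomputable def stableSubspace {N : ℕ} (B : Matrix (Fin N) (Fin N) ℂ) :
    Submodule ℂ (Fin N → ℂ) :=
  ⨆ μ ∈ {μ : ℂ | μ.re < 0}, Module.End.maxGenEigenspace (Matrix.toLin' B) μ

/-- The sum of the generalized eigenspaces of `B` for eigenvalues of positive real part. -/
noncomputable def unstableSubspace {N : ℕ} (B : Matrix (Fin N) (Fin N) ℂ) :
    Submodule ℂ (Fin N → ℂ) :=
  ⨆ μ ∈ {μ : ℂ | 0 < μ.re}, Module.End.maxGenEigenspace (Matrix.toLin' B) μ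

/-- `P` conjugates `W' = B(x) W` on the half-line `s` to `Z' = Binf Z` through `W = P Z`, that is
`P' = B P - P Binf`, and tends to the identity at exponential rate. -/
def IsConjugator {N : ℕ} (s : Set ℝ) (B : ℝ → Matrix (Fin N) (Fin N) ℂ)
    (Binf : Matrix (Fin N) (Fin N) ℂ) (P : ℝ → Matrix (Fin N) (Fin N) ℂ) : Prop :=
  (∀ x ∈ s, ∀ i j : Fin N,
    HasDerivWithinAt (fun y => P y i j) ((B x * P x - P x * Binf) i j) s x) ∧
  ∃ C η : ℝ, 0 < η ∧ ∀ x ∈ s, ∀ i j : Fin N,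
    ‖P x i j - (1 : Matrix (Fin N) (Fin N) ℂ) i j‖ ≤ C * Real.exp (-η * |x|)

/-- `d = det (P₋(0) R⁻, P₊(0) R⁺) / det (R⁻, R⁺)`, where `P₊` and `P₋` are conjugators on the
half-lines `x ≥ 0` and `x ≤ 0`, the columns of `R⁺` (the columns of `R` indexed by `S`) are a basis
of the stable subspace of `Binf`, and those of `R⁻` (the other columns of `R`) are a basis of its
unstable subspace. The order of the columns, being the same in both determinants, does not matter.
-/
def IsHomoclinicEvansValue {N : ℕ} (B : ℝ → Matrix (Fin N) (Fin N) ℂ)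
    (Binf : Matrix (Fin N) (Fin N) ℂ) (d : ℂ) : Prop :=
  ∃ (Pplus Pminus : ℝ → Matrix (Fin N) (Fin N) ℂ) (R : Matrix (Fin N) (Fin N) ℂ)
    (S : Finset (Fin N)),
    IsConjugator (Set.Ici 0) B Binf Pplus ∧ IsConjugator (Set.Iic 0) B Binf Pminus ∧
    R.det ≠ 0 ∧
    Submodule.span ℂ {v | ∃ j ∈ S, v = R.col j} = stableSubspace Binf ∧
    Submodule.span ℂ {v | ∃ j ∉ S, v = R.col j} = unstableSubspace Binf ∧
    d = (Matrix.of fun i j => if j ∈ S then (Pplus 0 * R) i j else (Pminus 0 * R) i j).det / R.det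

/-- The homoclinic Evans function of `W' = B(x) W`, `B(±∞) = Binf`, for hyperbolic `Binf`. Neither
the conjugators nor the bases are unique, but the value does not depend on their choice. -/
noncomputable def homoclinicEvans {N : ℕ} (B : ℝ → Matrix (Fin N) (Fin N) ℂ)
    (Binf : Matrix (Fin N) (Fin N) ℂ) : ℂ :=
  Classical.epsilon (IsHomoclinicEvansValue B Binf)

/-- The `l` with `|l| < M` at which `Ainf l` has no purely imaginary eigenvalue. -/
def hyperbolicSet {N : ℕ} (M : ℝ) (Ainf : ℂ → Matrix (Fin N) (Fin N) ℂ) : Set ℂ :=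
  {l | ‖l‖ < M ∧ ∀ κ : ℝ, Complex.I * κ ∉ spectrum ℂ (Ainf l)}

/-- The domains of hyperbolicity: connected components of the hyperbolic set. -/
def IsDomainOfHyperbolicity {N : ℕ} (M : ℝ) (Ainf : ℂ → Matrix (Fin N) (Fin N) ℂ)
    (Λ : Set ℂ) : Prop :=
  ∃ l ∈ hyperbolicSet M Ainf, Λ = connectedComponentIn (hyperbolicSet M Ainf) l

/-- The homoclinic Evans function of the domain of hyperbolicity `Λ`, extended to boundary points
of `Λ` by its limit from inside `Λ` (at points of an isolated arc, this is the value of its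
analytic extension). -/
noncomputable def homoclinicEvansOn {N : ℕ} (B : ℝ → ℂ → Matrix (Fin N) (Fin N) ℂ)
    (Binf : ℂ → Matrix (Fin N) (Fin N) ℂ) (Λ : Set ℂ) (l : ℂ) : ℂ :=
  limUnder (𝓝[Λ] l) (fun l' => homoclinicEvans (fun x => B x l') (Binf l'))

/-- `ls = lam ks` lies on the isolated arc `{lam k | k ∈ I}` of homoclinic essential spectrum: the
arc satisfies the dispersion relation `ik ∈ σ(Ainf (lam k))`, passes through `ls` with nonzero
velocity at `k = ks` only, and no other branch of the dispersion relation passes through `ls`: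
`i ks` is the only imaginary eigenvalue of `Ainf ls`, and it is algebraically simple. -/
structure IsIsolatedArcPoint {N : ℕ} (M : ℝ) (Ainf : ℂ → Matrix (Fin N) (Fin N) ℂ)
    (I : Set ℝ) (lam : ℝ → ℂ) (ls : ℂ) (ks : ℝ) : Prop where
  norm_lt : ‖ls‖ < M
  nhds : I ∈ 𝓝 ks
  value : lam ks = ls
  dispersion : ∀ k ∈ I, Complex.I * k ∈ spectrum ℂ (Ainf (lam k))
  differentiable : DifferentiableAt ℝ lam ks
  nondegenerate : deriv lam ks ≠ 0
  unique : ∀ k : ℝ, Complex.I * k ∈ spectrum ℂ (Ainf ls) → k = ks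
  simple : (Ainf ls).charpoly.rootMultiplicity (Complex.I * ks) = 1

/-- `μ` is an analytic eigenvalue of `Ainf` near `ls` with `μ(ls) = i ks`. -/
def IsCenterEigenvalue {N : ℕ} (Ainf : ℂ → Matrix (Fin N) (Fin N) ℂ) (ls : ℂ) (ks : ℝ)
    (μ : ℂ → ℂ) : Prop :=
  AnalyticAt ℂ μ ls ∧ μ ls = Complex.I * ks ∧ ∀ᶠ l in 𝓝 ls, μ l ∈ spectrum ℂ (Ainf l)

/-- The analytic center eigenvalue `μ_c`; if `Ainf` is analytic and `i ks` is a simple eigenvalue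
of `Ainf ls`, it exists and is unique near `ls`. -/
noncomputable def centerEigenvalue {N : ℕ} (Ainf : ℂ → Matrix (Fin N) (Fin N) ℂ) (ls : ℂ)
    (ks : ℝ) : ℂ → ℂ :=
  Classical.epsilon (IsCenterEigenvalue Ainf ls ks)

/-- The set `{lam κ | κ ∈ I, κ = k mod 2π/X}`. -/
def arcLattice (I : Set ℝ) (lam : ℝ → ℂ) (X k : ℝ) : Set ℂ :=
  {l | ∃ κ ∈ I, (∃ n : ℤ, κ = k + n * (2 * Real.pi / X)) ∧ l = lam κ}

/-! ### Linear differential equations in a Banach algebra, and their dependence on data -/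

section LinearODE

open MeasureTheory BoundedContinuousFunction intervalIntegral

/-! Cut one period at 0 and ±X/2. Periodicity gives Ψ(X/2) = Ψ(-X/2) Ψ(X), so γ is a Floquet
multiplier exactly when a solution on [0, X/2] and a solution on [-X/2, 0] agree at 0 and match at
the two ends up to the factor γ. On both halves the coefficient is exponentially close to one that
approaches `Ainf l`. Hence conjugators P₊, P₋, nearly the identity at ±X/2, reduce the equation to
Z' = `Ainf l` Z (`HomoclinicLimit.exists_asymptotics`).

Let s, c, u be the spectral projections of `Ainf l` onto the stable part, the simple eigenvalue μ(l)
near the imaginary axis, and the unstable part. Normalize stable and unstable solutions at the end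
of each half where they are largest. The periodic Evans function then becomes, up to an explicit
nonzero factor, the determinant of a bounded 2N × 2N matching matrix (`IsTriple.det_evans`). For |l
- ls| ≤ C/X this matrix is within O(1/X) of a limiting one, whose determinant is found by block
elimination (`IsTriple.det_matching`): up to a factor bounded above and below it is d₁ - γ exp(-μ(l)
X) d₂, with d₁ = det(P₊ s + P₋ (c + u)) and d₂ = det(P₊ (s + c) + P₋ u) taken at ls. These are the
two one-sided limits of the homoclinic Evans function, because c counts as unstable on one side of
the arc and as stable on the other. Everything stays bounded because μ(ls) is imaginary, so that X
Re μ(l) = O(1).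

With L = ln(d₂/d₁), a zero l satisfies exp((ik - μ(l)) X + L) = 1 + O(1/X). Thus μ(l) = iκ + L/X +
O(1/X²) for some κ ≡ k mod 2π/X. Differentiating μ(λ_j(k)) = ik gives μ'(ls) ≠ 0, and linearizing μ
gives l = λ_j(κ) + L/(μ'(ls) X) + O(1/X²) (`exists_arcLattice_of_zero`). Conversely, on a circle of
radius R/X² about such a shifted point the linear term dominates the error, and the maximum
principle for the reciprocal produces a zero inside (`exists_zero_of_mem_arcLattice`).

Three ingredients are built from scratch. Conjugators have the form P = 1 + exp(-ηx) u with u the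
bounded solution of a perturbed hyperbolic equation; a contraction argument gives existence and
Lipschitz dependence on the coefficient (`exists_conjugator_right`). Spectral projections are
contour integrals, which gives exponential bounds uniform in the matrix. Finally, the homoclinic
Evans function is defined through arbitrary choices, and `IsHyperbolicProj.homoclinicEvans_eq`
evaluates it as det(P₊ Q + P₋ (1 - Q)) for any conjugators and the stable spectral projection Q. -/

theorem abs_integral_exp_mul_abs_le {κ : ℝ} (hκ : 0 < κ) (x : ℝ) :
    |∫ y in (0:ℝ)..x, Real.exp (κ * |y|)| ≤ Real.exp (κ * |x|) / κ := by
  have key : ∀ x : ℝ, 0 ≤ x → |∫ y in (0:ℝ)..x, Real.exp (κ * |y|)| ≤ Real.exp (κ * |x|) / κ := by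
    intro x hx
    have h1 : ∫ y in (0:ℝ)..x, Real.exp (κ * |y|) = ∫ y in (0:ℝ)..x, Real.exp (κ * y) := by
      apply integral_congr
      intro y hy
      rw [Set.uIcc_of_le hx] at hy
      simp [abs_of_nonneg hy.1]
    have h2 : ∫ y in (0:ℝ)..x, Real.exp (κ * y) = (Real.exp (κ * x) - 1) / κ := by
      rw [integral_comp_mul_left (fun y => Real.exp y) hκ.ne', integral_exp]
      simp [div_eq_inv_mul]
    rw [h1, h2, abs_of_nonneg hx, abs_of_nonneg]
    · gcongr; linarith
    · have : 1 ≤ Real.exp (κ * x) := Real.one_le_exp (by positivity)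
      apply div_nonneg _ hκ.le; linarith
  rcases le_total 0 x with hx | hx
  · exact key x hx
  · have h := key (-x) (by linarith)
    have h3 : ∫ y in (0:ℝ)..x, Real.exp (κ * |y|) = - ∫ y in (0:ℝ)..(-x), Real.exp (κ * |y|) := by
      have := integral_comp_neg (a := 0) (b := x) (fun y => Real.exp (κ * |y|))
      simp only [abs_neg, neg_zero] at this
      rw [this, integral_symm]
    rw [h3, abs_neg]
    simpa using h

variable {𝔸 : Type*} [NormedRing 𝔸] [NormedAlgebra ℂ 𝔸]

/-- Picard iteration on the whole line at once. For u = exp(-κ|x|) Ψ the integral equation is a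
fixed-point problem on bounded continuous functions with Lipschitz constant K/κ, and κ = 2K + 1
makes this at most 1/2. -/
theorem exists_linearODE_solution [CompleteSpace 𝔸] {B : ℝ → 𝔸} (hB : Continuous B) {K : ℝ}
    (hK : ∀ x, ‖B x‖ ≤ K) :
    ∃ Ψ : ℝ → 𝔸, Ψ 0 = 1 ∧ ∀ x, HasDerivAt Ψ (B x * Ψ x) x := by
  have hK0 : 0 ≤ K := (norm_nonneg _).trans (hK 0)
  set κ : ℝ := 2 * K + 1 with hκdef
  have hκ : 0 < κ := by positivity
  have hcont : ∀ u : ℝ →ᵇ 𝔸, Continuous fun y => Real.exp (κ * |y|) • (B y * u y) := fun u => by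
    have := u.continuous
    fun_prop
  have hbound : ∀ (u : ℝ →ᵇ 𝔸) (x : ℝ),
      ‖Real.exp (-(κ * |x|)) • ∫ y in (0:ℝ)..x, Real.exp (κ * |y|) • (B y * u y)‖
        ≤ K / κ * ‖u‖ := by
    intro u x
    have h1 : ‖∫ y in (0:ℝ)..x, Real.exp (κ * |y|) • (B y * u y)‖ ≤
        |∫ y in (0:ℝ)..x, Real.exp (κ * |y|) * (K * ‖u‖)| := by
      apply norm_integral_le_abs_of_norm_le
      · refine Eventually.of_forall fun y => ?_
        rw [norm_smul, Real.norm_of_nonneg (Real.exp_pos _).le]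
        gcongr
        refine (norm_mul_le _ _).trans ?_
        gcongr
        · exact hK y
        · exact u.norm_coe_le_norm y
      · apply Continuous.intervalIntegrable; fun_prop
    rw [intervalIntegral.integral_mul_const, abs_mul,
      abs_of_nonneg (by positivity : 0 ≤ K * ‖u‖)] at h1
    rw [norm_smul, Real.norm_of_nonneg (Real.exp_pos _).le]
    calc _ ≤ Real.exp (-(κ * |x|)) * (Real.exp (κ * |x|) / κ * (K * ‖u‖)) := by
          gcongr; exact h1.trans (by gcongr; exact abs_integral_exp_mul_abs_le hκ x)
      _ = K / κ * ‖u‖ * (Real.exp (-(κ * |x|)) * Real.exp (κ * |x|)) := by field_simp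
      _ = _ := by rw [← Real.exp_add]; simp
  let Tf : (ℝ →ᵇ 𝔸) → ℝ → 𝔸 := fun u x =>
    Real.exp (-(κ * |x|)) • (1 + ∫ y in (0:ℝ)..x, Real.exp (κ * |y|) • (B y * u y))
  have hTcont : ∀ u, Continuous (Tf u) := fun u => by
    have h1 : Continuous fun x => ∫ y in (0:ℝ)..x, Real.exp (κ * |y|) • (B y * u y) :=
      intervalIntegral.continuous_primitive (fun a b => (hcont u).intervalIntegrable a b) 0
    fun_prop
  let T : (ℝ →ᵇ 𝔸) → (ℝ →ᵇ 𝔸) := fun u =>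
    BoundedContinuousFunction.ofNormedAddCommGroup (Tf u) (hTcont u) (‖(1:𝔸)‖ + K / κ * ‖u‖)
      (fun x => by
        simp only [Tf, smul_add]
        refine (norm_add_le _ _).trans ?_
        refine add_le_add ?_ (hbound u x)
        rw [norm_smul, Real.norm_of_nonneg (Real.exp_pos _).le]
        have : Real.exp (-(κ * |x|)) ≤ 1 := Real.exp_le_one_iff.2 (by
          have : 0 ≤ κ * |x| := by positivity
          linarith)
        nlinarith [norm_nonneg (1:𝔸)])
  have hcontr : ContractingWith (1/2) T := by
    refine ⟨by norm_num [← NNReal.coe_lt_coe], LipschitzWith.of_dist_le_mul fun u v => ?_⟩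
    rw [BoundedContinuousFunction.dist_le (by positivity)]
    intro x
    have e : T u x - T v x = Real.exp (-(κ * |x|)) •
        ∫ y in (0:ℝ)..x, Real.exp (κ * |y|) • (B y * (u - v) y) := by
      simp only [T, Tf, coe_ofNormedAddCommGroup, ← smul_sub, add_sub_add_left_eq_sub]
      rw [← integral_sub ((hcont u).intervalIntegrable _ _) ((hcont v).intervalIntegrable _ _)]
      simp only [← smul_sub, ← mul_sub]; rfl
    rw [dist_eq_norm, e, dist_eq_norm]
    refine (hbound (u - v) x).trans ?_
    gcongr
    have : K / κ ≤ 1/2 := by rw [div_le_iff₀ hκ]; linarith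
    simpa using this
  set u := ContractingWith.fixedPoint T hcontr with hu
  have hfix : T u = u := hcontr.fixedPoint_isFixedPt
  let Ψ : ℝ → 𝔸 := fun x => 1 + ∫ y in (0:ℝ)..x, Real.exp (κ * |y|) • (B y * u y)
  have hΨ : ∀ x, Real.exp (κ * |x|) • u x = Ψ x := fun x => by
    have : u x = T u x := by rw [hfix]
    rw [this]
    simp only [T, Tf, coe_ofNormedAddCommGroup, smul_smul, ← Real.exp_add]
    simp [Ψ]
  refine ⟨Ψ, by simp [Ψ], fun x => ?_⟩
  rw [← hΨ x, mul_smul_comm]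
  exact ((hcont u).integral_hasStrictDerivAt 0 x).hasDerivAt.const_add 1

theorem linearODE_eq {B : ℝ → 𝔸} {K : ℝ} (hK : ∀ x, ‖B x‖ ≤ K) {F G : ℝ → 𝔸}
    (hF : ∀ x, HasDerivAt F (B x * F x) x) (hG : ∀ x, HasDerivAt G (B x * G x) x) {x₀ : ℝ}
    (h0 : F x₀ = G x₀) : F = G := by
  refine ODE_solution_unique_univ (v := fun x w => B x * w) (K := K.toNNReal)
    (s := fun _ => Set.univ) (fun t => ?_) (fun t => ⟨hF t, trivial⟩) (fun t => ⟨hG t, trivial⟩) h0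
  refine (LipschitzWith.of_dist_le_mul fun a b => ?_).lipschitzOnWith
  rw [dist_eq_norm, dist_eq_norm, ← mul_sub]
  refine (norm_mul_le _ _).trans ?_
  gcongr
  exact (hK t).trans (Real.le_coe_toNNReal K)

/-- Two-sided Gronwall inequality. -/
theorem norm_le_gronwallBound_abs {E : Type*} [NormedAddCommGroup E] [NormedSpace ℝ E]
    {f f' : ℝ → E} {K δ T : ℝ} (hf : ∀ x, HasDerivAt f (f' x) x)
    (hb : ∀ x, |x| ≤ T → ‖f' x‖ ≤ K * ‖f x‖ + δ) {x : ℝ} (hx : |x| ≤ T) :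
    ‖f x‖ ≤ gronwallBound ‖f 0‖ K δ |x| := by
  rcases le_total 0 x with h | h
  · have hc : ContinuousOn f (Set.Icc 0 x) := fun y _ => (hf y).continuousAt.continuousWithinAt
    have := norm_le_gronwallBound_of_norm_deriv_right_le (f := f) (f' := f') (δ := ‖f 0‖) (K := K)
      (ε := δ) (a := 0) (b := x) hc (fun y _ => (hf y).hasDerivWithinAt) le_rfl
      (fun y hy => hb y (by rw [abs_of_nonneg hy.1]; rw [abs_of_nonneg h] at hx; linarith [hy.2]))
      x ⟨h, le_rfl⟩
    simpa [abs_of_nonneg h] using this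
  · have hf2 : ∀ y, HasDerivAt (fun y => f (-y)) (-f' (-y)) y := fun y => by
      simpa [Function.comp_def] using (hf (-y)).scomp y (hasDerivAt_neg y)
    have hc : ContinuousOn (fun y => f (-y)) (Set.Icc 0 (-x)) :=
      fun y _ => (hf2 y).continuousAt.continuousWithinAt
    have := norm_le_gronwallBound_of_norm_deriv_right_le (f := fun y => f (-y))
      (f' := fun y => - f' (-y)) (δ := ‖f 0‖) (K := K)
      (ε := δ) (a := 0) (b := -x) hc (fun y _ => (hf2 y).hasDerivWithinAt) (by simp)
      (fun y hy => by
        rw [norm_neg]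
        exact hb (-y) (by
          rw [abs_neg, abs_of_nonneg hy.1]; rw [abs_of_nonpos h] at hx; linarith [hy.2]))
      (-x) ⟨by linarith, le_rfl⟩
    simpa [abs_of_nonpos h] using this

theorem linearODE_norm_le {B : ℝ → 𝔸} {K : ℝ} (hK : ∀ x, ‖B x‖ ≤ K) {F : ℝ → 𝔸}
    (hF : ∀ x, HasDerivAt F (B x * F x) x) (x : ℝ) : ‖F x‖ ≤ ‖F 0‖ * Real.exp (K * |x|) := by
  have := norm_le_gronwallBound_abs (K := K) (δ := 0) hF
    (fun y _ => by
      refine (norm_mul_le _ _).trans ?_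
      rw [add_zero]; gcongr; exact hK y) (le_refl |x|)
  rwa [gronwallBound_ε0] at this

/-- Lipschitz dependence of the solution of a linear equation on its coefficient. -/
theorem linearODE_norm_sub_le {K : ℝ} (hK0 : 0 < K) {T : ℝ} (hT : 0 ≤ T) :
    ∃ c : ℝ, 0 ≤ c ∧ ∀ (B B' : ℝ → 𝔸) (F F' : ℝ → 𝔸) (δ : ℝ),
      (∀ x, ‖B x‖ ≤ K) → (∀ x, ‖B' x‖ ≤ K) → (∀ x, |x| ≤ T → ‖B x - B' x‖ ≤ δ) →
      (∀ x, HasDerivAt F (B x * F x) x) → (∀ x, HasDerivAt F' (B' x * F' x) x) →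
      F 0 = 1 → F' 0 = 1 → ∀ x, |x| ≤ T → ‖F x - F' x‖ ≤ c * δ := by
  refine ⟨‖(1:𝔸)‖ * Real.exp (K * T) * (Real.exp (K * T) - 1) / K, ?_, ?_⟩
  · have : 1 ≤ Real.exp (K * T) := Real.one_le_exp (by positivity)
    have : 0 ≤ Real.exp (K * T) - 1 := by linarith
    positivity
  intro B B' F F' δ hB hB' hδ hF hF' h0 h0' x hx
  have hδ0 : 0 ≤ δ := (norm_nonneg _).trans (hδ 0 (by simpa using hT))
  have hd : ∀ y, HasDerivAt (fun y => F y - F' y) (B y * F y - B' y * F' y) y :=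
    fun y => (hF y).sub (hF' y)
  have := norm_le_gronwallBound_abs (K := K) (δ := δ * (‖(1:𝔸)‖ * Real.exp (K * T))) (T := T) hd
    (fun y hy => by
      have e : B y * F y - B' y * F' y = B y * (F y - F' y) + (B y - B' y) * F' y := by noncomm_ring
      rw [e]
      refine (norm_add_le _ _).trans (add_le_add ?_ ?_)
      · refine (norm_mul_le _ _).trans ?_
        gcongr; exact hB y
      · refine (norm_mul_le _ _).trans ?_
        gcongr
        · exact hδ y hy
        · refine (linearODE_norm_le hB' hF' y).trans ?_
          rw [h0']; gcongr) hx
  rw [h0, h0', sub_self, norm_zero, gronwallBound_of_K_ne_0 hK0.ne'] at this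
  simp only [zero_mul, zero_add] at this
  refine this.trans ?_
  rw [div_mul_eq_mul_div, div_mul_eq_mul_div]
  have e2 : Real.exp (K * |x|) ≤ Real.exp (K * T) := by gcongr
  rw [div_le_div_iff_of_pos_right hK0]
  have := norm_nonneg (1:𝔸)
  calc _ ≤ δ * (‖(1:𝔸)‖ * Real.exp (K * T)) * (Real.exp (K * T) - 1) := by gcongr
    _ = _ := by ring

/-- The fundamental solution is invertible. -/
theorem linearODE_isUnit [CompleteSpace 𝔸] {B : ℝ → 𝔸} (hB : Continuous B) {K : ℝ}
    (hK : ∀ x, ‖B x‖ ≤ K)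
    {Ψ : ℝ → 𝔸} (h0 : Ψ 0 = 1) (hΨ : ∀ x, HasDerivAt Ψ (B x * Ψ x) x) (x : ℝ) :
    IsUnit (Ψ x) := by
  obtain ⟨Φ, hΦ0, hΦ⟩ := exists_linearODE_solution (B := fun y => B (y + x))
    (by fun_prop) (fun y => hK (y + x))
  -- Φ is the fundamental solution started at x. The two flow identities, read at 0, exhibit `Φ
  -- (-x)` as a two-sided inverse of `Ψ x`.
  have h1 : (fun y => Φ (y - x) * Ψ x) = Ψ := by
    refine linearODE_eq hK (x₀ := x) (fun y => ?_) hΨ (by simp [hΦ0])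
    have := (hΦ (y - x)).comp_sub_const y x
    simp only [sub_add_cancel] at this
    simpa [mul_assoc] using this.mul_const (Ψ x)
  have h2 : (fun y => Ψ (y + x) * Φ (-x)) = Φ := by
    refine linearODE_eq (B := fun y => B (y + x)) (fun y => hK (y + x)) (x₀ := -x)
      (fun y => ?_) hΦ (by simp [h0])
    have := (hΨ (y + x)).comp_add_const y x
    simpa [mul_assoc] using this.mul_const (Φ (-x))
  have e1 := congrFun h1 0
  have e2 := congrFun h2 0
  simp only [zero_sub, zero_add, h0, hΦ0] at e1 e2
  exact ⟨⟨Ψ x, Φ (-x), e2, e1⟩, rfl⟩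

theorem linearODE_periodic {B : ℝ → 𝔸} {K : ℝ} (hK : ∀ x, ‖B x‖ ≤ K) {X : ℝ}
    (hper : ∀ x, B (x + X) = B x)
    {Ψ : ℝ → 𝔸} (h0 : Ψ 0 = 1) (hΨ : ∀ x, HasDerivAt Ψ (B x * Ψ x) x) (x : ℝ) :
    Ψ (x + X) = Ψ x * Ψ X := by
  have : (fun y => Ψ (y + X)) = fun y => Ψ y * Ψ X := by
    refine linearODE_eq hK (x₀ := 0) (fun y => ?_) (fun y => ?_) (by simp [h0])
    · have := (hΨ (y + X)).comp_add_const y X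
      rwa [hper] at this
    · simpa [mul_assoc] using (hΨ y).mul_const (Ψ X)
  exact congrFun this x

/-- Solutions of a linear equation depend holomorphically on a parameter of its coefficient. -/
theorem linearODE_differentiableAt_param [CompleteSpace 𝔸]
    {B : ℂ → ℝ → 𝔸} {l₀ : ℂ} {r K : ℝ} (hr : 0 < r)
    (hcont : ∀ l ∈ Metric.ball l₀ r, Continuous (B l))
    (hK : ∀ l ∈ Metric.ball l₀ r, ∀ x, ‖B l x‖ ≤ K)
    (hhol : ∀ x, DifferentiableOn ℂ (fun l => B l x) (Metric.ball l₀ r))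
    {Ψ : ℂ → ℝ → 𝔸} (h0 : ∀ l ∈ Metric.ball l₀ r, Ψ l 0 = 1)
    (hΨ : ∀ l ∈ Metric.ball l₀ r, ∀ x, HasDerivAt (Ψ l) (B l x * Ψ l x) x) (T : ℝ) :
    DifferentiableAt ℂ (fun l => Ψ l T) l₀ := by
  have hl₀ : l₀ ∈ Metric.ball l₀ r := Metric.mem_ball_self hr
  have hK0 : 0 ≤ K := (norm_nonneg _).trans (hK l₀ hl₀ 0)
  -- Lipschitz bound for the coefficient
  have hlip : ∀ l ∈ Metric.ball l₀ r, ∀ x, ‖B l x - B l₀ x‖ ≤ 2 * K / r * ‖l - l₀‖ := by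
    intro l hl x
    have := Complex.dist_le_div_mul_dist_of_mapsTo_ball (R₂ := 2 * K) (hhol x) (fun m hm => by
      rw [mem_closedBall_iff_norm]
      refine (norm_sub_le _ _).trans ?_
      have h1 := hK m hm x
      have h2 := hK l₀ hl₀ x
      linarith) hl
    rwa [dist_eq_norm, dist_eq_norm] at this
  obtain ⟨c, hc0, hc⟩ := linearODE_norm_sub_le (𝔸 := 𝔸) (K := K + 1) (by positivity) (abs_nonneg T)
  have hΨlip : ∀ l ∈ Metric.ball l₀ r, ∀ x, |x| ≤ |T| →
      ‖Ψ l x - Ψ l₀ x‖ ≤ c * (2 * K / r * ‖l - l₀‖) := fun l hl x hx =>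
    hc (B l) (B l₀) (Ψ l) (Ψ l₀) _ (fun y => (hK l hl y).trans (by linarith))
      (fun y => (hK l₀ hl₀ y).trans (by linarith)) (fun y _ => hlip l hl y) (hΨ l hl) (hΨ l₀ hl₀)
      (h0 l hl) (h0 l₀ hl₀) x hx
  have hunit : ∀ x, IsUnit (Ψ l₀ x) := linearODE_isUnit (hcont l₀ hl₀) (hK l₀ hl₀) (h0 l₀ hl₀)
    (hΨ l₀ hl₀)
  -- Variation of constants: with Z = Ψ(l₀)⁻¹ one has (Z Ψ(l))' = Z (B(l) - B(l₀)) Ψ(l). So Ψ(l) is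
  -- Ψ(l₀) times 1 plus an integral whose integrand vanishes at l = l₀, and only that integral has
  -- to be differentiated.
  set Z : ℝ → 𝔸 := fun x => Ring.inverse (Ψ l₀ x) with hZdef
  have hZ : ∀ x, HasDerivAt Z (-(Z x * B l₀ x)) x := by
    intro x
    obtain ⟨u, hu⟩ := hunit x
    have h1 := hasFDerivAt_ringInverse (𝕜 := ℝ) u
    rw [hu] at h1
    have h2 := h1.comp_hasDerivAt x (hΨ l₀ hl₀ x)
    have h3 : Z x = ↑u⁻¹ := by simp [hZdef, ← hu]
    convert! h2 using 1
    rw [h3, ← hu]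
    simp [mul_assoc]
  have hZc : Continuous Z := continuous_iff_continuousAt.2 fun x => (hZ x).continuousAt
  have hΨc : ∀ l ∈ Metric.ball l₀ r, Continuous (Ψ l) := fun l hl =>
    continuous_iff_continuousAt.2 fun x => (hΨ l hl x).continuousAt
  let g : ℂ → ℝ → 𝔸 := fun l y => Z y * (B l y - B l₀ y) * Ψ l y
  have hgc : ∀ l ∈ Metric.ball l₀ r, Continuous (g l) := fun l hl => by
    have := hcont l hl
    have := hcont l₀ hl₀
    have := hΨc l hl
    fun_prop
  have hduh : ∀ l ∈ Metric.ball l₀ r, Ψ l T = Ψ l₀ T * (1 + ∫ y in (0:ℝ)..T, g l y) := by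
    intro l hl
    have hd : ∀ y, HasDerivAt (fun y => Z y * Ψ l y) (g l y) y := fun y => by
      convert! (hZ y).mul (hΨ l hl y) using 1
      simp only [g]; noncomm_ring
    rw [integral_eq_sub_of_hasDerivAt (fun y _ => hd y) ((hgc l hl).intervalIntegrable _ _)]
    have e : Z 0 * Ψ l 0 = 1 := by simp [hZdef, h0 l hl, h0 l₀ hl₀]
    rw [e, add_sub_cancel, ← mul_assoc]
    simp only [hZdef]
    rw [Ring.mul_inverse_cancel _ (hunit T), one_mul]
  -- differentiate under the integral sign
  obtain ⟨b, hb⟩ : ∃ b, ∀ y ∈ Set.uIcc 0 T, ‖Z y‖ ≤ b := by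
    obtain ⟨b, hb⟩ := isCompact_uIcc.exists_bound_of_continuousOn (s := Set.uIcc 0 T)
      hZc.continuousOn
    exact ⟨b, hb⟩
  have hb0 : 0 ≤ b := (norm_nonneg _).trans (hb 0 Set.left_mem_uIcc)
  have habs : ∀ y ∈ Set.uIoc 0 T, |y| ≤ |T| := fun y hy => by
    have := Set.abs_sub_left_of_mem_uIcc (Set.uIoc_subset_uIcc hy)
    simpa using this
  set D : ℝ → 𝔸 := fun y => deriv (fun l => B l y) l₀ with hD
  have hgd : ∀ y ∈ Set.uIoc 0 T, HasDerivAt (fun l => g l y) (Z y * D y * Ψ l₀ y) l₀ := by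
    intro y hy
    have hBd : HasDerivAt (fun l => B l y) (D y) l₀ :=
      ((hhol y).differentiableAt (Metric.ball_mem_nhds _ hr)).hasDerivAt
    have hΨt : Tendsto (fun l => Ψ l y) (𝓝 l₀) (𝓝 (Ψ l₀ y)) := by
      rw [tendsto_iff_norm_sub_tendsto_zero]
      have h1 : Tendsto (fun l => c * (2 * K / r * ‖l - l₀‖)) (𝓝 l₀) (𝓝 0) := by
        have : Continuous fun l => c * (2 * K / r * ‖l - l₀‖) := by fun_prop
        simpa using this.tendsto l₀
      refine squeeze_zero' (Eventually.of_forall fun _ => norm_nonneg _) ?_ h1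
      filter_upwards [Metric.ball_mem_nhds l₀ hr] with l hl using hΨlip l hl y (habs y hy)
    rw [hasDerivAt_iff_tendsto_slope] at hBd ⊢
    have : slope (fun l => g l y) l₀ = fun l => Z y * slope (fun l => B l y) l₀ l * Ψ l y := by
      funext l
      simp [slope, g]
    rw [this]
    exact ((hBd.const_mul (Z y)).mul (hΨt.mono_left nhdsWithin_le_nhds))
  have hgb : ∀ l ∈ Metric.ball l₀ r, ∀ y ∈ Set.uIoc 0 T, ‖g l y - g l₀ y‖ ≤
      b * (2 * K / r) * (‖(1:𝔸)‖ * Real.exp (K * |T|)) * ‖l - l₀‖ := by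
    intro l hl y hy
    have e : g l₀ y = 0 := by simp [g]
    rw [e, sub_zero]
    have h1 : ‖Ψ l y‖ ≤ ‖(1:𝔸)‖ * Real.exp (K * |T|) := by
      refine (linearODE_norm_le (hK l hl) (hΨ l hl) y).trans ?_
      rw [h0 l hl]
      exact mul_le_mul_of_nonneg_left
        (Real.exp_le_exp.2 (mul_le_mul_of_nonneg_left (habs y hy) hK0)) (norm_nonneg _)
    calc ‖g l y‖ ≤ ‖Z y‖ * ‖B l y - B l₀ y‖ * ‖Ψ l y‖ :=
          (norm_mul_le _ _).trans (by gcongr; exact norm_mul_le _ _)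
      _ ≤ b * (2 * K / r * ‖l - l₀‖) * (‖(1:𝔸)‖ * Real.exp (K * |T|)) := by
          gcongr
          · exact hb y (Set.uIoc_subset_uIcc hy)
          · exact hlip l hl y
      _ = _ := by ring
  -- The derivative in l is a pointwise limit of difference quotients, which are continuous in y;
  -- the points l₀ + r/(n + 2) stay in the ball and avoid l₀.
  have hDm : StronglyMeasurable D := by
    have hu : ∀ n : ℕ, l₀ + ((r / (n + 2) : ℝ) : ℂ) ∈ Metric.ball l₀ r := fun n => by
      rw [mem_ball_iff_norm, add_sub_cancel_left, Complex.norm_real, Real.norm_eq_abs,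
        abs_of_nonneg (by positivity)]
      rw [div_lt_iff₀ (by positivity)]
      nlinarith [(Nat.cast_nonneg n : (0:ℝ) ≤ n)]
    refine stronglyMeasurable_of_tendsto (u := atTop)
      (f := fun (n : ℕ) y => slope (fun l => B l y) l₀ (l₀ + ((r / (n + 2) : ℝ) : ℂ)))
      (fun n => ?_) ?_
    · simp only [slope, vsub_eq_sub]
      exact (((hcont _ (hu n)).sub (hcont _ hl₀)).const_smul _).stronglyMeasurable
    · rw [tendsto_pi_nhds]
      intro y
      have hBd : HasDerivAt (fun l => B l y) (D y) l₀ :=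
        ((hhol y).differentiableAt (Metric.ball_mem_nhds _ hr)).hasDerivAt
      rw [hasDerivAt_iff_tendsto_slope] at hBd
      refine hBd.comp (tendsto_nhdsWithin_iff.2 ⟨?_, Eventually.of_forall fun n => ?_⟩)
      · have h1 : Tendsto (fun n : ℕ => r / ((n:ℝ) + 2)) atTop (𝓝 0) :=
          tendsto_const_nhds.div_atTop
            (tendsto_atTop_add_const_right _ _ tendsto_natCast_atTop_atTop)
        have h2 := (Complex.continuous_ofReal.tendsto 0).comp h1
        simpa using (tendsto_const_nhds (x := l₀)).add h2
      · have : (0:ℝ) < r / (n + 2) := by positivity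
        simpa using (by exact_mod_cast this.ne' : ((r / (n + 2) : ℝ) : ℂ) ≠ 0)
  have hint : DifferentiableAt ℂ (fun l => ∫ y in (0:ℝ)..T, g l y) l₀ := by
    have key := hasFDerivAt_integral_of_dominated_loc_of_lip' (𝕜 := ℂ)
      (μ := volume.restrict (Set.uIoc 0 T)) (F := g) (x₀ := l₀)
      (F' := fun y => ContinuousLinearMap.toSpanSingleton ℂ (Z y * D y * Ψ l₀ y))
      (bound := fun _ => b * (2 * K / r) * (‖(1:𝔸)‖ * Real.exp (K * |T|)))
      (Metric.ball_mem_nhds l₀ hr)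
      (fun l hl => (hgc l hl).aestronglyMeasurable)
      ((hgc l₀ hl₀).integrableOn_uIoc)
      (by
        refine StronglyMeasurable.aestronglyMeasurable ?_
        exact (ContinuousLinearMap.toSpanSingletonCLE (𝕜 := ℂ) (E := 𝔸)).continuous.comp_stronglyMeasurable
          ((hZc.stronglyMeasurable.mul hDm).mul (hΨc l₀ hl₀).stronglyMeasurable))
      ((ae_restrict_iff' measurableSet_uIoc).2 (Eventually.of_forall fun y hy l hl =>
        hgb l hl y hy))
      (by
        exact integrableOn_const (by simp [Set.uIoc]))
      ((ae_restrict_iff' measurableSet_uIoc).2 (Eventually.of_forall fun y hy =>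
        (hgd y hy).hasFDerivAt))
    have h2 := key.2.differentiableAt
    have e : (fun l => ∫ y in (0:ℝ)..T, g l y) =
        fun l => (if (0:ℝ) ≤ T then (1:ℝ) else -1) • ∫ y in Set.uIoc 0 T, g l y := by
      funext l
      rw [intervalIntegral_eq_integral_uIoc]
    rw [e]
    split_ifs
    · simpa using h2
    · simpa using h2.neg
  have : DifferentiableAt ℂ (fun l => Ψ l₀ T * (1 + ∫ y in (0:ℝ)..T, g l y)) l₀ :=
    (hint.const_add 1).const_mul (Ψ l₀ T)
  refine this.congr_of_eventuallyEq ?_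
  filter_upwards [Metric.ball_mem_nhds l₀ hr] with l hl using hduh l hl

end LinearODE

/-! ### Riesz projections and the contour functional calculus -/

section ContourProjection

open MeasureTheory Metric

variable {𝔸 : Type*} [NormedRing 𝔸] [NormedAlgebra ℂ 𝔸]

/-- The Riesz contour integral `(2πi)⁻¹ ∮ f(z) (z - a)⁻¹ dz`. -/
noncomputable def contourCalculus (c : ℂ) (R : ℝ) (f : ℂ → ℂ) (a : 𝔸) : 𝔸 :=
  (2 * Real.pi * Complex.I : ℂ)⁻¹ • ∮ z in C(c, R), f z • resolvent a z

/-- The Riesz projection `(2πi)⁻¹ ∮ (z - a)⁻¹ dz`. -/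
noncomputable def contourProj (c : ℂ) (R : ℝ) (a : 𝔸) : 𝔸 := contourCalculus c R (fun _ => 1) a

theorem circleIntegral_clm [CompleteSpace 𝔸] (L : 𝔸 →L[ℂ] 𝔸) {f : ℂ → 𝔸} {c : ℂ} {R : ℝ}
    (hf : CircleIntegrable f c R) : ∮ z in C(c, R), L (f z) = L (∮ z in C(c, R), f z) := by
  simp only [circleIntegral]
  have := L.intervalIntegral_comp_comm hf.out
  rw [← this]
  simp

theorem resolvent_mul_left {a : 𝔸} {z : ℂ} (hz : z ∈ resolventSet ℂ a) :
    a * resolvent a z = z • resolvent a z - 1 := by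
  have h := Ring.mul_inverse_cancel _ hz
  rw [sub_mul, ← Algebra.smul_def] at h
  rw [resolvent, ← h]; abel

theorem resolvent_mul_right {a : 𝔸} {z : ℂ} (hz : z ∈ resolventSet ℂ a) :
    resolvent a z * a = z • resolvent a z - 1 := by
  have h := Ring.inverse_mul_cancel _ hz
  rw [mul_sub, ← Algebra.commutes, ← Algebra.smul_def] at h
  rw [resolvent, ← h]; abel

theorem continuousOn_resolvent [CompleteSpace 𝔸] {a : 𝔸} {s : Set ℂ} (hs : s ⊆ resolventSet ℂ a) :
    ContinuousOn (resolvent a) s := fun _ hz =>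
  (spectrum.hasDerivAt_resolvent_const_left (hs hz)).continuousAt.continuousWithinAt

section

variable {a : 𝔸} {c : ℂ} {R : ℝ}

theorem circleIntegrable_resolvent [CompleteSpace 𝔸] (hR : 0 ≤ R)
    (hs : sphere c R ⊆ resolventSet ℂ a) {f : ℂ → ℂ}
    (hf : ContinuousOn f (sphere c R)) : CircleIntegrable (fun z => f z • resolvent a z) c R :=
  (hf.smul (continuousOn_resolvent hs)).circleIntegrable hR

theorem contourCalculus_comm [CompleteSpace 𝔸] (hR : 0 ≤ R) (hs : sphere c R ⊆ resolventSet ℂ a)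
    {f : ℂ → ℂ}
    (hf : ContinuousOn f (sphere c R)) : a * contourCalculus c R f a = contourCalculus c R f a * a := by
  have hi := circleIntegrable_resolvent hR hs hf
  have h1 := circleIntegral_clm (ContinuousLinearMap.mul ℂ 𝔸 a) hi
  have h2 := circleIntegral_clm ((ContinuousLinearMap.mul ℂ 𝔸).flip a) hi
  simp only [ContinuousLinearMap.mul_apply', ContinuousLinearMap.flip_apply] at h1 h2
  rw [contourCalculus, mul_smul_comm, smul_mul_assoc, ← h1, ← h2]
  congr 1
  refine circleIntegral.integral_congr hR fun z hz => ?_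
  simp only [mul_smul_comm, smul_mul_assoc, resolvent_mul_left (hs hz), resolvent_mul_right (hs hz)]

/-- Each factor z can be traded for a factor a, since a (z - a)⁻¹ = z (z - a)⁻¹ - 1 and the
polynomial left over integrates to zero. -/
theorem circleIntegral_pow_smul_resolvent [CompleteSpace 𝔸] (hR : 0 ≤ R)
    (hs : sphere c R ⊆ resolventSet ℂ a)
    (n : ℕ) : ∮ z in C(c, R), z ^ n • resolvent a z = a ^ n * ∮ z in C(c, R), resolvent a z := by
  induction n with
  | zero => simp
  | succ n ih =>
    have hi := circleIntegrable_resolvent hR hs (f := fun z => z ^ n) (by fun_prop)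
    have h1 := circleIntegral_clm (ContinuousLinearMap.mul ℂ 𝔸 a) hi
    simp only [ContinuousLinearMap.mul_apply'] at h1
    rw [pow_succ', mul_assoc, ← ih, ← h1]
    have h2 : ∮ z in C(c, R), (z ^ n) • (1 : 𝔸) = 0 := by
      have := Complex.circleIntegral_eq_zero_of_differentiable_on_off_countable hR
        Set.countable_empty (f := fun z : ℂ => z ^ n • (1 : 𝔸)) (c := c)
        (by fun_prop) (fun _ _ => by fun_prop)
      exact this
    have h3 : ∮ z in C(c, R), z ^ (n + 1) • resolvent a z =
        ∮ z in C(c, R), (a * z ^ n • resolvent a z + z ^ n • (1 : 𝔸)) := by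
      refine circleIntegral.integral_congr hR fun z hz => ?_
      simp only [mul_smul_comm, resolvent_mul_left (hs hz), smul_sub, smul_smul, pow_succ,
        sub_add_cancel]
    rw [h3, circleIntegral.integral_add, h2, add_zero]
    · exact (ContinuousOn.circleIntegrable hR
        ((continuousOn_const.mul ((by fun_prop : ContinuousOn (fun z : ℂ => z ^ n) _).smul
          (continuousOn_resolvent hs)))))
    · exact ContinuousOn.circleIntegrable hR (by fun_prop)

/-- The holomorphic functional calculus is compatible with the exponential. -/
theorem exp_mul_contourProj [CompleteSpace 𝔸] (hR : 0 ≤ R) (hs : sphere c R ⊆ resolventSet ℂ a)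
    (t : ℂ) :
    NormedSpace.exp (t • a) * contourProj c R a =
      contourCalculus c R (fun z => Complex.exp (t * z)) a := by
  obtain ⟨K, hK⟩ := (isCompact_sphere c R).exists_bound_of_continuousOn (continuousOn_resolvent hs)
  have hm : ∀ θ, circleMap c R θ ∈ sphere c R := fun θ => circleMap_mem_sphere c hR θ
  have hK0 : 0 ≤ K := (norm_nonneg _).trans (hK _ (hm 0))
  have hcr : Continuous fun θ => resolvent a (circleMap c R θ) :=
    (continuousOn_resolvent hs).comp_continuous (continuous_circleMap c R) hm
  have hz : ∀ θ, ‖circleMap c R θ‖ ≤ ‖c‖ + R := fun θ => by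
    have := hm θ
    rw [mem_sphere_iff_norm] at this
    calc ‖circleMap c R θ‖ = ‖c + (circleMap c R θ - c)‖ := by congr 1; ring
      _ ≤ _ := (norm_add_le _ _).trans (by rw [this])
  set q : ℝ := ‖t‖ * (‖c‖ + R) with hq
  have hq0 : 0 ≤ q := by positivity
  -- Expand exp(tz) under the integral; term by term, powers of z become powers of a.
  have key := intervalIntegral.hasSum_integral_of_dominated_convergence (μ := volume) (a := 0)
    (b := 2 * Real.pi)
    (F := fun (n : ℕ) θ => deriv (circleMap c R) θ •
      (((n.factorial : ℂ)⁻¹ * t ^ n) • (circleMap c R θ ^ n • resolvent a (circleMap c R θ))))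
    (f := fun θ => deriv (circleMap c R) θ • (Complex.exp (t * circleMap c R θ) •
      resolvent a (circleMap c R θ)))
    (fun n _ => R * K * (q ^ n / n.factorial)) (fun n => ?_) (fun n => ?_) ?_ ?_ ?_
  · have e1 : ∀ n : ℕ, (∫ θ in (0:ℝ)..2 * Real.pi, deriv (circleMap c R) θ •
      (((n.factorial : ℂ)⁻¹ * t ^ n) • (circleMap c R θ ^ n • resolvent a (circleMap c R θ)))) =
      ((n.factorial : ℂ)⁻¹ • (t • a) ^ n) * ∮ z in C(c, R), resolvent a z := fun n => by
      rw [smul_pow, smul_smul, smul_mul_assoc, ← circleIntegral_pow_smul_resolvent hR hs,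
        ← circleIntegral.integral_smul]
      rfl
    simp only [e1] at key
    have h2 := (NormedSpace.exp_series_hasSum_exp' (𝕂 := ℂ) (t • a)).mul_right
      (∮ z in C(c, R), resolvent a z)
    have h3 := key.unique h2
    simp only [contourProj, contourCalculus, one_smul, mul_smul_comm, ← h3]
    rfl
  · refine Continuous.aestronglyMeasurable ?_
    simp only [deriv_circleMap]
    fun_prop
  · refine Eventually.of_forall fun θ _ => ?_
    rw [norm_smul, norm_smul, norm_smul, norm_mul, norm_inv, norm_pow, norm_pow, deriv_circleMap,
      norm_mul, norm_circleMap_zero, Complex.norm_I, mul_one, abs_of_nonneg hR, Complex.norm_natCast]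
    have h1 : ‖circleMap c R θ‖ ^ n ≤ (‖c‖ + R) ^ n := by gcongr; exact hz θ
    calc _ ≤ R * ((n.factorial : ℝ)⁻¹ * ‖t‖ ^ n * ((‖c‖ + R) ^ n * K)) := by
          gcongr
          exact hK _ (hm θ)
      _ = _ := by rw [hq, mul_pow]; field_simp
  · exact Eventually.of_forall fun θ _ => (Real.summable_pow_div_factorial q).mul_left _
  · exact intervalIntegrable_const
  · refine Eventually.of_forall fun θ _ => ?_
    refine HasSum.const_smul _ ?_
    have h1 := NormedSpace.exp_series_hasSum_exp' (𝕂 := ℂ) (t * circleMap c R θ)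
    rw [← Complex.exp_eq_exp_ℂ] at h1
    have h2 := h1.smul_const (resolvent a (circleMap c R θ))
    convert! h2 using 2 with n
    rw [smul_smul, mul_pow, smul_eq_mul]; ring_nf

theorem norm_contourCalculus_le (hR : 0 ≤ R) {f : ℂ → ℂ} {K m : ℝ}
    (hK : ∀ z ∈ sphere c R, ‖resolvent a z‖ ≤ K) (hf : ∀ z ∈ sphere c R, ‖f z‖ ≤ m) :
    ‖contourCalculus c R f a‖ ≤ R * (m * K) := by
  refine circleIntegral.norm_two_pi_i_inv_smul_integral_le_of_norm_le_const hR fun z hz => ?_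
  rw [norm_smul]
  have := (norm_nonneg _).trans (hf z hz)
  gcongr
  · exact hf z hz
  · exact hK z hz

theorem resolvent_sub {a b : 𝔸} {z : ℂ} (ha : z ∈ resolventSet ℂ a) (hb : z ∈ resolventSet ℂ b) :
    resolvent a z - resolvent b z = resolvent a z * (a - b) * resolvent b z := by
  rw [mul_sub, sub_mul, resolvent_mul_right ha, mul_assoc, resolvent_mul_left hb]
  simp [sub_mul, mul_sub]

theorem norm_contourProj_sub_le [CompleteSpace 𝔸] (hR : 0 ≤ R) {b : 𝔸}
    (ha : sphere c R ⊆ resolventSet ℂ a)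
    (hb : sphere c R ⊆ resolventSet ℂ b) {K : ℝ} (hKa : ∀ z ∈ sphere c R, ‖resolvent a z‖ ≤ K)
    (hKb : ∀ z ∈ sphere c R, ‖resolvent b z‖ ≤ K) :
    ‖contourProj c R a - contourProj c R b‖ ≤ R * (K ^ 2 * ‖a - b‖) := by
  simp only [contourProj, contourCalculus, one_smul]
  rw [← smul_sub, ← circleIntegral.integral_sub
    ((continuousOn_resolvent ha).circleIntegrable hR) ((continuousOn_resolvent hb).circleIntegrable hR)]
  refine circleIntegral.norm_two_pi_i_inv_smul_integral_le_of_norm_le_const hR fun z hz => ?_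
  have hK0 := (norm_nonneg _).trans (hKa z hz)
  rw [resolvent_sub (ha hz) (hb hz)]
  calc _ ≤ ‖resolvent a z‖ * ‖a - b‖ * ‖resolvent b z‖ :=
        (norm_mul_le _ _).trans (by gcongr; exact norm_mul_le _ _)
    _ ≤ K * ‖a - b‖ * K := by gcongr; exacts [hKa z hz, hKb z hz]
    _ = _ := by ring

/-- Lowers the height of a generalized eigenvector x by one, at the price of a factor (z - μ)⁻¹. -/
theorem resolvent_mul_sub {z μ : ℂ} (hz : z ∈ resolventSet ℂ a) (hzμ : z ≠ μ) (x : 𝔸) :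
    resolvent a z * x = (z - μ)⁻¹ • x + (z - μ)⁻¹ • (resolvent a z * ((a - algebraMap ℂ 𝔸 μ) * x)) := by
  have hne : z - μ ≠ 0 := sub_ne_zero.2 hzμ
  rw [← smul_add, eq_inv_smul_iff₀ hne, ← mul_assoc, mul_sub, resolvent_mul_right hz,
    ← Algebra.commutes, ← Algebra.smul_def, sub_smul, sub_mul, sub_mul, smul_mul_assoc,
    smul_mul_assoc]
  simp only [one_mul]
  abel

/-- Induction on the height k. The exponent m is kept general because each step adds one to it; once
an exponent exceeds one, the integral of that power of (z - μ)⁻¹ vanishes, so only the first term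
with m = 0 survives. -/
theorem circleIntegral_zpow_smul_resolvent_mul [CompleteSpace 𝔸] (hR : 0 ≤ R)
    (hs : sphere c R ⊆ resolventSet ℂ a)
    {μ : ℂ} (hμ : μ ∉ sphere c R) (k : ℕ) : ∀ (x : 𝔸), (a - algebraMap ℂ 𝔸 μ) ^ k * x = 0 →
    ∀ m : ℕ, ∮ z in C(c, R), ((z - μ)⁻¹ ^ m) • (resolvent a z * x) =
      if m = 0 then (∮ z in C(c, R), (z - μ)⁻¹) • x else 0 := by
  have hne : ∀ z ∈ sphere c R, z - μ ≠ 0 := fun z hz h => hμ (by rwa [← sub_eq_zero.1 h])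
  have hinv : ContinuousOn (fun z : ℂ => (z - μ)⁻¹) (sphere c R) :=
    ContinuousOn.inv₀ (by fun_prop) hne
  induction k with
  | zero => intro x hx m; simp only [pow_zero, one_mul] at hx; simp [hx, circleIntegral]
  | succ k ih =>
    intro x hx m
    have h1 : ∮ z in C(c, R), ((z - μ)⁻¹ ^ m) • (resolvent a z * x) =
        ∮ z in C(c, R), ((z - μ)⁻¹ ^ (m + 1) • x +
          (z - μ)⁻¹ ^ (m + 1) • (resolvent a z * ((a - algebraMap ℂ 𝔸 μ) * x))) := by
      refine circleIntegral.integral_congr hR fun z hz => ?_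
      rw [resolvent_mul_sub (hs hz) (sub_ne_zero.1 (hne z hz)) x, smul_add, smul_smul, smul_smul,
        ← pow_succ]
    rw [h1, circleIntegral.integral_add, ih _ (by rw [← mul_assoc, ← pow_succ, hx]),
      if_neg (Nat.succ_ne_zero m), add_zero, circleIntegral.integral_smul_const]
    · split_ifs with hm
      · subst hm; simp
      · have : ∮ z in C(c, R), (z - μ)⁻¹ ^ (m + 1) = 0 := by
          have := circleIntegral.integral_sub_zpow_of_ne (n := -(m + 1 : ℤ)) (by omega) c μ R
          rw [← this]
          refine circleIntegral.integral_congr hR fun z hz => ?_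
          rw [zpow_neg, inv_pow]; norm_cast
        rw [this, zero_smul]
    · exact ContinuousOn.circleIntegrable hR ((hinv.pow _).smul continuousOn_const)
    · exact ContinuousOn.circleIntegrable hR ((hinv.pow _).smul
        ((continuousOn_resolvent hs).mul continuousOn_const))

-- Here x ranges over the algebra, on which a acts by left multiplication. In finite dimension such
-- x span, so this evaluation determines the projection, and algebraic identities between
-- projections can be checked on generalized eigenvectors without deforming contours.
open Classical in
theorem contourProj_mul_genEigenvector [CompleteSpace 𝔸] (hR : 0 ≤ R)
    (hs : sphere c R ⊆ resolventSet ℂ a)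
    {μ : ℂ} (hμ : μ ∉ sphere c R) {k : ℕ} {x : 𝔸} (hx : (a - algebraMap ℂ 𝔸 μ) ^ k * x = 0) :
    contourProj c R a * x = if μ ∈ ball c R then x else 0 := by
  have h1 := circleIntegral_zpow_smul_resolvent_mul hR hs hμ k x hx 0
  simp only [pow_zero, one_smul, if_true] at h1
  have h2 := circleIntegral_clm ((ContinuousLinearMap.mul ℂ 𝔸).flip x)
    ((continuousOn_resolvent hs).circleIntegrable hR)
  simp only [ContinuousLinearMap.mul_apply', ContinuousLinearMap.flip_apply] at h2
  simp only [contourProj, contourCalculus, one_smul, smul_mul_assoc]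
  rw [← h2, h1, smul_smul]
  split_ifs with h
  · rw [circleIntegral.integral_sub_inv_of_mem_ball h, inv_mul_cancel₀ Complex.two_pi_I_ne_zero,
      one_smul]
  · have h0 : ∮ z in C(c, R), (z - μ)⁻¹ = 0 := by
      have hne : ∀ z ∈ closedBall c R, z - μ ≠ 0 := fun z hz h' => by
        rw [sub_eq_zero.1 h', ← sphere_union_ball] at hz
        exact hz.elim hμ h
      refine Complex.circleIntegral_eq_zero_of_differentiable_on_off_countable hR
        Set.countable_empty (ContinuousOn.inv₀ (by fun_prop) hne) (fun z hz => ?_)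
      exact DifferentiableAt.inv (by fun_prop) (hne z (ball_subset_closedBall hz.1))
    rw [h0, mul_zero, zero_smul]

end

/-- Generalized eigenvectors span: an element annihilating them all vanishes. -/
theorem eq_zero_of_mul_genEigenvector [FiniteDimensional ℂ 𝔸] {a b : 𝔸}
    (h : ∀ μ ∈ spectrum ℂ a, ∀ (k : ℕ) (x : 𝔸), (a - algebraMap ℂ 𝔸 μ) ^ k * x = 0 → b * x = 0) :
    b = 0 := by
  have htop := Module.End.iSup_maxGenEigenspace_eq_top (LinearMap.mulLeft ℂ a)
  have hle : (⨆ μ : ℂ, Module.End.maxGenEigenspace (LinearMap.mulLeft ℂ a) μ) ≤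
      LinearMap.ker (LinearMap.mulLeft ℂ b) := by
    refine iSup_le fun μ x hx => ?_
    rw [Module.End.mem_maxGenEigenspace] at hx
    obtain ⟨k, hk⟩ := hx
    have e : LinearMap.mulLeft ℂ a - μ • (1 : Module.End ℂ 𝔸) =
        LinearMap.mulLeft ℂ (a - algebraMap ℂ 𝔸 μ) := by
      ext y; simp [sub_mul, Algebra.smul_def]
    rw [e, LinearMap.pow_mulLeft, LinearMap.mulLeft_apply] at hk
    rw [LinearMap.mem_ker, LinearMap.mulLeft_apply]
    by_cases hμ : μ ∈ spectrum ℂ a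
    · exact h μ hμ k x hk
    · have hu : IsUnit (a - algebraMap ℂ 𝔸 μ) := by
        rw [spectrum.notMem_iff] at hμ
        rw [← neg_sub]; exact hμ.neg
      rw [(hu.pow k).mul_right_eq_zero.1 hk, mul_zero]
  have : (1 : 𝔸) ∈ LinearMap.ker (LinearMap.mulLeft ℂ b) := hle (htop ▸ trivial)
  simpa using this

end ContourProjection

/-! ### Stable, center and unstable spectral projections -/

section SpectralSplitting

open Metric

variable {𝔸 : Type*} [NormedRing 𝔸] [NormedAlgebra ℂ 𝔸]

/-- The Riesz projection of the part of the spectrum in a disc filling the left half-plane. -/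
noncomputable def stableProj (α ρ : ℝ) (a : 𝔸) : 𝔸 := contourProj (-(ρ : ℂ)) (ρ - α) a

/-- The Riesz projection of the part of the spectrum in a disc filling the right half-plane. -/
noncomputable def unstableProj (α ρ : ℝ) (a : 𝔸) : 𝔸 := contourProj (ρ : ℂ) (ρ - α) a

/-- The complementary projection. -/
noncomputable def centerProj (α ρ : ℝ) (a : 𝔸) : 𝔸 := 1 - stableProj α ρ a - unstableProj α ρ a

/-- The spectrum of `a` splits into parts in two discs, in the half-planes `re < -α` and `re > α`,
and a part in the strip `|re| < α`. -/
structure IsSplit (α ρ : ℝ) (a : 𝔸) : Prop where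
  pos : 0 < α
  lt : α < ρ
  spec : ∀ μ ∈ spectrum ℂ a, μ ∈ ball (-(ρ : ℂ)) (ρ - α) ∨ μ ∈ ball (ρ : ℂ) (ρ - α) ∨ |μ.re| < α

theorem re_le_of_mem_closedBall_neg {α ρ : ℝ} {z : ℂ} (hz : z ∈ closedBall (-(ρ : ℂ)) (ρ - α)) :
    z.re ≤ -α := by
  rw [mem_closedBall_iff_norm] at hz
  have := (Complex.abs_re_le_norm _).trans hz
  rw [abs_le] at this
  simp at this; linarith [this.2]

theorem le_re_of_mem_closedBall {α ρ : ℝ} {z : ℂ} (hz : z ∈ closedBall (ρ : ℂ) (ρ - α)) :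
    α ≤ z.re := by
  rw [mem_closedBall_iff_norm] at hz
  have := (Complex.abs_re_le_norm _).trans hz
  rw [abs_le] at this
  simp at this; linarith [this.1]

theorem re_lt_of_mem_ball_neg {α ρ : ℝ} {z : ℂ} (hz : z ∈ ball (-(ρ : ℂ)) (ρ - α)) :
    z.re < -α := by
  rw [mem_ball_iff_norm] at hz
  have := (Complex.abs_re_le_norm _).trans_lt hz
  rw [abs_lt] at this
  simp at this; linarith [this.2]

theorem lt_re_of_mem_ball {α ρ : ℝ} {z : ℂ} (hz : z ∈ ball (ρ : ℂ) (ρ - α)) : α < z.re := by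
  rw [mem_ball_iff_norm] at hz
  have := (Complex.abs_re_le_norm _).trans_lt hz
  rw [abs_lt] at this
  simp at this; linarith [this.1]

namespace IsSplit

variable {α ρ : ℝ} {a : 𝔸}

theorem mem_of_re_neg (h : IsSplit α ρ a) {μ : ℂ} (hμ : μ ∈ spectrum ℂ a) (hre : μ.re ≤ -α) :
    μ ∈ ball (-(ρ : ℂ)) (ρ - α) := by
  rcases h.spec μ hμ with h1 | h1 | h1
  · exact h1
  · have := lt_re_of_mem_ball h1; linarith [h.pos]
  · rw [abs_lt] at h1; linarith

theorem mem_of_re_pos (h : IsSplit α ρ a) {μ : ℂ} (hμ : μ ∈ spectrum ℂ a) (hre : α ≤ μ.re) :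
    μ ∈ ball (ρ : ℂ) (ρ - α) := by
  rcases h.spec μ hμ with h1 | h1 | h1
  · have := re_lt_of_mem_ball_neg h1; linarith [h.pos]
  · exact h1
  · rw [abs_lt] at h1; linarith

theorem notMem_sphere_neg (h : IsSplit α ρ a) {μ : ℂ} (hμ : μ ∈ spectrum ℂ a) :
    μ ∉ sphere (-(ρ : ℂ)) (ρ - α) := fun hs => by
  have := h.mem_of_re_neg hμ (re_le_of_mem_closedBall_neg (sphere_subset_closedBall hs))
  exact absurd this (by simp [mem_sphere.1 hs])

theorem notMem_sphere_pos (h : IsSplit α ρ a) {μ : ℂ} (hμ : μ ∈ spectrum ℂ a) :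
    μ ∉ sphere (ρ : ℂ) (ρ - α) := fun hs => by
  have := h.mem_of_re_pos hμ (le_re_of_mem_closedBall (sphere_subset_closedBall hs))
  exact absurd this (by simp [mem_sphere.1 hs])

theorem sphere_neg_subset (h : IsSplit α ρ a) :
    sphere (-(ρ : ℂ)) (ρ - α) ⊆ resolventSet ℂ a := fun z hz => by
  by_contra hc
  exact h.notMem_sphere_neg (spectrum.mem_iff.2 hc) hz

theorem sphere_pos_subset (h : IsSplit α ρ a) :
    sphere (ρ : ℂ) (ρ - α) ⊆ resolventSet ℂ a := fun z hz => by
  by_contra hc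
  exact h.notMem_sphere_pos (spectrum.mem_iff.2 hc) hz

theorem radius_nonneg (h : IsSplit α ρ a) : 0 ≤ ρ - α := by linarith [h.lt]

variable [CompleteSpace 𝔸]

theorem stableProj_comm (h : IsSplit α ρ a) : a * stableProj α ρ a = stableProj α ρ a * a :=
  contourCalculus_comm h.radius_nonneg h.sphere_neg_subset continuousOn_const

theorem unstableProj_comm (h : IsSplit α ρ a) : a * unstableProj α ρ a = unstableProj α ρ a * a :=
  contourCalculus_comm h.radius_nonneg h.sphere_pos_subset continuousOn_const

theorem centerProj_comm (h : IsSplit α ρ a) : a * centerProj α ρ a = centerProj α ρ a * a := by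
  simp [centerProj, mul_sub, sub_mul, h.stableProj_comm, h.unstableProj_comm]

section genEigenvector

variable {μ : ℂ} {k : ℕ} {x : 𝔸}

theorem stableProj_mul_of_mem (h : IsSplit α ρ a) (hμ : μ ∈ ball (-(ρ : ℂ)) (ρ - α))
    (hx : (a - algebraMap ℂ 𝔸 μ) ^ k * x = 0) : stableProj α ρ a * x = x := by
  have := contourProj_mul_genEigenvector h.radius_nonneg h.sphere_neg_subset
    (fun hs => absurd hμ (by simp [mem_sphere.1 hs])) hx
  rwa [if_pos hμ] at this

theorem stableProj_mul_of_lt (h : IsSplit α ρ a) (hμ : -α < μ.re)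
    (hx : (a - algebraMap ℂ 𝔸 μ) ^ k * x = 0) : stableProj α ρ a * x = 0 := by
  have h1 : μ ∉ closedBall (-(ρ : ℂ)) (ρ - α) := fun hb => by
    linarith [re_le_of_mem_closedBall_neg hb]
  have := contourProj_mul_genEigenvector h.radius_nonneg h.sphere_neg_subset
    (fun hs => h1 (sphere_subset_closedBall hs)) hx
  rwa [if_neg (fun hs => h1 (ball_subset_closedBall hs))] at this

theorem unstableProj_mul_of_mem (h : IsSplit α ρ a) (hμ : μ ∈ ball (ρ : ℂ) (ρ - α))
    (hx : (a - algebraMap ℂ 𝔸 μ) ^ k * x = 0) : unstableProj α ρ a * x = x := by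
  have := contourProj_mul_genEigenvector h.radius_nonneg h.sphere_pos_subset
    (fun hs => absurd hμ (by simp [mem_sphere.1 hs])) hx
  rwa [if_pos hμ] at this

theorem unstableProj_mul_of_lt (h : IsSplit α ρ a) (hμ : μ.re < α)
    (hx : (a - algebraMap ℂ 𝔸 μ) ^ k * x = 0) : unstableProj α ρ a * x = 0 := by
  have h1 : μ ∉ closedBall (ρ : ℂ) (ρ - α) := fun hb => by
    linarith [le_re_of_mem_closedBall hb]
  have := contourProj_mul_genEigenvector h.radius_nonneg h.sphere_pos_subset
    (fun hs => h1 (sphere_subset_closedBall hs)) hx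
  rwa [if_neg (fun hs => h1 (ball_subset_closedBall hs))] at this

theorem centerProj_mul_of_abs_lt (h : IsSplit α ρ a) (hμ : |μ.re| < α)
    (hx : (a - algebraMap ℂ 𝔸 μ) ^ k * x = 0) : centerProj α ρ a * x = x := by
  rw [abs_lt] at hμ
  simp [centerProj, sub_mul, h.stableProj_mul_of_lt hμ.1 hx, h.unstableProj_mul_of_lt hμ.2 hx]

end genEigenvector

/-- On the contour re z ≤ -α, so the integrand carries |exp(tz)| ≤ exp(-αt). The constant depends
only on the contour and a resolvent bound, which is what makes it uniform under perturbation of a.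
-/
theorem norm_exp_mul_stableProj_le (h : IsSplit α ρ a) {K : ℝ}
    (hK : ∀ z ∈ sphere (-(ρ : ℂ)) (ρ - α), ‖resolvent a z‖ ≤ K) {t : ℝ} (ht : 0 ≤ t) :
    ‖NormedSpace.exp ((t : ℂ) • a) * stableProj α ρ a‖ ≤ (ρ - α) * K * Real.exp (-α * t) := by
  rw [stableProj, exp_mul_contourProj h.radius_nonneg h.sphere_neg_subset]
  refine (norm_contourCalculus_le h.radius_nonneg (m := Real.exp (-α * t)) hK fun z hz => ?_).trans
    (le_of_eq (by ring))
  rw [Complex.norm_exp]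
  gcongr
  have := re_le_of_mem_closedBall_neg (sphere_subset_closedBall hz)
  simp; nlinarith

theorem norm_exp_neg_mul_unstableProj_le (h : IsSplit α ρ a) {K : ℝ}
    (hK : ∀ z ∈ sphere (ρ : ℂ) (ρ - α), ‖resolvent a z‖ ≤ K) {t : ℝ} (ht : 0 ≤ t) :
    ‖NormedSpace.exp ((-t : ℂ) • a) * unstableProj α ρ a‖ ≤ (ρ - α) * K * Real.exp (-α * t) := by
  rw [unstableProj, exp_mul_contourProj h.radius_nonneg h.sphere_pos_subset]
  refine (norm_contourCalculus_le h.radius_nonneg (m := Real.exp (-α * t)) hK fun z hz => ?_).trans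
    (le_of_eq (by ring))
  rw [Complex.norm_exp]
  gcongr
  have := le_re_of_mem_closedBall (sphere_subset_closedBall hz)
  simp; nlinarith

variable [FiniteDimensional ℂ 𝔸]

/-- This and the following relations are tested on generalized eigenvectors of a, where each
projection acts as 0 or 1 according to the location of the eigenvalue. -/
theorem stable_mul_stable (h : IsSplit α ρ a) :
    stableProj α ρ a * stableProj α ρ a = stableProj α ρ a := by
  rw [← sub_eq_zero]
  refine eq_zero_of_mul_genEigenvector (a := a) fun μ hμ k x hx => ?_
  rw [sub_mul, mul_assoc]
  rcases h.spec μ hμ with h1 | h1 | h1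
  · simp [h.stableProj_mul_of_mem h1 hx]
  · simp [h.stableProj_mul_of_lt (by linarith [lt_re_of_mem_ball h1, h.pos]) hx]
  · simp [h.stableProj_mul_of_lt (abs_lt.1 h1).1 hx]

theorem unstable_mul_unstable (h : IsSplit α ρ a) :
    unstableProj α ρ a * unstableProj α ρ a = unstableProj α ρ a := by
  rw [← sub_eq_zero]
  refine eq_zero_of_mul_genEigenvector (a := a) fun μ hμ k x hx => ?_
  rw [sub_mul, mul_assoc]
  rcases h.spec μ hμ with h1 | h1 | h1
  · simp [h.unstableProj_mul_of_lt (by linarith [re_lt_of_mem_ball_neg h1, h.pos]) hx]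
  · simp [h.unstableProj_mul_of_mem h1 hx]
  · simp [h.unstableProj_mul_of_lt (abs_lt.1 h1).2 hx]

theorem stable_mul_unstable (h : IsSplit α ρ a) : stableProj α ρ a * unstableProj α ρ a = 0 := by
  refine eq_zero_of_mul_genEigenvector (a := a) fun μ hμ k x hx => ?_
  rw [mul_assoc]
  rcases h.spec μ hμ with h1 | h1 | h1
  · simp [h.unstableProj_mul_of_lt (by linarith [re_lt_of_mem_ball_neg h1, h.pos]) hx]
  · simp [h.unstableProj_mul_of_mem h1 hx,
      h.stableProj_mul_of_lt (by linarith [lt_re_of_mem_ball h1, h.pos]) hx]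
  · simp [h.unstableProj_mul_of_lt (abs_lt.1 h1).2 hx]

theorem unstable_mul_stable (h : IsSplit α ρ a) : unstableProj α ρ a * stableProj α ρ a = 0 := by
  refine eq_zero_of_mul_genEigenvector (a := a) fun μ hμ k x hx => ?_
  rw [mul_assoc]
  rcases h.spec μ hμ with h1 | h1 | h1
  · simp [h.stableProj_mul_of_mem h1 hx,
      h.unstableProj_mul_of_lt (by linarith [re_lt_of_mem_ball_neg h1, h.pos]) hx]
  · simp [h.stableProj_mul_of_lt (by linarith [lt_re_of_mem_ball h1, h.pos]) hx]
  · simp [h.stableProj_mul_of_lt (abs_lt.1 h1).1 hx]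

theorem stable_add_unstable (h : IsSplit α ρ a) (hhyp : ∀ μ ∈ spectrum ℂ a, α ≤ |μ.re|) :
    stableProj α ρ a + unstableProj α ρ a = 1 := by
  rw [← sub_eq_zero]
  refine eq_zero_of_mul_genEigenvector (a := a) fun μ hμ k x hx => ?_
  rw [sub_mul, add_mul]
  rcases h.spec μ hμ with h1 | h1 | h1
  · simp [h.stableProj_mul_of_mem h1 hx,
      h.unstableProj_mul_of_lt (by linarith [re_lt_of_mem_ball_neg h1, h.pos]) hx]
  · simp [h.stableProj_mul_of_lt (by linarith [lt_re_of_mem_ball h1, h.pos]) hx,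
      h.unstableProj_mul_of_mem h1 hx]
  · exact absurd h1 (not_lt.2 (hhyp μ hμ))

end IsSplit

variable [CompleteSpace 𝔸]

/-- Upper hemicontinuity of the spectrum: it cannot leave the open set formed by the two discs and
the strip. -/
theorem IsSplit.eventually {α ρ : ℝ} {a : 𝔸} (h : IsSplit α ρ a) : ∀ᶠ b in 𝓝 a, IsSplit α ρ b := by
  have h1 := upperHemicontinuous_spectrum ℂ 𝔸
  have hU : IsOpen (ball (-(ρ : ℂ)) (ρ - α) ∪ (ball (ρ : ℂ) (ρ - α) ∪ {μ : ℂ | |μ.re| < α})) := by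
    refine isOpen_ball.union (isOpen_ball.union ?_)
    exact isOpen_lt (by fun_prop) continuous_const
  have h2 := (h1.upperHemicontinuousAt a).forall_isOpen _ hU (fun μ hμ => h.spec μ hμ)
  filter_upwards [h2] with b hb
  exact ⟨h.pos, h.lt, fun μ hμ => hb hμ⟩

/-- The resolvent is jointly continuous in the element and in z, and compactness of s makes the
neighbourhood of a uniform in z. -/
theorem eventually_norm_resolvent_le {a : 𝔸} {s : Set ℂ} (hs : IsCompact s)
    (hsub : s ⊆ resolventSet ℂ a) :
    ∃ K : ℝ, 0 ≤ K ∧ ∀ᶠ b in 𝓝 a, ∀ z ∈ s, ‖resolvent b z‖ ≤ K := by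
  obtain ⟨K, hK⟩ := hs.exists_bound_of_continuousOn (continuousOn_resolvent hsub)
  refine ⟨|K| + 1, by positivity, ?_⟩
  refine hs.eventually_forall_of_forall_eventually fun z hz => ?_
  have hc : ContinuousAt (fun p : 𝔸 × ℂ => ‖resolvent p.1 p.2‖) (a, z) := by
    obtain ⟨u, hu⟩ := hsub hz
    refine ContinuousAt.norm ?_
    refine ContinuousAt.comp (g := Ring.inverse) (f := fun p : 𝔸 × ℂ => algebraMap ℂ 𝔸 p.2 - p.1)
      ?_ ?_
    · simp only [← hu]; exact NormedRing.inverse_continuousAt u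
    · have : Continuous (algebraMap ℂ 𝔸) := continuous_algebraMap ℂ 𝔸
      fun_prop
  have := hc.eventually (gt_mem_nhds (show ‖resolvent a z‖ < |K| + 1 by
    have := hK z hz; have := le_abs_self K; linarith))
  exact this.mono fun p hp => hp.le

/-- Spectral gaps give a splitting by discs. -/
theorem exists_isSplit {a : 𝔸} {α : ℝ} (hα : 0 < α)
    (h : ∀ μ ∈ spectrum ℂ a, |μ.re| < α ∨ 2 * α ≤ |μ.re|) : ∃ ρ, IsSplit α ρ a := by
  set S : ℝ := ‖a‖ * ‖(1 : 𝔸)‖ with hS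
  have hS0 : 0 ≤ S := by positivity
  have hb : ∀ μ ∈ spectrum ℂ a, ‖μ‖ ≤ S := fun μ hμ => spectrum.norm_le_norm_mul_of_mem hμ
  -- For |μ| ≤ S and re μ ≥ 2α, |μ - ρ|² ≤ S² - 4αρ + ρ², which is below (ρ - α)² as soon as S² <
  -- 2αρ. The first summand provides this, and the second gives strictness and ρ > α.
  set ρ : ℝ := S ^ 2 / (2 * α) + 2 * α with hρ
  have hρα : α < ρ := by
    have : 0 ≤ S ^ 2 / (2 * α) := by positivity
    linarith
  have hρS : S ^ 2 < 2 * ρ * α := by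
    have : 2 * ρ * α = S ^ 2 + 4 * α ^ 2 := by rw [hρ]; field_simp; ring
    rw [this]; nlinarith
  refine ⟨ρ, hα, hρα, fun μ hμ => ?_⟩
  have hn : μ.re ^ 2 + μ.im ^ 2 ≤ S ^ 2 := by
    have := hb μ hμ
    have e := Complex.sq_norm μ
    rw [Complex.normSq_apply] at e
    nlinarith [norm_nonneg μ]
  rcases h μ hμ with h1 | h1
  · exact Or.inr (Or.inr h1)
  · rcases le_abs.1 h1 with h2 | h2
    · refine Or.inr (Or.inl ?_)
      rw [mem_ball_iff_norm]
      refine lt_of_pow_lt_pow_left₀ 2 (by linarith) ?_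
      rw [Complex.sq_norm, Complex.normSq_apply]
      simp
      nlinarith
    · refine Or.inl ?_
      rw [mem_ball_iff_norm]
      refine lt_of_pow_lt_pow_left₀ 2 (by linarith) ?_
      rw [Complex.sq_norm, Complex.normSq_apply]
      simp
      nlinarith

end SpectralSplitting

/-! ### Exponential dichotomies: bounded solutions and their roughness -/

section BoundedSolutions

open MeasureTheory BoundedContinuousFunction

variable {V : Type*} [NormedAddCommGroup V] [NormedSpace ℂ V]

/-- The contribution to the bounded solution of `u' = L u + f` of a projection `Q` on which
`exp (t L)` decays as `t → ∞`. -/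
noncomputable def greenPart (L Q : V →L[ℂ] V) (f : ℝ → V) (x : ℝ) : V :=
  NormedSpace.exp ((x : ℂ) • L) (∫ y in Set.Iic x, NormedSpace.exp ((-y : ℂ) • L) (Q (f y)))

/-- `exp (t L)` decays on the range of `Q`. -/
structure DecaysOn (L Q : V →L[ℂ] V) (K α : ℝ) : Prop where
  pos : 0 < α
  bound : ∀ t : ℝ, 0 ≤ t → ‖NormedSpace.exp ((t : ℂ) • L) * Q‖ ≤ K * Real.exp (-α * t)

variable [CompleteSpace V] {L Q : V →L[ℂ] V} {K α : ℝ}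

omit [CompleteSpace V] in
theorem DecaysOn.const_nonneg (h : DecaysOn L Q K α) : 0 ≤ K := by
  simpa using (norm_nonneg _).trans (h.bound 0 le_rfl)

theorem exp_ofReal_smul_add (L : V →L[ℂ] V) (s t : ℂ) :
    NormedSpace.exp ((s + t) • L) = NormedSpace.exp (s • L) * NormedSpace.exp (t • L) := by
  let _ : NormedAlgebra ℚ (V →L[ℂ] V) := NormedAlgebra.restrictScalars ℚ ℂ _
  rw [add_smul]
  exact NormedSpace.exp_add_of_commute (((Commute.refl L).smul_left s).smul_right t)

theorem hasDerivAt_exp_ofReal_smul (L : V →L[ℂ] V) (x : ℝ) :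
    HasDerivAt (fun x : ℝ => NormedSpace.exp ((x : ℂ) • L)) (L * NormedSpace.exp ((x : ℂ) • L)) x := by
  simpa [Function.comp_def] using
    (hasDerivAt_exp_smul_const' L (x : ℂ)).scomp x Complex.ofRealCLM.hasDerivAt

theorem continuous_exp_ofReal_smul (L : V →L[ℂ] V) :
    Continuous fun x : ℝ => NormedSpace.exp ((x : ℂ) • L) :=
  continuous_iff_continuousAt.2 fun x => (hasDerivAt_exp_ofReal_smul L x).continuousAt

theorem continuous_greenIntegrand {f : ℝ → V} (hf : Continuous f) :
    Continuous fun y : ℝ => NormedSpace.exp ((-y : ℂ) • L) (Q (f y)) := by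
  have h1 : Continuous fun y : ℝ => NormedSpace.exp ((-y : ℂ) • L) := by
    simpa [Function.comp_def] using (continuous_exp_ofReal_smul L).comp continuous_neg
  exact h1.clm_apply (Q.continuous.comp hf)

theorem norm_greenIntegrand_le (h : DecaysOn L Q K α) {f : ℝ → V} {H : ℝ} (hH : ∀ x, ‖f x‖ ≤ H)
    {x y : ℝ} (hy : y ≤ x) :
    ‖NormedSpace.exp ((x : ℂ) • L) (NormedSpace.exp ((-y : ℂ) • L) (Q (f y)))‖ ≤
      K * H * Real.exp (-α * x) * Real.exp (α * y) := by
  have e : NormedSpace.exp ((x : ℂ) • L) (NormedSpace.exp ((-y : ℂ) • L) (Q (f y))) =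
      (NormedSpace.exp (((x - y : ℝ) : ℂ) • L) * Q) (f y) := by
    push_cast
    rw [sub_eq_add_neg, exp_ofReal_smul_add]; rfl
  rw [e]
  have hb := h.bound (x - y) (by linarith)
  calc _ ≤ _ := ContinuousLinearMap.le_opNorm _ _
    _ ≤ K * Real.exp (-α * (x - y)) * H := by
        have := h.const_nonneg
        gcongr
        exact hH y
    _ = _ := by
        rw [show -α * (x - y) = -α * x + α * y by ring, Real.exp_add]; ring

theorem integrableOn_greenIntegrand (h : DecaysOn L Q K α) {f : ℝ → V} (hf : Continuous f) {H : ℝ}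
    (hH : ∀ x, ‖f x‖ ≤ H) (x : ℝ) :
    IntegrableOn (fun y : ℝ => NormedSpace.exp ((-y : ℂ) • L) (Q (f y))) (Set.Iic x) := by
  have h0 : IntegrableOn (fun y : ℝ => NormedSpace.exp ((-y : ℂ) • L) (Q (f y))) (Set.Iic 0) := by
    refine Integrable.mono' ((integrableOn_exp_mul_Iic h.pos 0).const_mul (K * H))
      (continuous_greenIntegrand hf).aestronglyMeasurable ?_
    refine (ae_restrict_iff' measurableSet_Iic).2 (Eventually.of_forall fun y hy => ?_)
    have := norm_greenIntegrand_le h hH (x := 0) hy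
    simpa using this
  have h1 : IntegrableOn (fun y : ℝ => NormedSpace.exp ((-y : ℂ) • L) (Q (f y)))
      (Set.Icc (min 0 x) (max 0 x)) :=
    (continuous_greenIntegrand hf).continuousOn.integrableOn_Icc
  refine (h0.union h1).mono_set fun y hy => ?_
  rcases le_total y 0 with h2 | h2
  · exact Or.inl h2
  · exact Or.inr ⟨(min_le_left _ _).trans h2, le_trans hy (le_max_right _ _)⟩

theorem norm_greenPart_le (h : DecaysOn L Q K α) {f : ℝ → V} {H : ℝ}
    (hH : ∀ x, ‖f x‖ ≤ H) (hf : Continuous f) (x : ℝ) : ‖greenPart L Q f x‖ ≤ K / α * H := by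
  rw [greenPart, ← ContinuousLinearMap.integral_comp_comm _ (integrableOn_greenIntegrand h hf hH x)]
  have hi : IntegrableOn (fun y => K * H * Real.exp (-α * x) * Real.exp (α * y)) (Set.Iic x) :=
    (integrableOn_exp_mul_Iic h.pos x).const_mul _
  refine (norm_integral_le_of_norm_le hi ((ae_restrict_iff' measurableSet_Iic).2
    (Eventually.of_forall fun y hy => norm_greenIntegrand_le h hH hy))).trans (le_of_eq ?_)
  rw [integral_const_mul, integral_exp_mul_Iic h.pos, neg_mul, Real.exp_neg]
  field_simp

theorem hasDerivAt_greenPart (h : DecaysOn L Q K α) {f : ℝ → V} {H : ℝ}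
    (hH : ∀ x, ‖f x‖ ≤ H) (hf : Continuous f) (x : ℝ) :
    HasDerivAt (greenPart L Q f) (L (greenPart L Q f x) + Q (f x)) x := by
  have hi := integrableOn_greenIntegrand h hf hH
  have hc := continuous_greenIntegrand (L := L) (Q := Q) hf
  -- Separating the fixed integral over (-∞, 0] leaves a primitive based at 0, to which the
  -- fundamental theorem of calculus applies.
  have e : greenPart L Q f = fun x : ℝ => NormedSpace.exp ((x : ℂ) • L)
      ((∫ y in Set.Iic (0:ℝ), NormedSpace.exp ((-y : ℂ) • L) (Q (f y))) +
        ∫ y in (0:ℝ)..x, NormedSpace.exp ((-y : ℂ) • L) (Q (f y))) := by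
    funext x
    rw [greenPart, ← intervalIntegral.integral_Iic_sub_Iic (hi 0) (hi x)]
    congr 1; abel
  rw [e]
  have h1 := (hc.integral_hasStrictDerivAt 0 x).hasDerivAt.const_add
    (∫ y in Set.Iic (0:ℝ), NormedSpace.exp ((-y : ℂ) • L) (Q (f y)))
  have h3 := ((ContinuousLinearMap.restrictScalarsL ℂ V V ℝ ℝ).hasFDerivAt.comp_hasDerivAt x
    (hasDerivAt_exp_ofReal_smul L x)).clm_apply h1
  convert! h3 using 1
  have e2 : NormedSpace.exp ((x : ℂ) • L) (NormedSpace.exp ((-x : ℂ) • L) (Q (f x))) = Q (f x) := by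
    rw [← mul_apply_eq_comp, ← exp_ofReal_smul_add]
    simp
  exact congrArg _ e2.symm

theorem greenPart_sub (h : DecaysOn L Q K α) {f g : ℝ → V} (hf : Continuous f) (hg : Continuous g)
    {H H' : ℝ} (hH : ∀ x, ‖f x‖ ≤ H) (hH' : ∀ x, ‖g x‖ ≤ H') (x : ℝ) :
    greenPart L Q (f - g) x = greenPart L Q f x - greenPart L Q g x := by
  simp only [greenPart, Pi.sub_apply, map_sub]
  rw [integral_sub (integrableOn_greenIntegrand h hf hH x) (integrableOn_greenIntegrand h hg hH' x),
    map_sub]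

/-- An exponential dichotomy of `u' = L u`. -/
structure HasDichotomy (L : V →L[ℂ] V) (Qs Qu : V →L[ℂ] V) (K α : ℝ) : Prop where
  stable : DecaysOn L Qs K α
  unstable : DecaysOn (-L) Qu K α
  add : Qs + Qu = 1

/-- The bounded solution of `u' = L u + f`. -/
noncomputable def green (L Qs Qu : V →L[ℂ] V) (f : ℝ → V) (x : ℝ) : V :=
  greenPart L Qs f x - greenPart (-L) Qu (fun y => f (-y)) (-x)

variable {Qs Qu : V →L[ℂ] V}

theorem hasDerivAt_green (h : HasDichotomy L Qs Qu K α) {f : ℝ → V} {H : ℝ}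
    (hH : ∀ x, ‖f x‖ ≤ H) (hf : Continuous f) (x : ℝ) :
    HasDerivAt (green L Qs Qu f) (L (green L Qs Qu f x) + f x) x := by
  have h1 := hasDerivAt_greenPart h.stable hH hf x
  have h2 := (hasDerivAt_greenPart h.unstable (fun y => hH (-y)) (by fun_prop : Continuous fun y => f (-y))
    (-x)).scomp x (hasDerivAt_neg x)
  have h3 := h1.sub h2
  convert! h3 using 1
  have : f x = Qs (f x) + Qu (f x) := by
    rw [← _root_.add_apply, h.add]; rfl
  conv_lhs => rw [this]
  simp [green]
  abel

theorem norm_green_le (h : HasDichotomy L Qs Qu K α) {f : ℝ → V} {H : ℝ}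
    (hH : ∀ x, ‖f x‖ ≤ H) (hf : Continuous f) (x : ℝ) :
    ‖green L Qs Qu f x‖ ≤ 2 * K / α * H := by
  have h1 := norm_greenPart_le h.stable hH hf x
  have h2 := norm_greenPart_le h.unstable (fun y => hH (-y))
    (by fun_prop : Continuous fun y => f (-y)) (-x)
  refine (norm_sub_le _ _).trans ?_
  calc _ ≤ _ := add_le_add h1 h2
    _ = _ := by ring

theorem green_sub (h : HasDichotomy L Qs Qu K α) {f g : ℝ → V} (hf : Continuous f)
    (hg : Continuous g) {H H' : ℝ} (hH : ∀ x, ‖f x‖ ≤ H) (hH' : ∀ x, ‖g x‖ ≤ H') (x : ℝ) :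
    green L Qs Qu (f - g) x = green L Qs Qu f x - green L Qs Qu g x := by
  have h2 := greenPart_sub h.unstable (f := fun y => f (-y)) (g := fun y => g (-y)) (by fun_prop)
    (by fun_prop) (fun y => hH (-y)) (fun y => hH' (-y)) (-x)
  have e : (fun y => (f - g) (-y)) = (fun y => f (-y)) - fun y => g (-y) := rfl
  rw [green, green, green, greenPart_sub h.stable hf hg hH hH', e, h2]
  abel

theorem continuous_green (h : HasDichotomy L Qs Qu K α) {f : ℝ → V} {H : ℝ}
    (hH : ∀ x, ‖f x‖ ≤ H) (hf : Continuous f) : Continuous (green L Qs Qu f) :=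
  continuous_iff_continuousAt.2 fun x => (hasDerivAt_green h hH hf x).continuousAt

/-- Roughness: the bounded solution persists under a small bounded perturbation of `L`. -/
theorem exists_bounded_solution (h : HasDichotomy L Qs Qu K α) {κ : ℝ}
    (hκ : 2 * K / α * κ ≤ 1 / 2) {F : ℝ → V →L[ℂ] V} (hF : Continuous F) (hFκ : ∀ x, ‖F x‖ ≤ κ)
    {f : ℝ → V} {H : ℝ} (hf : Continuous f) (hH : ∀ x, ‖f x‖ ≤ H) :
    ∃ u : ℝ → V, Continuous u ∧ (∀ x, ‖u x‖ ≤ 2 * (2 * K / α * H)) ∧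
      ∀ x, u x = green L Qs Qu (fun y => F y (u y) + f y) x := by
  have hκ0 : 0 ≤ κ := (norm_nonneg _).trans (hFκ 0)
  have hH0 : 0 ≤ H := (norm_nonneg _).trans (hH 0)
  have hc0 : 0 ≤ 2 * K / α := by
    have := h.stable.const_nonneg; have := h.stable.pos; positivity
  have hcont : ∀ u : ℝ →ᵇ V, Continuous fun y => F y (u y) + f y := fun u =>
    (hF.clm_apply u.continuous).add hf
  have hFu : ∀ (u : ℝ →ᵇ V) y, ‖F y (u y)‖ ≤ κ * ‖u‖ := fun u y =>
    ((F y).le_opNorm _).trans (by gcongr; exacts [hFκ y, u.norm_coe_le_norm y])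
  have hbd : ∀ (u : ℝ →ᵇ V) y, ‖F y (u y) + f y‖ ≤ κ * ‖u‖ + H := fun u y =>
    (norm_add_le _ _).trans (add_le_add (hFu u y) (hH y))
  let T : (ℝ →ᵇ V) → (ℝ →ᵇ V) := fun u =>
    BoundedContinuousFunction.ofNormedAddCommGroup (green L Qs Qu fun y => F y (u y) + f y)
      (continuous_green h (hbd u) (hcont u)) _ (norm_green_le h (hbd u) (hcont u))
  have hT : ContractingWith (1/2) T := by
    refine ⟨by norm_num [← NNReal.coe_lt_coe], LipschitzWith.of_dist_le_mul fun u v => ?_⟩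
    rw [BoundedContinuousFunction.dist_le (by positivity)]
    intro x
    have e : T u x - T v x = green L Qs Qu (fun y => F y ((u - v) y)) x := by
      simp only [T, coe_ofNormedAddCommGroup]
      rw [← green_sub h (hcont u) (hcont v) (hbd u) (hbd v)]
      congr 1
      funext y
      simp
    rw [dist_eq_norm, e, dist_eq_norm]
    refine (norm_green_le h (hFu (u - v)) (hF.clm_apply (u - v).continuous) x).trans ?_
    rw [← mul_assoc]
    gcongr
    simpa using hκ
  set u := ContractingWith.fixedPoint T hT with hu
  have hfix : T u = u := hT.fixedPoint_isFixedPt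
  have hux : ∀ x, u x = green L Qs Qu (fun y => F y (u y) + f y) x := fun x => by
    conv_lhs => rw [← hfix]
    rfl
  refine ⟨u, u.continuous, fun x => ?_, hux⟩
  -- A priori bound from the fixed-point equation; the smallness of κ lets half of ‖u‖ be absorbed
  -- on the left.
  have hn : ‖u‖ ≤ 2 * K / α * (κ * ‖u‖ + H) := by
    rw [BoundedContinuousFunction.norm_le (by positivity)]
    intro x
    rw [hux x]
    exact norm_green_le h (hbd u) (hcont u) x
  refine (u.norm_coe_le_norm x).trans ?_
  have := mul_le_mul_of_nonneg_right hκ (norm_nonneg u)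
  nlinarith

/-- Lipschitz dependence of the bounded solution on the data. -/
theorem norm_bounded_solution_sub_le (h : HasDichotomy L Qs Qu K α) {κ : ℝ}
    (hκ : 2 * K / α * κ ≤ 1 / 2) {F F' : ℝ → V →L[ℂ] V} (hF : Continuous F) (hF' : Continuous F')
    (hFκ : ∀ x, ‖F x‖ ≤ κ) (hFκ' : ∀ x, ‖F' x‖ ≤ κ)
    {f f' : ℝ → V} {H H' : ℝ} (hf : Continuous f) (hH : ∀ x, ‖f x‖ ≤ H)
    (hf' : Continuous f') (hH' : ∀ x, ‖f' x‖ ≤ H')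
    {u u' : ℝ → V} (hu : Continuous u) (hu' : Continuous u') {U U' : ℝ} (hU : ∀ x, ‖u x‖ ≤ U)
    (hU' : ∀ x, ‖u' x‖ ≤ U')
    (hsol : ∀ x, u x = green L Qs Qu (fun y => F y (u y) + f y) x)
    (hsol' : ∀ x, u' x = green L Qs Qu (fun y => F' y (u' y) + f' y) x)
    {δ δ' : ℝ} (hδ : ∀ x, ‖F x - F' x‖ ≤ δ) (hδ' : ∀ x, ‖f x - f' x‖ ≤ δ') (x : ℝ) :
    ‖u x - u' x‖ ≤ 2 * (2 * K / α * (δ * U' + δ')) := by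
  have hκ0 : 0 ≤ κ := (norm_nonneg _).trans (hFκ 0)
  have hδ0 : 0 ≤ δ := (norm_nonneg _).trans (hδ 0)
  have hδ'0 : 0 ≤ δ' := (norm_nonneg _).trans (hδ' 0)
  have hU'0 : 0 ≤ U' := (norm_nonneg _).trans (hU' 0)
  have hc0 : 0 ≤ 2 * K / α := by
    have := h.stable.const_nonneg; have := h.stable.pos; positivity
  -- As a bounded function the difference has a finite sup norm, so the term κ‖w‖ in its equation
  -- can be absorbed.
  let w : ℝ →ᵇ V := BoundedContinuousFunction.ofNormedAddCommGroup (fun x => u x - u' x)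
    (hu.sub hu') (U + U') (fun x => (norm_sub_le _ _).trans (add_le_add (hU x) (hU' x)))
  have hbd : ∀ y, ‖F y (u y) + f y‖ ≤ κ * U + H := fun y =>
    (norm_add_le _ _).trans (add_le_add (((F y).le_opNorm _).trans
      (by gcongr; exacts [hFκ y, hU y])) (hH y))
  have hbd' : ∀ y, ‖F' y (u' y) + f' y‖ ≤ κ * U' + H' := fun y =>
    (norm_add_le _ _).trans (add_le_add (((F' y).le_opNorm _).trans
      (by gcongr; exacts [hFκ' y, hU' y])) (hH' y))
  have hc : Continuous fun y => F y (u y) + f y := (hF.clm_apply hu).add hf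
  have hc' : Continuous fun y => F' y (u' y) + f' y := (hF'.clm_apply hu').add hf'
  have hdiff : ∀ y, ‖(F y (u y) + f y) - (F' y (u' y) + f' y)‖ ≤ κ * ‖w‖ + (δ * U' + δ') := by
    intro y
    have e : (F y (u y) + f y) - (F' y (u' y) + f' y) =
        F y (w y) + ((F y - F' y) (u' y) + (f y - f' y)) := by
      simp [w]; abel
    rw [e]
    refine (norm_add_le _ _).trans (add_le_add ?_ ((norm_add_le _ _).trans (add_le_add ?_ (hδ' y))))
    · exact ((F y).le_opNorm _).trans (by gcongr; exacts [hFκ y, w.norm_coe_le_norm y])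
    · exact ((F y - F' y).le_opNorm _).trans (by gcongr; exacts [hδ y, hU' y])
  have hw : ∀ x, ‖w x‖ ≤ 2 * K / α * (κ * ‖w‖ + (δ * U' + δ')) := by
    intro x
    have e : w x = green L Qs Qu ((fun y => F y (u y) + f y) - fun y => F' y (u' y) + f' y) x := by
      rw [green_sub h hc hc' hbd hbd', ← hsol, ← hsol']; rfl
    rw [e]
    exact norm_green_le h hdiff (hc.sub hc') x
  have hn : ‖w‖ ≤ 2 * K / α * (κ * ‖w‖ + (δ * U' + δ')) :=
    (BoundedContinuousFunction.norm_le (by positivity)).2 hw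
  refine (w.norm_coe_le_norm x).trans ?_
  have := mul_le_mul_of_nonneg_right hκ (norm_nonneg w)
  nlinarith

end BoundedSolutions

/-! ### Conjugators on a right half-line -/

section Conjugators

theorem linearODE_eq_right {𝔸 : Type*} [NormedRing 𝔸] [NormedAlgebra ℂ 𝔸] {B : ℝ → 𝔸} {K : ℝ}
    (hK : ∀ x, ‖B x‖ ≤ K) {F G : ℝ → 𝔸} {a : ℝ} (hF : ∀ x, a ≤ x → HasDerivAt F (B x * F x) x)
    (hG : ∀ x, a ≤ x → HasDerivAt G (B x * G x) x) (h0 : F a = G a) {x : ℝ} (hx : a ≤ x) :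
    F x = G x := by
  have hd : ∀ y, a ≤ y → HasDerivAt (fun y => F y - G y) (B y * (F y - G y)) y := fun y hy => by
    rw [mul_sub]; exact (hF y hy).sub (hG y hy)
  have := norm_le_gronwallBound_of_norm_deriv_right_le (f := fun y => F y - G y)
    (f' := fun y => B y * (F y - G y)) (δ := 0) (K := K) (ε := 0) (a := a) (b := x)
    (fun y hy => (hd y hy.1).continuousAt.continuousWithinAt)
    (fun y hy => (hd y hy.1).hasDerivWithinAt) (by simp [h0])
    (fun y _ => by rw [add_zero]; exact (norm_mul_le _ _).trans (by gcongr; exact hK y))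
    x ⟨hx, le_rfl⟩
  rw [gronwallBound_ε0_δ0] at this
  exact sub_eq_zero.1 (norm_le_zero_iff.1 this)

/-- The spectrum is compact and avoids the imaginary axis, so it keeps a positive distance from it.
The splitting then has empty center part and the two Riesz projections form the dichotomy. -/
theorem exists_dichotomy {V : Type*} [NormedAddCommGroup V] [NormedSpace ℂ V] [CompleteSpace V]
    [FiniteDimensional ℂ V] {L : V →L[ℂ] V} (h : ∀ μ ∈ spectrum ℂ L, μ.re ≠ 0) :
    ∃ (Qs Qu : V →L[ℂ] V) (K α : ℝ), HasDichotomy L Qs Qu K α := by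
  obtain ⟨α, hα, hgap⟩ : ∃ α : ℝ, 0 < α ∧ ∀ μ ∈ spectrum ℂ L, 2 * α ≤ |μ.re| := by
    rcases (spectrum ℂ L).eq_empty_or_nonempty with he | hne
    · exact ⟨1, one_pos, by simp [he]⟩
    · obtain ⟨μ₀, hμ₀, hmin⟩ := (spectrum.isCompact L).exists_isMinOn hne
        (f := fun μ : ℂ => |μ.re|) (by fun_prop)
      have : 0 < |μ₀.re| := abs_pos.2 (h μ₀ hμ₀)
      exact ⟨|μ₀.re| / 2, by positivity, fun μ hμ => by
        have : |μ₀.re| ≤ |μ.re| := hmin hμ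
        linarith⟩
  obtain ⟨ρ, hs⟩ := exists_isSplit hα (fun μ hμ => Or.inr (hgap μ hμ))
  obtain ⟨K₁, hK₁0, hK₁⟩ := eventually_norm_resolvent_le
    (isCompact_sphere (-(ρ : ℂ)) (ρ - α)) hs.sphere_neg_subset
  obtain ⟨K₂, hK₂0, hK₂⟩ := eventually_norm_resolvent_le
    (isCompact_sphere (ρ : ℂ) (ρ - α)) hs.sphere_pos_subset
  have hr := hs.radius_nonneg
  refine ⟨stableProj α ρ L, unstableProj α ρ L, (ρ - α) * max K₁ K₂, α, ⟨hα, ?_⟩,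
    ⟨hα, ?_⟩, hs.stable_add_unstable fun μ hμ => by linarith [hgap μ hμ]⟩
  · intro t ht
    exact hs.norm_exp_mul_stableProj_le (fun z hz => (hK₁.self_of_nhds z hz).trans (le_max_left _ _)) ht
  · intro t ht
    have := hs.norm_exp_neg_mul_unstableProj_le
      (fun z hz => (hK₂.self_of_nhds z hz).trans (le_max_right K₁ _)) ht
    simpa using this

variable {𝔸 : Type*} [NormedRing 𝔸]

/-- The class of coefficients `B` with `B → A` exponentially, `A` close to `A₀`. -/
structure IsAsymptoticallyConstant (A₀ : 𝔸) (δ C₀ ν : ℝ) (B : ℝ → 𝔸) (A : 𝔸) : Prop where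
  cont : Continuous B
  near : ‖A - A₀‖ ≤ δ
  decay : ∀ x, ‖B x - A‖ ≤ C₀ * Real.exp (-ν * |x|)

theorem IsAsymptoticallyConstant.norm_le {A₀ : 𝔸} {δ C₀ ν : ℝ} (hν : 0 < ν) {B : ℝ → 𝔸} {A : 𝔸}
    (h : IsAsymptoticallyConstant A₀ δ C₀ ν B A) (x : ℝ) : ‖B x‖ ≤ ‖A₀‖ + δ + C₀ := by
  have hC₀ : 0 ≤ C₀ := by simpa using (norm_nonneg _).trans (h.decay 0)
  have h1 := h.decay x
  have h2 : Real.exp (-ν * |x|) ≤ 1 := Real.exp_le_one_iff.2 (by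
    have := abs_nonneg x; nlinarith)
  have h3 := h.near
  have e : B x = A₀ + (A - A₀) + (B x - A) := by abel
  rw [e]
  refine (norm_add_le _ _).trans (add_le_add ((norm_add_le _ _).trans (by gcongr)) ?_)
  nlinarith

variable [NormedAlgebra ℂ 𝔸]

/-- The commutator with `a` as a continuous linear map. -/
noncomputable def commutatorCLM (a : 𝔸) : 𝔸 →L[ℂ] 𝔸 :=
  ContinuousLinearMap.mul ℂ 𝔸 a - (ContinuousLinearMap.mul ℂ 𝔸).flip a

@[simp] theorem commutatorCLM_apply (a x : 𝔸) : commutatorCLM a x = a * x - x * a := by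
  simp [commutatorCLM]

theorem commutatorCLM_sub (a b : 𝔸) : commutatorCLM
    (a - b) = commutatorCLM a - commutatorCLM b := by
  ext x; simp [sub_mul, mul_sub]; abel

theorem norm_commutatorCLM_le (a : 𝔸) : ‖commutatorCLM a‖ ≤ 2 * ‖a‖ := by
  refine ContinuousLinearMap.opNorm_le_bound _ (by positivity) fun x => ?_
  rw [commutatorCLM_apply]
  refine (norm_sub_le _ _).trans ?_
  have h1 := norm_mul_le a x
  have h2 := norm_mul_le x a
  nlinarith

set_option maxHeartbeats 1600000 in
/-- Existence, exponential bounds and Lipschitz dependence of the conjugator on a right half-line,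
for coefficients whose limit is close to a fixed matrix. -/
theorem exists_conjugator_right [CompleteSpace 𝔸] [FiniteDimensional ℂ 𝔸] (A₀ : 𝔸) {η ν C₀ : ℝ}
    (hη : 0 < η) (hην : η < ν)
    (hyp : ∀ μ ∈ spectrum ℂ (commutatorCLM A₀ + (η : ℂ) • (1 : 𝔸 →L[ℂ] 𝔸)), μ.re ≠ 0) :
    ∃ δ c : ℝ, 0 < δ ∧ 0 ≤ c ∧ ∃ P : (ℝ → 𝔸) → 𝔸 → ℝ → 𝔸,
      (∀ B A, IsAsymptoticallyConstant A₀ δ C₀ ν B A →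
        (∀ x, HasDerivAt (P B A) (B x * P B A x - P B A x * A) x) ∧
        ∀ x, 0 ≤ x → ‖P B A x - 1‖ ≤ c * Real.exp (-η * x)) ∧
      ∀ B A B' A' d, IsAsymptoticallyConstant A₀ δ C₀ ν B A →
        IsAsymptoticallyConstant A₀ δ C₀ ν B' A' →
        (∀ x, 0 ≤ x → ‖(B x - A) - (B' x - A')‖ ≤ d * Real.exp (-η * x)) →
        ‖P B A 0 - P B' A' 0‖ ≤ c * (‖A - A'‖ + d) := by
  -- Substituting P = 1 + exp(-ηx) u into P' = BP - PA gives u' = (ad A₀ + η) u + [A - A₀, u] + (B -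
  -- A) u + exp(ηx) (B - A). The shift η makes the constant part hyperbolic, the next two terms are
  -- small, and the forcing is bounded on x ≥ 0 because η < ν. So P is found by looking for a
  -- bounded u.
  obtain ⟨Qs, Qu, K, α, hdich⟩ := exists_dichotomy hyp
  set L := commutatorCLM A₀ + (η : ℂ) • (1 : 𝔸 →L[ℂ] 𝔸) with hL
  have hK0 := hdich.stable.const_nonneg
  have hα := hdich.stable.pos
  have hν : 0 < ν := hη.trans hην
  -- The perturbation allowed by roughness: half is spent on the commutator with A - A₀ (2δ = κ/2),
  -- half on B - A beyond x₀.
  set κ : ℝ := α / (4 * K + 4) with hκdef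
  have hκ : 0 < κ := by positivity
  have hκ2 : 2 * K / α * κ ≤ 1 / 2 := by
    rw [hκdef, div_mul_div_comm, div_le_div_iff₀ (by positivity) (by positivity)]
    nlinarith
  set δ : ℝ := κ / 4 with hδdef
  have hδ : 0 < δ := by positivity
  -- Freezing B at its value in x₀ to the left of x₀ makes the perturbation small on the whole line
  -- and leaves the equation unchanged for x ≥ x₀.
  obtain ⟨x₀, hx₀0, hx₀⟩ : ∃ x₀ : ℝ, 0 ≤ x₀ ∧ C₀ * Real.exp (-ν * x₀) ≤ κ / 2 := by
    have h1 : Tendsto (fun x : ℝ => C₀ * Real.exp (-ν * x)) atTop (𝓝 (C₀ * 0)) := by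
      refine Tendsto.const_mul _ (Real.tendsto_exp_atBot.comp ?_)
      exact tendsto_id.const_mul_atTop_of_neg (by linarith)
    rw [mul_zero] at h1
    obtain ⟨x, h2, h3⟩ := ((h1.eventually (gt_mem_nhds (show (0:ℝ) < κ / 2 by positivity))).and
      (eventually_ge_atTop 0)).exists
    exact ⟨x, h3, h2.le⟩
  set U : ℝ := 2 * (2 * K / α * C₀) with hU
  set M : ℝ := ‖A₀‖ + δ + |C₀| + 1 with hM
  have hM0 : 0 < M := by positivity
  set E : ℝ := ‖(1:𝔸)‖ * Real.exp (M * x₀) with hE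
  have hE0 : 0 ≤ E := by positivity
  -- perturbation terms
  let F : (ℝ → 𝔸) → 𝔸 → ℝ → 𝔸 →L[ℂ] 𝔸 := fun B A x =>
    commutatorCLM (A - A₀) + ContinuousLinearMap.mul ℂ 𝔸 (B (max x x₀) - A)
  let f : (ℝ → 𝔸) → 𝔸 → ℝ → 𝔸 := fun B A x => ((Real.exp (η * x) : ℝ) : ℂ) • (B (max x x₀) - A)
  have hFc : ∀ B A, IsAsymptoticallyConstant A₀ δ C₀ ν B A → Continuous (F B A) := fun B A h => by
    have := h.cont
    simp only [F]; fun_prop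
  have hfc : ∀ B A, IsAsymptoticallyConstant A₀ δ C₀ ν B A → Continuous (f B A) := fun B A h => by
    have := h.cont
    simp only [f]; fun_prop
  have hmax : ∀ x, 0 ≤ max x x₀ := fun x => hx₀0.trans (le_max_right _ _)
  have hFκ : ∀ B A, IsAsymptoticallyConstant A₀ δ C₀ ν B A → ∀ x, ‖F B A x‖ ≤ κ := by
    intro B A h x
    have hC₀ : 0 ≤ C₀ := by simpa using (norm_nonneg _).trans (h.decay 0)
    have h1 := (norm_commutatorCLM_le (A - A₀)).trans (mul_le_mul_of_nonneg_left h.near two_pos.le)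
    have h2 : ‖ContinuousLinearMap.mul ℂ 𝔸 (B (max x x₀) - A)‖ ≤ κ / 2 := by
      refine (ContinuousLinearMap.opNorm_mul_apply_le ℂ 𝔸 _).trans ((h.decay _).trans ?_)
      refine le_trans ?_ hx₀
      rw [abs_of_nonneg (hmax x)]
      gcongr ?_ * Real.exp ?_
      nlinarith [le_max_right x x₀]
    refine (norm_add_le _ _).trans ?_
    calc _ ≤ 2 * δ + κ / 2 := add_le_add h1 h2
      _ = κ := by rw [hδdef]; ring
  have hexp : ∀ x, Real.exp (η * x) * Real.exp (-η * max x x₀) ≤ 1 := fun x => by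
    rw [← Real.exp_add]
    refine Real.exp_le_one_iff.2 ?_
    nlinarith [le_max_left x x₀]
  have hfH : ∀ B A, IsAsymptoticallyConstant A₀ δ C₀ ν B A → ∀ x, ‖f B A x‖ ≤ C₀ := by
    intro B A h x
    have hC₀ : 0 ≤ C₀ := by simpa using (norm_nonneg _).trans (h.decay 0)
    simp only [f]
    rw [norm_smul, Complex.norm_real, Real.norm_of_nonneg (Real.exp_pos _).le]
    calc _ ≤ Real.exp (η * x) * (C₀ * Real.exp (-η * max x x₀)) := by
          gcongr
          refine (h.decay _).trans ?_
          rw [abs_of_nonneg (hmax x)]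
          gcongr ?_ * Real.exp ?_
          nlinarith [hmax x]
      _ = C₀ * (Real.exp (η * x) * Real.exp (-η * max x x₀)) := by ring
      _ ≤ C₀ * 1 := by gcongr; exact hexp x
      _ = C₀ := mul_one _
  have hMbd : ∀ B A, IsAsymptoticallyConstant A₀ δ C₀ ν B A → (∀ x, ‖B x‖ ≤ M) ∧ ‖A‖ ≤ M := by
    intro B A h
    refine ⟨fun x => (h.norm_le hν x).trans ?_, ?_⟩
    · rw [hM]; linarith [le_abs_self C₀]
    · have : A = A₀ + (A - A₀) := by abel
      rw [this]
      refine (norm_add_le _ _).trans ?_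
      have := h.near
      have := abs_nonneg C₀
      linarith
  -- choice of the bounded solution and of the flow back to `0`
  have key : ∀ B A, IsAsymptoticallyConstant A₀ δ C₀ ν B A → ∃ (u Ψ : ℝ → 𝔸), Continuous u ∧
      (∀ x, ‖u x‖ ≤ U) ∧ (∀ x, u x = green L Qs Qu (fun y => F B A y (u y) + f B A y) x) ∧
      Ψ 0 = 1 ∧ ∀ x, HasDerivAt Ψ (B (x + x₀) * Ψ x) x := by
    intro B A h
    obtain ⟨u, hu⟩ := exists_bounded_solution hdich hκ2 (hFc B A h) (hFκ B A h) (hfc B A h)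
      (hfH B A h)
    obtain ⟨Ψ, hΨ⟩ := exists_linearODE_solution (B := fun x => B (x + x₀))
      (by have := h.cont; fun_prop) (fun x => (hMbd B A h).1 (x + x₀))
    exact ⟨u, Ψ, hu.1, hu.2.1, hu.2.2, hΨ⟩
  -- One simultaneous choice for all pairs (B, A), so that the bounds and the Lipschitz comparison
  -- concern the same conjugators.
  choose! u Ψ huc huU hug hΨ0 hΨ using key
  let p : (ℝ → 𝔸) → 𝔸 → 𝔸 := fun B A => 1 + ((Real.exp (-η * x₀) : ℝ) : ℂ) • u B A x₀
  have hexpd : ∀ (A : 𝔸) (s : ℝ), HasDerivAt (fun x : ℝ => NormedSpace.exp ((x : ℂ) • A))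
      (A * NormedSpace.exp ((s : ℂ) • A)) s := fun A s => by
    simpa [Function.comp_def] using
      (hasDerivAt_exp_smul_const' A (s : ℂ)).scomp s Complex.ofRealCLM.hasDerivAt
  have hexpc : ∀ (A : 𝔸) (s : ℂ), A * NormedSpace.exp (s • A) = NormedSpace.exp (s • A) * A :=
    fun A s => ((Commute.refl A).smul_right s).exp_right
  have hexpn : ∀ (A : 𝔸) (s : ℝ), ‖A‖ ≤ M → |s| ≤ x₀ → ‖NormedSpace.exp ((s : ℂ) • A)‖ ≤ E := by
    intro A s hA hs
    refine (linearODE_norm_le (B := fun _ => A) (fun _ => hA) (hexpd A) s).trans ?_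
    simp only [Complex.ofReal_zero, zero_smul, NormedSpace.exp_zero]
    rw [hE]
    gcongr
  have hexpd2 : ∀ (A : 𝔸) (x : ℝ), HasDerivAt
      (fun x : ℝ => NormedSpace.exp (((x₀ - x : ℝ) : ℂ) • A))
      (-(NormedSpace.exp (((x₀ - x : ℝ) : ℂ) • A) * A)) x := fun A x => by
    have := (hexpd A (x₀ - x)).scomp x ((hasDerivAt_id x).const_sub x₀)
    rw [hexpc] at this
    convert! this using 1
    simp
  -- Transport the value at x₀ over all of ℝ, by the flow of B on the left and that of A on the
  -- right. This solves the true, unfrozen equation everywhere, and uniqueness identifies it with 1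
  -- + exp(-ηx) u for x ≥ x₀.
  let P : (ℝ → 𝔸) → 𝔸 → ℝ → 𝔸 := fun B A x =>
    Ψ B A (x - x₀) * p B A * NormedSpace.exp (((x₀ - x : ℝ) : ℂ) • A)
  have hPd : ∀ B A, IsAsymptoticallyConstant A₀ δ C₀ ν B A →
      ∀ x, HasDerivAt (P B A) (B x * P B A x - P B A x * A) x := by
    intro B A h x
    have h1 := (hΨ B A h (x - x₀)).comp_sub_const x x₀
    simp only [sub_add_cancel] at h1
    have h2 := (h1.mul_const (p B A)).mul (hexpd2 A x)
    convert! h2 using 1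
    simp only [P]; noncomm_ring
  have hΨE : ∀ B A, IsAsymptoticallyConstant A₀ δ C₀ ν B A → ∀ s, |s| ≤ x₀ → ‖Ψ B A s‖ ≤ E := by
    intro B A h s hs
    refine (linearODE_norm_le (B := fun x => B (x + x₀)) (fun y => (hMbd B A h).1 _)
      (hΨ B A h) s).trans ?_
    rw [hΨ0 B A h, hE]
    gcongr
  have hpn : ∀ B A, IsAsymptoticallyConstant A₀ δ C₀ ν B A → ‖p B A‖ ≤ ‖(1:𝔸)‖ + U := by
    intro B A h
    refine (norm_add_le _ _).trans (add_le_add le_rfl ?_)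
    rw [norm_smul, Complex.norm_real, Real.norm_of_nonneg (Real.exp_pos _).le]
    have h1 : Real.exp (-η * x₀) ≤ 1 := Real.exp_le_one_iff.2 (by nlinarith)
    have h2 := huU B A h x₀
    have := norm_nonneg (u B A x₀)
    nlinarith [Real.exp_pos (-η * x₀)]
  -- identification with the bounded solution beyond `x₀`
  have hPu : ∀ B A, IsAsymptoticallyConstant A₀ δ C₀ ν B A → ∀ x, x₀ ≤ x →
      P B A x = 1 + ((Real.exp (-η * x) : ℝ) : ℂ) • u B A x := by
    intro B A h x hx
    set q : ℝ → 𝔸 := fun x => 1 + ((Real.exp (-η * x) : ℝ) : ℂ) • u B A x with hq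
    have hud : ∀ y, HasDerivAt (u B A) (L (u B A y) + (F B A y (u B A y) + f B A y)) y := by
      intro y
      have e : u B A = green L Qs Qu (fun y => F B A y (u B A y) + f B A y) :=
        funext (hug B A h)
      have hb : ∀ z, ‖F B A z (u B A z) + f B A z‖ ≤ κ * U + C₀ := fun z =>
        (norm_add_le _ _).trans (add_le_add (((F B A z).le_opNorm _).trans
          (by gcongr; exacts [hFκ B A h z, huU B A h z])) (hfH B A h z))
      have := hasDerivAt_green hdich hb
        (((hFc B A h).clm_apply (huc B A h)).add (hfc B A h)) y
      rw [← e] at this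
      exact this
    have hqd : ∀ y, x₀ ≤ y → HasDerivAt q (B y * q y - q y * A) y := by
      intro y hy
      have h1 : HasDerivAt (fun x : ℝ => ((Real.exp (-η * x) : ℝ) : ℂ))
          ((Real.exp (-η * y) * (-η) : ℝ) : ℂ) y := by
        refine HasDerivAt.ofReal_comp ?_
        simpa using ((hasDerivAt_id y).const_mul (-η)).exp
      have h2 := (h1.smul (hud y)).const_add 1
      convert! h2 using 1
      have hmy : max y x₀ = y := max_eq_left hy
      have ee : ((Real.exp (-η * y) : ℝ) : ℂ) * ((Real.exp (η * y) : ℝ) : ℂ) = 1 := by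
        rw [← Complex.ofReal_mul, ← Real.exp_add]; simp
      simp only [hq, L, F, f, hmy, _root_.add_apply, commutatorCLM_apply, smul_add, smul_smul, ee,
        ContinuousLinearMap.mul_apply', one_smul, smul_apply,
        one_apply_eq_self, mul_add, add_mul, sub_mul, mul_sub, smul_sub, mul_smul_comm,
        smul_mul_assoc, Complex.ofReal_mul, Complex.ofReal_neg, mul_neg, neg_smul, mul_one, one_mul]
      abel
    have hqe : q x * NormedSpace.exp (((x - x₀ : ℝ) : ℂ) • A) = Ψ B A (x - x₀) * p B A := by
      refine linearODE_eq_right (B := B) (K := M) (hMbd B A h).1 (a := x₀)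
        (F := fun x => q x * NormedSpace.exp (((x - x₀ : ℝ) : ℂ) • A))
        (G := fun x => Ψ B A (x - x₀) * p B A) (fun y hy => ?_) (fun y _ => ?_) ?_ hx
      · have h1 := (hqd y hy).mul ((hexpd A (y - x₀)).comp_sub_const y x₀)
        convert! h1 using 1
        noncomm_ring
      · have h1 := (hΨ B A h (y - x₀)).comp_sub_const y x₀
        simp only [sub_add_cancel] at h1
        simpa [mul_assoc] using h1.mul_const (p B A)
      · simp [hΨ0 B A h, q, p]
    simp only [P]
    rw [← hqe, mul_assoc]
    have e3 : NormedSpace.exp (((x - x₀ : ℝ) : ℂ) • A) * NormedSpace.exp (((x₀ - x : ℝ) : ℂ) • A)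
        = 1 := by
      let _ : NormedAlgebra ℚ 𝔸 := NormedAlgebra.restrictScalars ℚ ℂ _
      rw [← NormedSpace.exp_add_of_commute
        (((Commute.refl A).smul_left _).smul_right _), ← add_smul]
      simp
    rw [e3, mul_one]
  obtain ⟨c₁, hc₁0, hc₁⟩ := linearODE_norm_sub_le (𝔸 := 𝔸) hM0 hx₀0
  set G : ℝ := ‖(1:𝔸)‖ + |U| with hG
  have hG0 : 0 ≤ G := by positivity
  have hpG : ∀ B A, IsAsymptoticallyConstant A₀ δ C₀ ν B A → ‖p B A‖ ≤ G := fun B A h =>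
    (hpn B A h).trans (by have := le_abs_self U; rw [hG]; gcongr)
  -- On [0, x₀] the conjugator is merely bounded, and the factor exp(ηx₀) turns this into an
  -- exponential bound; beyond x₀ the bound |U| on u suffices.
  set c₂ : ℝ := (E * G * E + ‖(1:𝔸)‖) * Real.exp (η * x₀) + |U| with hc₂
  set c₃ : ℝ := 2 * (2 * K / α * (2 * |U| + 1)) with hc₃
  have hc₃0 : 0 ≤ c₃ := by positivity
  set c₄ : ℝ := c₁ * G * E + E * c₃ * E + E * G * c₁ with hc₄
  have hc₄0 : 0 ≤ c₄ := by positivity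
  refine ⟨δ, c₂ + c₄, hδ, by positivity, P, fun B A h => ⟨hPd B A h, fun x hx => ?_⟩, ?_⟩
  · have hc24 : c₂ ≤ c₂ + c₄ := by linarith
    refine le_trans ?_ (mul_le_mul_of_nonneg_right hc24 (Real.exp_pos _).le)
    rcases le_total x₀ x with hxx | hxx
    · rw [hPu B A h x hxx, add_sub_cancel_left, norm_smul, Complex.norm_real,
        Real.norm_of_nonneg (Real.exp_pos _).le, mul_comm]
      gcongr
      refine (huU B A h x).trans ((le_abs_self U).trans ?_)
      rw [hc₂]
      have : 0 ≤ (E * G * E + ‖(1:𝔸)‖) * Real.exp (η * x₀) := by positivity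
      linarith
    · have h1 : ‖P B A x‖ ≤ E * G * E := by
        refine (norm_mul_le _ _).trans (mul_le_mul ((norm_mul_le _ _).trans (mul_le_mul ?_
          (hpG B A h) (norm_nonneg _) hE0)) ?_ (norm_nonneg _) (by positivity))
        · exact hΨE B A h _ (by rw [abs_of_nonpos (by linarith)]; linarith)
        · exact hexpn A _ (hMbd B A h).2 (by rw [abs_of_nonneg (by linarith)]; linarith)
      have h2 : 1 ≤ Real.exp (η * x₀) * Real.exp (-η * x) := by
        rw [← Real.exp_add]; exact Real.one_le_exp (by nlinarith)
      calc _ ≤ E * G * E + ‖(1:𝔸)‖ := (norm_sub_le _ _).trans (by gcongr)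
        _ ≤ (E * G * E + ‖(1:𝔸)‖) * (Real.exp (η * x₀) * Real.exp (-η * x)) :=
            le_mul_of_one_le_right (by positivity) h2
        _ = (E * G * E + ‖(1:𝔸)‖) * Real.exp (η * x₀) * Real.exp (-η * x) := by ring
        _ ≤ _ := by gcongr; rw [hc₂]; linarith [abs_nonneg U]
  · intro B A B' A' d h h' hd
    have hd0 : 0 ≤ d := by simpa using (norm_nonneg _).trans (hd 0 le_rfl)
    set D : ℝ := ‖A - A'‖ + d with hD
    have hD0 : 0 ≤ D := by positivity
    have hdd : ∀ x, 0 ≤ x → ‖(B x - A) - (B' x - A')‖ ≤ d := fun x hx => (hd x hx).trans (by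
      have : Real.exp (-η * x) ≤ 1 := Real.exp_le_one_iff.2 (by nlinarith)
      nlinarith)
    have hu2 : ‖u B A x₀ - u B' A' x₀‖ ≤ c₃ * D := by
      have h1 := norm_bounded_solution_sub_le hdich hκ2 (hFc B A h) (hFc B' A' h') (hFκ B A h)
        (hFκ B' A' h') (hfc B A h) (hfH B A h) (hfc B' A' h') (hfH B' A' h') (huc B A h)
        (huc B' A' h') (huU B A h) (fun x => (huU B' A' h' x).trans (le_abs_self U))
        (hug B A h) (hug B' A' h')
        (δ := 2 * D) (δ' := D) (fun x => ?_) (fun x => ?_) x₀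
      · refine h1.trans (le_of_eq ?_)
        rw [hc₃]; ring
      · have e : F B A x - F B' A' x = commutatorCLM (A - A') +
            ContinuousLinearMap.mul ℂ 𝔸 ((B (max x x₀) - A) - (B' (max x x₀) - A')) := by
          simp only [F, map_sub, commutatorCLM_sub]; abel
        rw [e]
        refine (norm_add_le _ _).trans ?_
        have h2 := norm_commutatorCLM_le (A - A')
        have h3 := (ContinuousLinearMap.opNorm_mul_apply_le ℂ 𝔸
          ((B (max x x₀) - A) - (B' (max x x₀) - A'))).trans (hdd _ (hmax x))
        rw [hD]; linarith
      · have e : f B A x - f B' A' x = ((Real.exp (η * x) : ℝ) : ℂ) •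
            ((B (max x x₀) - A) - (B' (max x x₀) - A')) := by
          simp only [f, ← smul_sub]
        rw [e, norm_smul, Complex.norm_real, Real.norm_of_nonneg (Real.exp_pos _).le]
        calc _ ≤ Real.exp (η * x) * (d * Real.exp (-η * max x x₀)) := by
              gcongr; exact hd _ (hmax x)
          _ = d * (Real.exp (η * x) * Real.exp (-η * max x x₀)) := by ring
          _ ≤ d * 1 := by gcongr; exact hexp x
          _ ≤ D := by rw [hD]; linarith [norm_nonneg (A - A')]
    have hp2 : ‖p B A - p B' A'‖ ≤ c₃ * D := by
      have e : p B A - p B' A' = ((Real.exp (-η * x₀) : ℝ) : ℂ) • (u B A x₀ - u B' A' x₀) := by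
        simp only [p, smul_sub]; abel
      rw [e, norm_smul, Complex.norm_real, Real.norm_of_nonneg (Real.exp_pos _).le]
      have : Real.exp (-η * x₀) ≤ 1 := Real.exp_le_one_iff.2 (by nlinarith)
      have := norm_nonneg (u B A x₀ - u B' A' x₀)
      nlinarith
    have hΨ2 : ‖Ψ B A (-x₀) - Ψ B' A' (-x₀)‖ ≤ c₁ * D := by
      refine hc₁ (fun x => B (x + x₀)) (fun x => B' (x + x₀)) _ _ D (fun x => (hMbd B A h).1 _)
        (fun x => (hMbd B' A' h').1 _) (fun x hx => ?_) (hΨ B A h) (hΨ B' A' h') (hΨ0 B A h)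
        (hΨ0 B' A' h') _ (by rw [abs_neg, abs_of_nonneg hx₀0])
      have e : B (x + x₀) - B' (x + x₀) = (A - A') +
          ((B (x + x₀) - A) - (B' (x + x₀) - A')) := by abel
      rw [e]
      refine (norm_add_le _ _).trans (add_le_add le_rfl (hdd _ ?_))
      rw [abs_le] at hx; linarith
    have he2 : ‖NormedSpace.exp ((x₀ : ℂ) • A) - NormedSpace.exp ((x₀ : ℂ) • A')‖ ≤ c₁ * D :=
      hc₁ (fun _ => A) (fun _ => A') (fun x : ℝ => NormedSpace.exp ((x : ℂ) • A))
        (fun x : ℝ => NormedSpace.exp ((x : ℂ) • A')) D (fun _ => (hMbd B A h).2)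
        (fun _ => (hMbd B' A' h').2) (fun _ _ => by rw [hD]; linarith) (hexpd A) (hexpd A')
        (by simp) (by simp) x₀ (by rw [abs_of_nonneg hx₀0])
    have hneg : |-x₀| ≤ x₀ := by rw [abs_neg, abs_of_nonneg hx₀0]
    have hpos : |x₀| ≤ x₀ := by rw [abs_of_nonneg hx₀0]
    -- Telescoping: change the flow of B, the value at x₀ and the flow of A one at a time.
    have e : P B A 0 - P B' A' 0 =
        (Ψ B A (-x₀) - Ψ B' A' (-x₀)) * p B A * NormedSpace.exp ((x₀ : ℂ) • A) +
        Ψ B' A' (-x₀) * (p B A - p B' A') * NormedSpace.exp ((x₀ : ℂ) • A) +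
        Ψ B' A' (-x₀) * p B' A' *
          (NormedSpace.exp ((x₀ : ℂ) • A) - NormedSpace.exp ((x₀ : ℂ) • A')) := by
      simp only [P, zero_sub, sub_zero]; noncomm_ring
    have hmul3 : ∀ {a b c : 𝔸} {r s t : ℝ}, ‖a‖ ≤ r → ‖b‖ ≤ s → ‖c‖ ≤ t →
        ‖a * b * c‖ ≤ r * s * t := fun ha hb hc => by
      have := (norm_nonneg _).trans ha
      have := (norm_nonneg _).trans hb
      exact (norm_mul_le _ _).trans (mul_le_mul ((norm_mul_le _ _).trans (by gcongr)) hc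
        (norm_nonneg _) (by positivity))
    rw [e]
    calc _ ≤ c₁ * D * G * E + E * (c₃ * D) * E + E * G * (c₁ * D) := by
          refine (norm_add_le _ _).trans (add_le_add ((norm_add_le _ _).trans (add_le_add ?_ ?_)) ?_)
          · exact hmul3 hΨ2 (hpG B A h) (hexpn A _ (hMbd B A h).2 hpos)
          · exact hmul3 (hΨE B' A' h' _ hneg) hp2 (hexpn A _ (hMbd B A h).2 hpos)
          · exact hmul3 (hΨE B' A' h' _ hneg) (hpG B' A' h') he2
      _ = c₄ * D := by rw [hc₄]; ring
      _ ≤ (c₂ + c₄) * D := by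
          gcongr
          have : 0 ≤ c₂ := by positivity
          linarith

end Conjugators

/-! ### Choice of the exponential weight, and conjugators on both half-lines -/

section TwoSidedConjugators

theorem finite_spectrum_of_finiteDimensional {𝔸 : Type*} [Ring 𝔸] [Algebra ℂ 𝔸]
    [FiniteDimensional ℂ 𝔸] (a : 𝔸) : (spectrum ℂ a).Finite := by
  have hint : IsIntegral ℂ a := Algebra.IsIntegral.isIntegral a
  have hne := minpoly.ne_zero hint
  refine (Polynomial.rootSet_finite (minpoly ℂ a) ℂ).subset fun μ hμ => ?_
  have h1 := spectrum.subset_polynomial_aeval a (minpoly ℂ a) ⟨μ, hμ, rfl⟩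
  rw [minpoly.aeval] at h1
  rw [Polynomial.mem_rootSet]
  refine ⟨hne, ?_⟩
  by_contra hc
  rw [spectrum.mem_iff, sub_zero] at h1
  refine h1 (IsUnit.map (algebraMap ℂ 𝔸) (isUnit_iff_ne_zero.2 ?_))
  simpa using hc

variable {𝔸 : Type*} [NormedRing 𝔸] [NormedAlgebra ℂ 𝔸]

/-- Only finitely many η put an eigenvalue of one of the two shifted commutators on the imaginary
axis. A single η is wanted for both signs so that both half-lines share one weight. -/
theorem exists_hyperbolic_shift [FiniteDimensional ℂ 𝔸] (A₀ : 𝔸) {ν : ℝ} (hν : 0 < ν) :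
    ∃ η, 0 < η ∧ η < ν ∧
      (∀ μ ∈ spectrum ℂ (commutatorCLM A₀ + (η : ℂ) • (1 : 𝔸 →L[ℂ] 𝔸)), μ.re ≠ 0) ∧
      ∀ μ ∈ spectrum ℂ (commutatorCLM (-A₀) + (η : ℂ) • (1 : 𝔸 →L[ℂ] 𝔸)), μ.re ≠ 0 := by
  have hfin : ((fun μ : ℂ => -μ.re) '' spectrum ℂ (commutatorCLM A₀) ∪
      (fun μ : ℂ => -μ.re) '' spectrum ℂ (commutatorCLM (-A₀))).Finite :=
    ((finite_spectrum_of_finiteDimensional _).image _).union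
      ((finite_spectrum_of_finiteDimensional _).image _)
  obtain ⟨η, hη, hη2⟩ := ((Set.Ioo_infinite hν).sdiff hfin).nonempty
  have key : ∀ (a : 𝔸 →L[ℂ] 𝔸), η ∉ (fun μ : ℂ => -μ.re) '' spectrum ℂ a →
      ∀ μ ∈ spectrum ℂ (a + (η : ℂ) • (1 : 𝔸 →L[ℂ] 𝔸)), μ.re ≠ 0 := by
    intro a ha μ hμ h0
    rw [← Algebra.algebraMap_eq_smul_one] at hμ
    refine ha ⟨μ - η, ?_, ?_⟩
    · have := spectrum.add_mem_add_iff (R := ℂ) (a := a) (r := μ - η) (s := (η : ℂ))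
      rw [← this, sub_add_cancel, add_comm]
      exact hμ
    · simp [h0]
  exact ⟨η, hη.1, hη.2, key _ fun h => hη2 (Or.inl h), key _ fun h => hη2 (Or.inr h)⟩

/-- The substitution x ↦ -x turns the left half-line problem for (B, A) into a right half-line
problem for (-B(-·), -A); left conjugators are obtained this way. -/
theorem IsAsymptoticallyConstant.reflect {𝔸 : Type*} [NormedRing 𝔸] {A₀ : 𝔸} {δ C₀ ν : ℝ}
    {B : ℝ → 𝔸} {A : 𝔸}
    (h : IsAsymptoticallyConstant A₀ δ C₀ ν B A) :
    IsAsymptoticallyConstant (-A₀) δ C₀ ν (fun x => -B (-x)) (-A) where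
  cont := by have := h.cont; fun_prop
  near := by rw [← neg_sub', norm_neg]; exact h.near
  decay x := by
    have := h.decay (-x)
    rwa [abs_neg, ← norm_neg, neg_sub'] at this

/-- Conjugators on both half-lines, for coefficients whose limit is close to a fixed matrix. -/
theorem exists_conjugators [CompleteSpace 𝔸] [FiniteDimensional ℂ 𝔸] (A₀ : 𝔸) {ν : ℝ}
    (hν : 0 < ν) (C₀ : ℝ) :
    ∃ η δ c : ℝ, 0 < η ∧ η < ν ∧ 0 < δ ∧ 0 ≤ c ∧ ∃ Pp Pm : (ℝ → 𝔸) → 𝔸 → ℝ → 𝔸,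
      (∀ B A, IsAsymptoticallyConstant A₀ δ C₀ ν B A →
        (∀ x, HasDerivAt (Pp B A) (B x * Pp B A x - Pp B A x * A) x) ∧
        (∀ x, HasDerivAt (Pm B A) (B x * Pm B A x - Pm B A x * A) x) ∧
        (∀ x, 0 ≤ x → ‖Pp B A x - 1‖ ≤ c * Real.exp (-η * |x|)) ∧
        (∀ x, x ≤ 0 → ‖Pm B A x - 1‖ ≤ c * Real.exp (-η * |x|))) ∧
      ∀ B A B' A' d, IsAsymptoticallyConstant A₀ δ C₀ ν B A →
        IsAsymptoticallyConstant A₀ δ C₀ ν B' A' →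
        (∀ x, ‖(B x - A) - (B' x - A')‖ ≤ d * Real.exp (-η * |x|)) →
        ‖Pp B A 0 - Pp B' A' 0‖ ≤ c * (‖A - A'‖ + d) ∧
        ‖Pm B A 0 - Pm B' A' 0‖ ≤ c * (‖A - A'‖ + d) := by
  obtain ⟨η, hη, hην, h1, h2⟩ := exists_hyperbolic_shift A₀ hν
  obtain ⟨δ₁, c₁, hδ₁, hc₁, P, hP, hPl⟩ := exists_conjugator_right A₀ (C₀ := C₀) hη hην h1
  obtain ⟨δ₂, c₂, hδ₂, hc₂, R, hR, hRl⟩ := exists_conjugator_right (-A₀) (C₀ := C₀) hη hην h2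
  have w1 : ∀ {B A}, IsAsymptoticallyConstant A₀ (min δ₁ δ₂) C₀ ν B A →
      IsAsymptoticallyConstant A₀ δ₁ C₀ ν B A := fun h =>
    ⟨h.cont, h.near.trans (min_le_left _ _), h.decay⟩
  have w2 : ∀ {B A}, IsAsymptoticallyConstant A₀ (min δ₁ δ₂) C₀ ν B A →
      IsAsymptoticallyConstant (-A₀) δ₂ C₀ ν (fun x => -B (-x)) (-A) := fun h =>
    IsAsymptoticallyConstant.reflect ⟨h.cont, h.near.trans (min_le_right _ _), h.decay⟩
  refine ⟨η, min δ₁ δ₂, c₁ + c₂, hη, hην, lt_min hδ₁ hδ₂, by positivity, P,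
    fun B A x => R (fun x => -B (-x)) (-A) (-x), ?_, ?_⟩
  · intro B A h
    obtain ⟨hd1, hb1⟩ := hP B A (w1 h)
    obtain ⟨hd2, hb2⟩ := hR _ _ (w2 h)
    refine ⟨hd1, fun x => ?_, fun x hx => ?_, fun x hx => ?_⟩
    · have := (hd2 (-x)).scomp x (hasDerivAt_neg x)
      convert! this using 1
      simp [sub_eq_add_neg]
    · rw [abs_of_nonneg hx]
      refine (hb1 x hx).trans ?_
      gcongr; linarith
    · rw [abs_of_nonpos hx]
      refine (hb2 (-x) (by linarith)).trans ?_
      gcongr; linarith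
  · intro B A B' A' d h h' hd
    have hd0 : 0 ≤ d := by simpa using (norm_nonneg _).trans (hd 0)
    constructor
    · refine (hPl B A B' A' d (w1 h) (w1 h') (fun x hx => ?_)).trans ?_
      · simpa [abs_of_nonneg hx] using hd x
      · gcongr; linarith
    · have h3 := hRl _ _ _ _ d (w2 h) (w2 h') (fun x hx => ?_)
      · simp only [neg_zero]
        refine h3.trans ?_
        have e : ‖-A - -A'‖ = ‖A - A'‖ := by rw [neg_sub_neg, norm_sub_rev]
        rw [e]
        gcongr; linarith
      · have h4 := hd (-x)
        rw [abs_neg, abs_of_nonneg hx, ← norm_neg] at h4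
        convert! h4 using 2
        abel

end TwoSidedConjugators

/-! ### Invertibility and comparison of conjugators -/

section HalfLineConjugators

variable {𝔸 : Type*} [NormedRing 𝔸] [NormedAlgebra ℂ 𝔸]

theorem hasDerivAt_exp_ofReal_smul_const [CompleteSpace 𝔸] (A : 𝔸) (s : ℝ) :
    HasDerivAt (fun x : ℝ => NormedSpace.exp ((x : ℂ) • A)) (A * NormedSpace.exp ((s : ℂ) • A)) s := by
  simpa [Function.comp_def] using
    (hasDerivAt_exp_smul_const' A (s : ℂ)).scomp s Complex.ofRealCLM.hasDerivAt

theorem mul_exp_smul_comm {A Q : 𝔸} (h : A * Q = Q * A) (s : ℂ) :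
    NormedSpace.exp (s • A) * Q = Q * NormedSpace.exp (s • A) :=
  (((Commute.symm h).smul_right s).exp_right).symm

theorem exp_smul_mul_exp_neg_smul [CompleteSpace 𝔸] (A : 𝔸) (s : ℂ) :
    NormedSpace.exp (s • A) * NormedSpace.exp ((-s) • A) = 1 := by
  let _ : NormedAlgebra ℚ 𝔸 := NormedAlgebra.restrictScalars ℚ ℂ _
  rw [← NormedSpace.exp_add_of_commute (((Commute.refl A).smul_left _).smul_right _), ← add_smul]
  simp

theorem exp_neg_smul_mul_exp_smul [CompleteSpace 𝔸] (A : 𝔸) (s : ℂ) :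
    NormedSpace.exp ((-s) • A) * NormedSpace.exp (s • A) = 1 := by
  simpa using exp_smul_mul_exp_neg_smul A (-s)

/-- `P` conjugates `W' = B W` on `x ≥ 0` to `Z' = A Z`, and tends to the identity. -/
structure IsRightConjugator (B : ℝ → 𝔸) (A : 𝔸) (P : ℝ → 𝔸) : Prop where
  deriv : ∀ x, 0 ≤ x → HasDerivWithinAt P (B x * P x - P x * A) (Set.Ici 0) x
  tendsto : Tendsto P atTop (𝓝 1)

variable [CompleteSpace 𝔸] {B : ℝ → 𝔸} {A : 𝔸} {P R : ℝ → 𝔸}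

theorem IsRightConjugator.mul_exp_eq (h : IsRightConjugator B A P) {K : ℝ} (hK : ∀ x, ‖B x‖ ≤ K)
    {Φ : ℝ → 𝔸} (h0 : Φ 0 = 1) (hΦ : ∀ x, HasDerivAt Φ (B x * Φ x) x) {x : ℝ} (hx : 0 ≤ x) :
    P x * NormedSpace.exp ((x : ℂ) • A) = Φ x * P 0 := by
  set f : ℝ → 𝔸 := fun x => P x * NormedSpace.exp ((x : ℂ) • A) - Φ x * P 0 with hf
  have hd : ∀ y, 0 ≤ y → HasDerivWithinAt f (B y * f y) (Set.Ici 0) y := fun y hy => by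
    have h1 := ((h.deriv y hy).mul (hasDerivAt_exp_ofReal_smul_const A y).hasDerivWithinAt).sub
      ((hΦ y).mul_const (P 0)).hasDerivWithinAt
    convert! h1 using 1
    simp only [hf]; noncomm_ring
  have := norm_le_gronwallBound_of_norm_deriv_right_le (f := f)
    (f' := fun y => B y * f y) (δ := 0) (K := K) (ε := 0) (a := 0) (b := x)
    (fun y hy => ((hd y hy.1).continuousWithinAt).mono fun z hz => hz.1)
    (fun y hy => (hd y hy.1).mono (Set.Ici_subset_Ici.2 hy.1)) (by simp [hf, h0])
    (fun y _ => by rw [add_zero]; exact (norm_mul_le _ _).trans (by gcongr; exact hK y))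
    x ⟨hx, le_rfl⟩
  rw [gronwallBound_ε0_δ0] at this
  exact sub_eq_zero.1 (norm_le_zero_iff.1 this)

/-- P tends to 1, hence is invertible far out, and the relation P(x) exp(xA) = Φ(x) P(0) between
invertible flows carries this back to 0. -/
theorem IsRightConjugator.isUnit_zero (h : IsRightConjugator B A P) (hB : Continuous B) {K : ℝ}
    (hK : ∀ x, ‖B x‖ ≤ K) : IsUnit (P 0) := by
  obtain ⟨Φ, h0, hΦ⟩ := exists_linearODE_solution hB hK
  have hu : ∀ᶠ x in atTop, IsUnit (P x) :=
    h.tendsto.eventually (Units.isOpen.mem_nhds isUnit_one)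
  obtain ⟨x, hx, hx0⟩ := (hu.and (eventually_ge_atTop 0)).exists
  have e := h.mul_exp_eq hK h0 hΦ hx0
  have hΦu := linearODE_isUnit hB hK h0 hΦ x
  have h2 : IsUnit (NormedSpace.exp ((x : ℂ) • A)) :=
    ⟨⟨_, _, exp_smul_mul_exp_neg_smul A x, exp_neg_smul_mul_exp_smul A x⟩, rfl⟩
  have h3 : IsUnit (Φ x * P 0) := e ▸ hx.mul h2
  obtain ⟨u, hu⟩ := hΦu
  rw [← hu] at h3
  exact (Units.isUnit_units_mul u _).1 h3

/-- Two conjugators differ by a factor that is asymptotically trivial. -/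
theorem IsRightConjugator.exists_eq_mul (hP : IsRightConjugator B A P)
    (hR : IsRightConjugator B A R) (hB : Continuous B) {K : ℝ} (hK : ∀ x, ‖B x‖ ≤ K) :
    ∃ T : 𝔸, R 0 = P 0 * T ∧ Tendsto (fun x : ℝ => NormedSpace.exp ((x : ℂ) • A) * T *
      NormedSpace.exp (((-x : ℝ) : ℂ) • A)) atTop (𝓝 1) := by
  obtain ⟨Φ, h0, hΦ⟩ := exists_linearODE_solution hB hK
  have hP0 := hP.isUnit_zero hB hK
  refine ⟨Ring.inverse (P 0) * R 0, by rw [← mul_assoc, Ring.mul_inverse_cancel _ hP0, one_mul], ?_⟩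
  have hu : ∀ᶠ x in atTop, IsUnit (P x) :=
    hP.tendsto.eventually (Units.isOpen.mem_nhds isUnit_one)
  have hlim : Tendsto (fun x => Ring.inverse (P x) * R x) atTop (𝓝 1) := by
    have h1 : Tendsto (fun x => Ring.inverse (P x)) atTop (𝓝 1) := by
      have := (NormedRing.inverse_continuousAt (1 : 𝔸ˣ)).tendsto.comp
        (by simpa using hP.tendsto : Tendsto P atTop (𝓝 ((1 : 𝔸ˣ) : 𝔸)))
      simpa [Function.comp_def] using this
    simpa using h1.mul hR.tendsto
  refine hlim.congr' ?_
  filter_upwards [hu, eventually_ge_atTop 0] with x hx hx0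
  have e1 := hP.mul_exp_eq hK h0 hΦ hx0
  have e2 := hR.mul_exp_eq hK h0 hΦ hx0
  have e3 : R x = P x * (NormedSpace.exp ((x : ℂ) • A) * (Ring.inverse (P 0) * R 0) *
      NormedSpace.exp (((-x : ℝ) : ℂ) • A)) := by
    have : P x * (NormedSpace.exp ((x : ℂ) • A) * (Ring.inverse (P 0) * R 0) *
      NormedSpace.exp (((-x : ℝ) : ℂ) • A)) = P x * NormedSpace.exp ((x : ℂ) • A) *
        (Ring.inverse (P 0) * R 0) * NormedSpace.exp ((-(x : ℂ)) • A) := by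
      push_cast; noncomm_ring
    rw [this, e1, mul_assoc (Φ x), Ring.mul_inverse_cancel_left _ _ hP0, ← e2, mul_assoc,
      exp_smul_mul_exp_neg_smul, mul_one]
  rw [e3, ← mul_assoc, Ring.inverse_mul_cancel _ hx, one_mul]

/-- As (1 - Q) Q = 0, the corner (1 - Q) T Q equals exp(-xA) (1 - Q) times (exp(xA) T exp(-xA) - 1)
times exp(xA) Q. The outer factors stay bounded and the middle one tends to zero. So T preserves the
stable subspace. -/
theorem eq_zero_of_tendsto_conj {Q T : 𝔸} (hQ : A * Q = Q * A) (hQ2 : Q * Q = Q) {K : ℝ}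
    (hs : ∀ t : ℝ, 0 ≤ t → ‖NormedSpace.exp ((t : ℂ) • A) * Q‖ ≤ K)
    (hu : ∀ t : ℝ, 0 ≤ t → ‖NormedSpace.exp (((-t : ℝ) : ℂ) • A) * (1 - Q)‖ ≤ K)
    (hT : Tendsto (fun x : ℝ => NormedSpace.exp ((x : ℂ) • A) * T *
      NormedSpace.exp (((-x : ℝ) : ℂ) • A)) atTop (𝓝 1)) : (1 - Q) * T * Q = 0 := by
  have hK0 : 0 ≤ K := (norm_nonneg _).trans (hs 0 le_rfl)
  have hlim : Tendsto (fun x : ℝ => K * ‖NormedSpace.exp ((x : ℂ) • A) * T *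
      NormedSpace.exp (((-x : ℝ) : ℂ) • A) - 1‖ * K) atTop (𝓝 0) := by
    have h1 := (tendsto_iff_norm_sub_tendsto_zero.1 hT)
    simpa using (h1.const_mul K).mul_const K
  have hb : ∀ᶠ x : ℝ in atTop, ‖(1 - Q) * T * Q‖ ≤ K * ‖NormedSpace.exp ((x : ℂ) • A) * T *
      NormedSpace.exp (((-x : ℝ) : ℂ) • A) - 1‖ * K := by
    filter_upwards [eventually_ge_atTop 0] with x hx
    have hQ' : A * (1 - Q) = (1 - Q) * A := by rw [mul_sub, sub_mul, hQ]; simp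
    have e : (1 - Q) * T * Q = (NormedSpace.exp (((-x : ℝ) : ℂ) • A) * (1 - Q)) *
        (NormedSpace.exp ((x : ℂ) • A) * T * NormedSpace.exp (((-x : ℝ) : ℂ) • A) - 1) *
        (NormedSpace.exp ((x : ℂ) • A) * Q) := by
      have c1 := mul_exp_smul_comm hQ' ((-x : ℝ) : ℂ)
      have i1 := exp_neg_smul_mul_exp_smul A (x : ℂ)
      have z : (1 - Q) * Q = 0 := by rw [sub_mul, one_mul, hQ2, sub_self]
      rw [c1]
      push_cast
      calc (1 - Q) * T * Q = (1 - Q) * (NormedSpace.exp (-(x : ℂ) • A) * NormedSpace.exp ((x : ℂ) • A))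
            * T * (NormedSpace.exp (-(x : ℂ) • A) * NormedSpace.exp ((x : ℂ) • A)) * Q
            - (1 - Q) * (NormedSpace.exp (-(x : ℂ) • A) * NormedSpace.exp ((x : ℂ) • A)) * Q := by
            rw [i1]; simp [z]
        _ = _ := by noncomm_ring
    rw [e]
    refine (norm_mul_le _ _).trans (mul_le_mul ((norm_mul_le _ _).trans ?_) (hs x hx)
      (norm_nonneg _) (by positivity))
    gcongr
    exact hu x hx
  have := ge_of_tendsto hlim hb
  exact norm_le_zero_iff.1 this

end HalfLineConjugators

/-! ### From entrywise statements to the operator norm on matrices -/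

section MatrixBridge

open scoped Matrix.Norms.Operator

variable {N : ℕ}

theorem Matrix.norm_entry_le_opNorm (M : Matrix (Fin N) (Fin N) ℂ) (i j : Fin N)
    : ‖M i j‖ ≤ ‖M‖ := by
  rw [Matrix.linfty_opNorm_def, ← coe_nnnorm, NNReal.coe_le_coe]
  exact (Finset.single_le_sum (f := fun j => ‖M i j‖₊) (fun _ _ => zero_le) (Finset.mem_univ j)).trans
    (Finset.le_sup (f := fun i => ∑ j, ‖M i j‖₊) (Finset.mem_univ i))

theorem Matrix.opNorm_le_of_entries {M : Matrix (Fin N) (Fin N) ℂ} {c : ℝ} (hc : 0 ≤ c)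
    (h : ∀ i j, ‖M i j‖ ≤ c) : ‖M‖ ≤ N * c := by
  rw [Matrix.linfty_opNorm_def]
  have : (Finset.univ.sup fun i => ∑ j, ‖M i j‖₊) ≤ Real.toNNReal (N * c) := by
    refine Finset.sup_le fun i _ => ?_
    rw [← NNReal.coe_le_coe, Real.coe_toNNReal _ (by positivity)]
    push_cast
    refine (Finset.sum_le_sum fun j _ => h i j).trans (le_of_eq ?_)
    simp
  have h2 := NNReal.coe_le_coe.2 this
  rwa [Real.coe_toNNReal _ (by positivity)] at h2

theorem Matrix.hasDerivAt_iff_entries {Ψ : ℝ → Matrix (Fin N) (Fin N) ℂ}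
    {Ψ' : Matrix (Fin N) (Fin N) ℂ} {x : ℝ} :
    HasDerivAt Ψ Ψ' x ↔ ∀ i j, HasDerivAt (fun y => Ψ y i j) (Ψ' i j) x := by
  refine ⟨fun h i j => hasDerivAt_pi.1 (hasDerivAt_pi.1 h i) j, fun h => ?_⟩
  exact hasDerivAt_pi.2 fun i => hasDerivAt_pi.2 fun j => h i j

theorem Matrix.hasDerivWithinAt_iff_entries {Ψ : ℝ → Matrix (Fin N) (Fin N) ℂ}
    {Ψ' : Matrix (Fin N) (Fin N) ℂ} {s : Set ℝ} {x : ℝ} :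
    HasDerivWithinAt Ψ Ψ' s x ↔ ∀ i j, HasDerivWithinAt (fun y => Ψ y i j) (Ψ' i j) s x := by
  refine ⟨fun h i j => hasDerivWithinAt_pi.1 (hasDerivWithinAt_pi.1 h i) j, fun h => ?_⟩
  exact hasDerivWithinAt_pi.2 fun i => hasDerivWithinAt_pi.2 fun j => h i j

theorem solutionOperator_spec {B : ℝ → Matrix (Fin N) (Fin N) ℂ} (hB : Continuous B) {K : ℝ}
    (hK : ∀ x, ‖B x‖ ≤ K) :
    solutionOperator B 0 = 1 ∧
      ∀ x, HasDerivAt (solutionOperator B) (B x * solutionOperator B x) x := by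
  obtain ⟨Ψ, h0, hΨ⟩ := exists_linearODE_solution hB hK
  have hex : ∃ Ψ, IsSolutionOperator B Ψ :=
    ⟨Ψ, h0, fun x i j => Matrix.hasDerivAt_iff_entries.1 (hΨ x) i j⟩
  have := Classical.epsilon_spec hex
  exact ⟨this.1, fun x => Matrix.hasDerivAt_iff_entries.2 fun i j => this.2 x i j⟩

theorem isConjugator_iff {s : Set ℝ} {B : ℝ → Matrix (Fin N) (Fin N) ℂ}
    {A : Matrix (Fin N) (Fin N) ℂ} {P : ℝ → Matrix (Fin N) (Fin N) ℂ} :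
    IsConjugator s B A P ↔ (∀ x ∈ s, HasDerivWithinAt P (B x * P x - P x * A) s x) ∧
      ∃ C η : ℝ, 0 < η ∧ ∀ x ∈ s, ‖P x - 1‖ ≤ C * Real.exp (-η * |x|) := by
  refine ⟨fun h => ⟨fun x hx => Matrix.hasDerivWithinAt_iff_entries.2 (h.1 x hx), ?_⟩,
    fun h => ⟨fun x hx => Matrix.hasDerivWithinAt_iff_entries.1 (h.1 x hx), ?_⟩⟩
  · obtain ⟨C, η, hη, hb⟩ := h.2
    refine ⟨N * |C|, η, hη, fun x hx => ?_⟩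
    rw [mul_assoc]
    refine Matrix.opNorm_le_of_entries (by positivity) fun i j => (hb x hx i j).trans ?_
    gcongr
    exact le_abs_self C
  · obtain ⟨C, η, hη, hb⟩ := h.2
    exact ⟨C, η, hη, fun x hx i j => (Matrix.norm_entry_le_opNorm _ i j).trans (hb x hx)⟩

theorem IsConjugator.isRightConjugator {B : ℝ → Matrix (Fin N) (Fin N) ℂ}
    {A : Matrix (Fin N) (Fin N) ℂ} {P : ℝ → Matrix (Fin N) (Fin N) ℂ}
    (h : IsConjugator (Set.Ici 0) B A P) : IsRightConjugator B A P := by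
  obtain ⟨hd, C, η, hη, hb⟩ := isConjugator_iff.1 h
  refine ⟨fun x hx => hd x hx, ?_⟩
  rw [tendsto_iff_norm_sub_tendsto_zero]
  have h1 : Tendsto (fun x : ℝ => C * Real.exp (-η * x)) atTop (𝓝 (C * 0)) := by
    refine Tendsto.const_mul _ (Real.tendsto_exp_atBot.comp ?_)
    exact tendsto_id.const_mul_atTop_of_neg (by linarith)
  rw [mul_zero] at h1
  refine squeeze_zero' (Eventually.of_forall fun _ => norm_nonneg _) ?_ h1
  filter_upwards [eventually_ge_atTop 0] with x hx
  have := hb x hx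
  rwa [abs_of_nonneg hx] at this

theorem IsConjugator.reflect {B : ℝ → Matrix (Fin N) (Fin N) ℂ}
    {A : Matrix (Fin N) (Fin N) ℂ} {P : ℝ → Matrix (Fin N) (Fin N) ℂ}
    (h : IsConjugator (Set.Iic 0) B A P) :
    IsConjugator (Set.Ici 0) (fun x => -B (-x)) (-A) (fun x => P (-x)) := by
  obtain ⟨hd, C, η, hη, hb⟩ := isConjugator_iff.1 h
  refine isConjugator_iff.2 ⟨fun x hx => ?_, C, η, hη, fun x hx => ?_⟩
  · have hx' : -x ∈ Set.Iic (0 : ℝ) := by simpa using hx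
    have := (hd (-x) hx').scomp x (hasDerivAt_neg x).hasDerivWithinAt
      (s := Set.Ici 0) (fun y hy => by simpa using hy)
    convert! this using 1
    simp
    abel
  · have hx' : -x ∈ Set.Iic (0 : ℝ) := by simpa using hx
    simpa using hb (-x) hx'

end MatrixBridge

/-! ### Independence of choices: evaluation of the homoclinic Evans function -/

section EvansValue

theorem corner_conj_exp {𝔸 : Type*} [NormedRing 𝔸] [NormedAlgebra ℂ 𝔸] [CompleteSpace 𝔸]
    {A Q : 𝔸} (T : 𝔸) (hQ : A * Q = Q * A) (s : ℂ) :
    Q * (NormedSpace.exp (s • A) * T * NormedSpace.exp ((-s) • A)) * Q + (1 - Q) =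
      NormedSpace.exp (s • A) * (Q * T * Q + (1 - Q)) * NormedSpace.exp ((-s) • A) := by
  have c1 := mul_exp_smul_comm hQ s
  have c2 := mul_exp_smul_comm hQ (-s)
  have i1 := exp_smul_mul_exp_neg_smul A s
  calc Q * (NormedSpace.exp (s • A) * T * NormedSpace.exp (-s • A)) * Q + (1 - Q)
      = (Q * NormedSpace.exp (s • A)) * T * (NormedSpace.exp (-s • A) * Q)
        + (NormedSpace.exp (s • A) * NormedSpace.exp (-s • A)
        - Q * (NormedSpace.exp (s • A) * NormedSpace.exp (-s • A))) := by
        rw [i1]; noncomm_ring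
    _ = _ := by
      rw [← mul_assoc Q, ← c1, c2]; noncomm_ring

open scoped Matrix.Norms.Operator

variable {N : ℕ} {A Q T : Matrix (Fin N) (Fin N) ℂ}

/-- Conjugation by exp(xA) commutes with taking the Q-corner and does not change its determinant,
while the conjugated corner tends to the identity. -/
theorem det_eq_one_of_tendsto_conj (hQ : A * Q = Q * A) (hQ2 : Q * Q = Q)
    (hT : Tendsto (fun x : ℝ => NormedSpace.exp ((x : ℂ) • A) * T *
      NormedSpace.exp (((-x : ℝ) : ℂ) • A)) atTop (𝓝 1)) :
    (Q * T * Q + (1 - Q)).det = 1 := by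
  have h1 : Tendsto (fun x : ℝ => Q * (NormedSpace.exp ((x : ℂ) • A) * T *
      NormedSpace.exp (((-x : ℝ) : ℂ) • A)) * Q + (1 - Q)) atTop (𝓝 (Q * 1 * Q + (1 - Q))) :=
    ((hT.const_mul Q).mul_const Q).add_const _
  rw [mul_one, hQ2, add_sub_cancel] at h1
  have h2 : Tendsto (fun x : ℝ => (Q * (NormedSpace.exp ((x : ℂ) • A) * T *
      NormedSpace.exp (((-x : ℝ) : ℂ) • A)) * Q + (1 - Q)).det) atTop (𝓝 1) := by
    have := (Continuous.matrix_det continuous_id).tendsto (1 : Matrix (Fin N) (Fin N) ℂ)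
    simp only [id, Matrix.det_one] at this
    exact this.comp h1
  refine tendsto_nhds_unique (tendsto_const_nhds.congr fun x => ?_) h2
  have e : Q * (NormedSpace.exp ((x : ℂ) • A) * T *
      NormedSpace.exp (((-x : ℝ) : ℂ) • A)) * Q + (1 - Q) =
      NormedSpace.exp ((x : ℂ) • A) * (Q * T * Q + (1 - Q)) *
      NormedSpace.exp ((-(x : ℂ)) • A) := by
    push_cast
    exact corner_conj_exp T hQ x
  have i1 : NormedSpace.exp ((x : ℂ) • A) * NormedSpace.exp ((-(x : ℂ)) • A) = 1 :=
    exp_smul_mul_exp_neg_smul A (x : ℂ)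
  have i2 := congrArg Matrix.det i1
  rw [Matrix.det_mul, Matrix.det_one] at i2
  rw [e, Matrix.det_mul, Matrix.det_mul, mul_right_comm, i2, one_mul]

/-- A spectral projection of `A` onto the part of the spectrum in the left half plane, when `A` has
no imaginary spectrum: bounded exponentials and the action on generalized eigenvectors. -/
structure IsHyperbolicProj (A Q : Matrix (Fin N) (Fin N) ℂ) : Prop where
  comm : A * Q = Q * A
  idem : Q * Q = Q
  bound : ∃ K : ℝ, (∀ t : ℝ, 0 ≤ t → ‖NormedSpace.exp ((t : ℂ) • A) * Q‖ ≤ K) ∧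
    ∀ t : ℝ, 0 ≤ t → ‖NormedSpace.exp (((-t : ℝ) : ℂ) • A) * (1 - Q)‖ ≤ K
  re_ne : ∀ μ ∈ spectrum ℂ A, μ.re ≠ 0
  stable : ∀ μ ∈ spectrum ℂ A, μ.re < 0 → ∀ (k : ℕ) (V : Matrix (Fin N) (Fin N) ℂ),
    (A - algebraMap ℂ _ μ) ^ k * V = 0 → Q * V = V
  unstable : ∀ μ ∈ spectrum ℂ A, 0 < μ.re → ∀ (k : ℕ) (V : Matrix (Fin N) (Fin N) ℂ),
    (A - algebraMap ℂ _ μ) ^ k * V = 0 → Q * V = 0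

/-- A vector is encoded as a matrix with equal columns, so that statements about elements of the
matrix algebra apply to it. -/
theorem Matrix.exists_pow_mul_eq_zero {μ : ℂ} {v : Fin N → ℂ}
    (hv : v ∈ Module.End.maxGenEigenspace (Matrix.toLin' A) μ) :
    ∃ k : ℕ, (A - algebraMap ℂ _ μ) ^ k * Matrix.of (fun i (_ : Fin N) => v i) = 0 := by
  obtain ⟨k, hk⟩ := (Module.End.mem_maxGenEigenspace _ _ _).1 hv
  refine ⟨k, ?_⟩
  have e : (Matrix.toLin' A - μ • (1 : Module.End ℂ (Fin N → ℂ))) ^ k =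
      Matrix.toLin' ((A - algebraMap ℂ _ μ) ^ k) := by
    rw [Matrix.toLin'_pow, map_sub]
    congr 2
    rw [Algebra.algebraMap_eq_smul_one, map_smul, Matrix.toLin'_one]; rfl
  rw [e, Matrix.toLin'_apply] at hk
  ext i j
  simpa [Matrix.mul_apply, Matrix.mulVec, dotProduct] using congrFun hk i

theorem Matrix.mulVec_eq_of_mul_of {v w : Fin N → ℂ}
    (h : Q * Matrix.of (fun i (_ : Fin N) => v i) = Matrix.of (fun i (_ : Fin N) => w i)) :
    Q.mulVec v = w := by
  funext i
  have := congrFun (congrFun h i) i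
  simpa [Matrix.mul_apply, Matrix.mulVec, dotProduct] using this

theorem Matrix.maxGenEigenspace_eq_bot {μ : ℂ} (h : μ ∉ spectrum ℂ A) :
    Module.End.maxGenEigenspace (Matrix.toLin' A) μ = ⊥ := by
  by_contra hne
  obtain ⟨v, hv, hv0⟩ := Submodule.exists_mem_ne_zero_of_ne_bot hne
  obtain ⟨k, hk⟩ := exists_pow_mul_eq_zero hv
  have hu : IsUnit (A - algebraMap ℂ _ μ) := by
    have := spectrum.notMem_iff.1 h
    rw [← neg_sub]; exact this.neg
  obtain ⟨u, hu⟩ := hu.pow k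
  rw [← hu, Units.mul_right_eq_zero] at hk
  refine hv0 (funext fun i => ?_)
  simpa using congrFun (congrFun hk i) i

namespace IsHyperbolicProj

variable (h : IsHyperbolicProj A Q)
include h

theorem mulVec_of_mem_stable {v : Fin N → ℂ} (hv : v ∈ stableSubspace A) : Q.mulVec v = v := by
  have : stableSubspace A ≤ LinearMap.ker (Matrix.toLin' (Q - 1)) := by
    refine iSup₂_le fun μ hμ w hw => ?_
    by_cases hs : μ ∈ spectrum ℂ A
    · obtain ⟨k, hk⟩ := Matrix.exists_pow_mul_eq_zero hw
      have := Matrix.mulVec_eq_of_mul_of (h.stable μ hs hμ k _ hk)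
      simp [this]
    · rw [Matrix.maxGenEigenspace_eq_bot hs] at hw
      rw [(Submodule.mem_bot _).1 hw]; exact Submodule.zero_mem _
  simpa [Matrix.sub_mulVec, sub_eq_zero] using this hv

theorem mulVec_of_mem_unstable {v : Fin N → ℂ} (hv : v ∈ unstableSubspace A) :
    Q.mulVec v = 0 := by
  have : unstableSubspace A ≤ LinearMap.ker (Matrix.toLin' Q) := by
    refine iSup₂_le fun μ hμ w hw => ?_
    by_cases hs : μ ∈ spectrum ℂ A
    · obtain ⟨k, hk⟩ := Matrix.exists_pow_mul_eq_zero hw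
      exact Matrix.mulVec_eq_of_mul_of (h.unstable μ hs hμ k _ hk)
    · rw [Matrix.maxGenEigenspace_eq_bot hs] at hw
      rw [(Submodule.mem_bot _).1 hw]; exact Submodule.zero_mem _
  simpa using this hv

theorem sup_eq_top : stableSubspace A ⊔ unstableSubspace A = ⊤ := by
  rw [eq_top_iff, ← Module.End.iSup_maxGenEigenspace_eq_top (Matrix.toLin' A)]
  refine iSup_le fun μ => ?_
  by_cases hs : μ ∈ spectrum ℂ A
  · rcases lt_or_gt_of_ne (h.re_ne μ hs) with hμ | hμ
    · exact le_sup_of_le_left (le_iSup₂_of_le μ hμ le_rfl)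
    · exact le_sup_of_le_right (le_iSup₂_of_le μ hμ le_rfl)
  · rw [Matrix.maxGenEigenspace_eq_bot hs]; exact bot_le

theorem mem_stable_iff {v : Fin N → ℂ} : v ∈ stableSubspace A ↔ Q.mulVec v = v := by
  refine ⟨h.mulVec_of_mem_stable, fun hv => ?_⟩
  have : v ∈ stableSubspace A ⊔ unstableSubspace A := h.sup_eq_top ▸ Submodule.mem_top
  obtain ⟨s, hs, u, hu, rfl⟩ := Submodule.mem_sup.1 this
  rw [Matrix.mulVec_add, h.mulVec_of_mem_stable hs, h.mulVec_of_mem_unstable hu, add_zero] at hv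
  rwa [← hv]

theorem mem_unstable_iff {v : Fin N → ℂ} : v ∈ unstableSubspace A ↔ Q.mulVec v = 0 := by
  refine ⟨h.mulVec_of_mem_unstable, fun hv => ?_⟩
  have : v ∈ stableSubspace A ⊔ unstableSubspace A := h.sup_eq_top ▸ Submodule.mem_top
  obtain ⟨s, hs, u, hu, rfl⟩ := Submodule.mem_sup.1 this
  rw [Matrix.mulVec_add, h.mulVec_of_mem_stable hs, h.mulVec_of_mem_unstable hu, add_zero] at hv
  simpa [hv] using hu

/-- Adapted bases exist. -/
theorem exists_basis : ∃ (R : Matrix (Fin N) (Fin N) ℂ) (S : Finset (Fin N)), R.det ≠ 0 ∧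
    Submodule.span ℂ {v | ∃ j ∈ S, v = R.col j} = stableSubspace A ∧
    Submodule.span ℂ {v | ∃ j ∉ S, v = R.col j} = unstableSubspace A := by
  classical
  have hc : IsCompl (stableSubspace A) (unstableSubspace A) := by
    refine ⟨disjoint_iff_inf_le.2 fun v hv => ?_, codisjoint_iff.2 h.sup_eq_top⟩
    have h1 := h.mem_stable_iff.1 hv.1
    rw [h.mem_unstable_iff.1 hv.2] at h1
    exact (Submodule.mem_bot ℂ).2 h1.symm
  let b₀ := ((Module.finBasis ℂ (stableSubspace A)).prod
    (Module.finBasis ℂ (unstableSubspace A))).map (Submodule.prodEquivOfIsCompl _ _ hc)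
  have hcard : Fintype.card (Fin (Module.finrank ℂ (stableSubspace A)) ⊕
      Fin (Module.finrank ℂ (unstableSubspace A))) = Fintype.card (Fin N) := by
    rw [← Module.finrank_eq_card_basis b₀, Module.finrank_fintype_fun_eq_card]
  let e := Fintype.equivOfCardEq hcard
  let b := b₀.reindex e
  have hl : ∀ i, b (e (Sum.inl i)) ∈ stableSubspace A := fun i => by
    simp [b, b₀]
  have hr : ∀ i, b (e (Sum.inr i)) ∈ unstableSubspace A := fun i => by
    simp [b, b₀]
  refine ⟨Matrix.of fun i j => b j i, Finset.univ.filter fun j => (e.symm j).isLeft, ?_, ?_, ?_⟩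
  · have h1 := (Pi.basisFun ℂ (Fin N)).invertibleToMatrix b
    have h2 : (Pi.basisFun ℂ (Fin N)).toMatrix b = Matrix.of fun i j => b j i := by
      ext i j; simp [Module.Basis.toMatrix_apply]
    rw [← h2]
    exact (Matrix.isUnit_det_of_invertible _).ne_zero
  · refine le_antisymm (Submodule.span_le.2 ?_) fun v hv => ?_
    · rintro v ⟨j, hj, rfl⟩
      simp only [Finset.mem_filter, Finset.mem_univ, true_and] at hj
      obtain ⟨i, hi⟩ := Sum.isLeft_iff.1 hj
      have := hl i
      rw [← hi, Equiv.apply_symm_apply] at this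
      exact this
    · have h1 := (Module.finBasis ℂ (stableSubspace A)).sum_repr ⟨v, hv⟩
      have h2 : _ = v := congrArg Subtype.val h1
      rw [← h2]
      simp only [AddSubmonoidClass.coe_finsetSum, Submodule.coe_smul]
      refine Submodule.sum_mem _ fun i _ => Submodule.smul_mem _ _ (Submodule.subset_span ?_)
      refine ⟨e (Sum.inl i), by simp, ?_⟩
      funext x
      simp [b, b₀, Matrix.col_apply]
  · refine le_antisymm (Submodule.span_le.2 ?_) fun v hv => ?_
    · rintro v ⟨j, hj, rfl⟩
      simp only [Finset.mem_filter, Finset.mem_univ, true_and, Bool.not_eq_true,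
        Sum.isLeft_eq_false] at hj
      obtain ⟨i, hi⟩ := Sum.isRight_iff.1 hj
      have := hr i
      rw [← hi, Equiv.apply_symm_apply] at this
      exact this
    · have h1 := (Module.finBasis ℂ (unstableSubspace A)).sum_repr ⟨v, hv⟩
      have h2 : _ = v := congrArg Subtype.val h1
      rw [← h2]
      simp only [AddSubmonoidClass.coe_finsetSum, Submodule.coe_smul]
      refine Submodule.sum_mem _ fun i _ => Submodule.smul_mem _ _ (Submodule.subset_span ?_)
      refine ⟨e (Sum.inr i), by simp, ?_⟩
      funext x
      simp [b, b₀, Matrix.col_apply]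

/-- Q fixes the columns of R with index in S and annihilates the others, so the mixed matrix is (P₊
Q + P₋ (1 - Q)) R and the basis cancels from the quotient. -/
theorem det_div_det_eq {R Pp Pm : Matrix (Fin N) (Fin N) ℂ} {S : Finset (Fin N)} (hR : R.det ≠ 0)
    (hs : Submodule.span ℂ {v | ∃ j ∈ S, v = R.col j} = stableSubspace A)
    (hu : Submodule.span ℂ {v | ∃ j ∉ S, v = R.col j} = unstableSubspace A) :
    (Matrix.of fun i j => if j ∈ S then (Pp * R) i j else (Pm * R) i j).det / R.det =
      (Pp * Q + Pm * (1 - Q)).det := by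
  have key : ∀ j, Q.mulVec (R.col j) = if j ∈ S then R.col j else 0 := fun j => by
    split_ifs with hj
    · exact h.mem_stable_iff.1 (hs ▸ Submodule.subset_span ⟨j, hj, rfl⟩)
    · exact h.mem_unstable_iff.1 (hu ▸ Submodule.subset_span ⟨j, hj, rfl⟩)
  have hcol : ∀ (P : Matrix (Fin N) (Fin N) ℂ) i j, (P * R) i j = P.mulVec (R.col j) i :=
    fun P i j => rfl
  have e : (Matrix.of fun i j => if j ∈ S then (Pp * R) i j else (Pm * R) i j) =
      (Pp * Q + Pm * (1 - Q)) * R := by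
    ext i j
    rw [hcol, Matrix.add_mulVec, ← Matrix.mulVec_mulVec, ← Matrix.mulVec_mulVec, key,
      Matrix.sub_mulVec, key, Matrix.one_mulVec, Matrix.of_apply, hcol, hcol]
    split_ifs <;> simp
  rw [e, Matrix.det_mul, mul_div_cancel_right₀ _ hR]

/-- Other conjugators have values P₊ T and P₋ T' at 0, where T preserves the stable and T' the
unstable subspace. The new matrix is therefore the old one times two diagonal corners, and
asymptotic triviality gives each of these determinant 1. -/
theorem det_eq_of_conjugators {B : ℝ → Matrix (Fin N) (Fin N) ℂ} (hB : Continuous B) {K : ℝ}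
    (hK : ∀ x, ‖B x‖ ≤ K) {Pp Pm Rp Rm : ℝ → Matrix (Fin N) (Fin N) ℂ}
    (hPp : IsConjugator (Set.Ici 0) B A Pp) (hPm : IsConjugator (Set.Iic 0) B A Pm)
    (hRp : IsConjugator (Set.Ici 0) B A Rp) (hRm : IsConjugator (Set.Iic 0) B A Rm) :
    (Rp 0 * Q + Rm 0 * (1 - Q)).det = (Pp 0 * Q + Pm 0 * (1 - Q)).det := by
  obtain ⟨T, hT, hTl⟩ := hPp.isRightConjugator.exists_eq_mul hRp.isRightConjugator hB hK
  obtain ⟨T', hT', hTl'⟩ := hPm.reflect.isRightConjugator.exists_eq_mul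
    hRm.reflect.isRightConjugator (hB.comp continuous_neg).neg
    (fun x => by simpa using hK (-x))
  simp only [neg_zero] at hT'
  obtain ⟨C, hC1, hC2⟩ := h.bound
  have hz : (1 - Q) * T * Q = 0 := eq_zero_of_tendsto_conj h.comm h.idem hC1 hC2 hTl
  have hcomm' : -A * (1 - Q) = (1 - Q) * -A := by
    rw [neg_mul, mul_neg, mul_sub, sub_mul, h.comm, mul_one, one_mul]
  have hidem' : (1 - Q) * (1 - Q) = 1 - Q := by
    have := h.idem
    simp [mul_sub, sub_mul, this]
  have hz' : (1 - (1 - Q)) * T' * (1 - Q) = 0 :=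
    eq_zero_of_tendsto_conj hcomm' hidem' (K := C)
      (fun t ht => by rw [smul_neg, ← neg_smul, ← Complex.ofReal_neg]; exact hC2 t ht)
      (fun t ht => by
        rw [smul_neg, ← neg_smul, ← Complex.ofReal_neg, neg_neg,
          sub_sub_cancel]; exact hC1 t ht) hTl'
  rw [sub_sub_cancel] at hz'
  have h1 := det_eq_one_of_tendsto_conj h.comm h.idem hTl
  have h2 := det_eq_one_of_tendsto_conj hcomm' hidem' hTl'
  rw [sub_sub_cancel] at h2
  have hid := h.idem
  have z1 : T * Q = Q * T * Q := by
    rw [← sub_eq_zero, ← hz]; noncomm_ring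
  have z2 : T' * (1 - Q) = (1 - Q) * T' * (1 - Q) := by
    rw [← sub_eq_zero, ← hz']; noncomm_ring
  have p1 : Q * (1 - Q) = 0 := by simp [mul_sub, hid]
  have p2 : (1 - Q) * Q = 0 := by simp [sub_mul, hid]
  have e : Rp 0 * Q + Rm 0 * (1 - Q) = (Pp 0 * Q + Pm 0 * (1 - Q)) *
      ((Q * T * Q + (1 - Q)) * ((1 - Q) * T' * (1 - Q) + Q)) := by
    have e1 : (Q * T * Q + (1 - Q)) * ((1 - Q) * T' * (1 - Q) + Q) =
        Q * T * Q + (1 - Q) * T' * (1 - Q) := by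
      calc _ = Q * T * (Q * (1 - Q)) * T' * (1 - Q) + Q * T * (Q * Q)
          + ((1 - Q) * (1 - Q)) * T' * (1 - Q) + (1 - Q) * Q := by noncomm_ring
        _ = _ := by rw [p1, p2, hid, hidem']; noncomm_ring
    have e2 : (Pp 0 * Q + Pm 0 * (1 - Q)) * (Q * T * Q + (1 - Q) * T' * (1 - Q)) =
        Pp 0 * (Q * T * Q) + Pm 0 * ((1 - Q) * T' * (1 - Q)) := by
      calc _ = Pp 0 * ((Q * Q) * T * Q) + Pp 0 * (Q * (1 - Q)) * T' * (1 - Q)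
            + Pm 0 * ((1 - Q) * Q) * T * Q + Pm 0 * (((1 - Q) * (1 - Q)) * T' * (1 - Q)) := by
            noncomm_ring
        _ = _ := by rw [p1, p2, hid, hidem']; noncomm_ring
    rw [e1, e2, hT, hT', mul_assoc, mul_assoc, z1, z2]
  rw [e, Matrix.det_mul, Matrix.det_mul, h1, h2, mul_one, mul_one]

/-- The homoclinic Evans function is computed by any pair of conjugators and the spectral
projections. -/
theorem homoclinicEvans_eq {B : ℝ → Matrix (Fin N) (Fin N) ℂ} (hB : Continuous B) {K : ℝ}
    (hK : ∀ x, ‖B x‖ ≤ K) {Pp Pm : ℝ → Matrix (Fin N) (Fin N) ℂ}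
    (hPp : IsConjugator (Set.Ici 0) B A Pp) (hPm : IsConjugator (Set.Iic 0) B A Pm) :
    homoclinicEvans B A = (Pp 0 * Q + Pm 0 * (1 - Q)).det := by
  obtain ⟨R, S, hR, hs, hu⟩ := h.exists_basis
  have hex : ∃ d, IsHomoclinicEvansValue B A d := ⟨_, Pp, Pm, R, S, hPp, hPm, hR, hs, hu, rfl⟩
  obtain ⟨Rp, Rm, R', S', hRp, hRm, hR', hs', hu', he⟩ := Classical.epsilon_spec hex
  rw [homoclinicEvans, he, h.det_div_det_eq hR' hs' hu']
  exact h.det_eq_of_conjugators hB hK hPp hPm hRp hRm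

end IsHyperbolicProj

end EvansValue

/-! ### Local uniformity of spectral projections and exponential bounds -/

section UniformSplitting

variable {𝔸 : Type*} [NormedRing 𝔸] [NormedAlgebra ℂ 𝔸] [CompleteSpace 𝔸]

theorem exp_ofReal_smul_mul_eigen {A P : 𝔸} {τ : ℂ} (h : A * P = τ • P) (t : ℝ) :
    NormedSpace.exp ((t : ℂ) • A) * P = Complex.exp (t * τ) • P := by
  have h1 : ∀ x : ℝ, HasDerivAt (fun x : ℝ => NormedSpace.exp ((x : ℂ) • A) * P)
      (A * (NormedSpace.exp ((x : ℂ) • A) * P)) x := fun x => by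
    simpa [mul_assoc] using (hasDerivAt_exp_ofReal_smul_const A x).mul_const P
  have h2 : ∀ x : ℝ, HasDerivAt (fun x : ℝ => Complex.exp (x * τ) • P)
      (A * (Complex.exp (x * τ) • P)) x := fun x => by
    have e : HasDerivAt (fun x : ℝ => Complex.exp (x * τ)) (Complex.exp (x * τ) * (1 * τ)) x :=
      (Complex.ofRealCLM.hasDerivAt (x := x)).mul_const τ |>.cexp
    convert! e.smul_const P using 1
    rw [mul_smul_comm, h, smul_smul, one_mul]
  exact congrFun (linearODE_eq (B := fun _ => A) (K := ‖A‖) (fun _ => le_rfl) h1 h2 (x₀ := 0)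
    (by simp)) t

/-- The spectral projections are Lipschitz and the associated exponential bounds are uniform,
locally. -/
theorem IsSplit.exists_uniform [FiniteDimensional ℂ 𝔸] {α ρ : ℝ} {a : 𝔸} (h : IsSplit α ρ a) :
    ∃ K : ℝ, 0 ≤ K ∧ ∀ᶠ b in 𝓝 a, IsSplit α ρ b ∧
      ‖stableProj α ρ b - stableProj α ρ a‖ ≤ K * ‖b - a‖ ∧
      ‖unstableProj α ρ b - unstableProj α ρ a‖ ≤ K * ‖b - a‖ ∧
      (∀ t : ℝ, 0 ≤ t → ‖NormedSpace.exp ((t : ℂ) • b) * stableProj α ρ b‖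
        ≤ K * Real.exp (-α * t)) ∧
      ∀ t : ℝ, 0 ≤ t → ‖NormedSpace.exp ((-t : ℂ) • b) * unstableProj α ρ b‖
        ≤ K * Real.exp (-α * t) := by
  obtain ⟨K₁, hK₁, h1⟩ := eventually_norm_resolvent_le (isCompact_sphere _ _) h.sphere_neg_subset
  obtain ⟨K₂, hK₂, h2⟩ := eventually_norm_resolvent_le (isCompact_sphere _ _) h.sphere_pos_subset
  have hr := h.radius_nonneg
  set r := ρ - α
  set K := max K₁ K₂
  have hK0 : 0 ≤ K := hK₁.trans (le_max_left _ _)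
  have h1a := h1.self_of_nhds
  have h2a := h2.self_of_nhds
  refine ⟨r * K ^ 2 + r * K, by positivity, ?_⟩
  filter_upwards [h.eventually, h1, h2] with b hb h1 h2
  refine ⟨hb, ?_, ?_, fun t ht => ?_, fun t ht => ?_⟩
  · refine (norm_contourProj_sub_le hr hb.sphere_neg_subset h.sphere_neg_subset
      (K := K) (fun z hz => (h1 z hz).trans (le_max_left _ _))
      (fun z hz => (h1a z hz).trans (le_max_left _ _))).trans ?_
    have : 0 ≤ r * K * ‖b - a‖ := by positivity
    nlinarith
  · refine (norm_contourProj_sub_le hr hb.sphere_pos_subset h.sphere_pos_subset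
      (K := K) (fun z hz => (h2 z hz).trans (le_max_right _ _))
      (fun z hz => (h2a z hz).trans (le_max_right _ _))).trans ?_
    have : 0 ≤ r * K * ‖b - a‖ := by positivity
    nlinarith
  · refine (hb.norm_exp_mul_stableProj_le (K := K)
      (fun z hz => (h1 z hz).trans (le_max_left _ _)) ht).trans ?_
    gcongr
    have : 0 ≤ r * K ^ 2 := by positivity
    linarith
  · refine (hb.norm_exp_neg_mul_unstableProj_le (K := K)
      (fun z hz => (h2 z hz).trans (le_max_right _ _)) ht).trans ?_
    gcongr
    have : 0 ≤ r * K ^ 2 := by positivity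
    linarith

namespace IsSplit

variable {α ρ : ℝ} {a : 𝔸} [FiniteDimensional ℂ 𝔸]

theorem center_mul_stable (h : IsSplit α ρ a) : centerProj α ρ a * stableProj α ρ a = 0 := by
  simp [centerProj, sub_mul, h.stable_mul_stable, h.unstable_mul_stable]

theorem stable_mul_center (h : IsSplit α ρ a) : stableProj α ρ a * centerProj α ρ a = 0 := by
  simp [centerProj, mul_sub, h.stable_mul_stable, h.stable_mul_unstable]

theorem center_mul_unstable (h : IsSplit α ρ a) : centerProj α ρ a * unstableProj α ρ a = 0 := by
  simp [centerProj, sub_mul, h.unstable_mul_unstable, h.stable_mul_unstable]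

theorem unstable_mul_center (h : IsSplit α ρ a) : unstableProj α ρ a * centerProj α ρ a = 0 := by
  simp [centerProj, mul_sub, h.unstable_mul_unstable, h.unstable_mul_stable]

theorem center_mul_center (h : IsSplit α ρ a) :
    centerProj α ρ a * centerProj α ρ a = centerProj α ρ a := by
  nth_rw 1 [centerProj]
  rw [sub_mul, sub_mul, h.stable_mul_center, h.unstable_mul_center]; simp

end IsSplit

end UniformSplitting

/-! ### A single simple eigenvalue in the strip, and its stability -/

section SimpleCenter

open scoped Matrix.Norms.Operator
open Matrix

variable {N : ℕ} {α ρ : ℝ} {A A₀ : Matrix (Fin N) (Fin N) ℂ}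

/-- The spectrum of `A` in the strip `|re| < α` is a single algebraically simple eigenvalue. -/
structure IsSimpleCenter (α ρ : ℝ) (A : Matrix (Fin N) (Fin N) ℂ) : Prop extends IsSplit α ρ A where
  rank_one : ∃ u v : Fin N → ℂ, centerProj α ρ A = vecMulVec u v ∧ v ⬝ᵥ u = 1

/-- The eigenvalue in the strip. -/
noncomputable def stripEigenvalue (α ρ : ℝ) (A : Matrix (Fin N) (Fin N) ℂ) : ℂ :=
  (A * centerProj α ρ A).trace

namespace IsSimpleCenter

theorem trace_center (h : IsSimpleCenter α ρ A) : (centerProj α ρ A).trace = 1 := by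
  obtain ⟨u, v, he, huv⟩ := h.rank_one
  rw [he, trace_vecMulVec, dotProduct_comm, huv]

theorem center_ne_zero (h : IsSimpleCenter α ρ A) : centerProj α ρ A ≠ 0 := fun h0 => by
  have := h.trace_center
  simp [h0] at this

/-- The center projection is idempotent, commutes with A and has rank one, so A compresses to a
scalar on its range; the trace identifies the scalar. -/
theorem mul_center (h : IsSimpleCenter α ρ A) :
    A * centerProj α ρ A = stripEigenvalue α ρ A • centerProj α ρ A := by
  obtain ⟨u, v, he, huv⟩ := h.rank_one
  have h1 : A * centerProj α ρ A = centerProj α ρ A * (A * centerProj α ρ A) := by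
    have hc : A * centerProj α ρ A = centerProj α ρ A * A := h.toIsSplit.centerProj_comm
    have hi : centerProj α ρ A * centerProj α ρ A = centerProj α ρ A :=
      h.toIsSplit.center_mul_center
    rw [hc, ← mul_assoc, hi]
  have h2 : A * centerProj α ρ A = (v ⬝ᵥ (A *ᵥ u)) • centerProj α ρ A := by
    rw [h1, he, mul_vecMulVec, mul_vecMulVec, vecMulVec_mulVec, ← smul_vecMulVec]
    simp
  have h3 : stripEigenvalue α ρ A = v ⬝ᵥ (A *ᵥ u) := by
    rw [stripEigenvalue, h2, trace_smul, h.trace_center, smul_eq_mul, mul_one]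
  rw [h2, h3]

theorem pow_one_mul_center (h : IsSimpleCenter α ρ A) :
    (A - algebraMap ℂ _ (stripEigenvalue α ρ A)) ^ 1 * centerProj α ρ A = 0 := by
  rw [pow_one, sub_mul, h.mul_center, Algebra.algebraMap_eq_smul_one, smul_mul_assoc, one_mul,
    sub_self]

theorem stripEigenvalue_mem (h : IsSimpleCenter α ρ A) : stripEigenvalue α ρ A ∈ spectrum ℂ A := by
  by_contra hc
  have hu : IsUnit (A - algebraMap ℂ _ (stripEigenvalue α ρ A)) := by
    rw [← neg_sub]; exact (spectrum.notMem_iff.1 hc).neg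
  obtain ⟨w, hw⟩ := hu
  have := h.pow_one_mul_center
  rw [pow_one, ← hw, Units.mul_right_eq_zero] at this
  exact h.center_ne_zero this

theorem eq_stripEigenvalue (h : IsSimpleCenter α ρ A) {σ : ℂ} (hσ : σ ∈ spectrum ℂ A)
    (hre : |σ.re| < α) : σ = stripEigenvalue α ρ A := by
  by_contra hne
  have hev : Module.End.HasEigenvalue (Matrix.toLin' A) σ := by
    rw [Module.End.hasEigenvalue_iff_mem_spectrum, Matrix.spectrum_toLin']; exact hσ
  obtain ⟨v, hv⟩ := hev.exists_hasEigenvector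
  have hmem : v ∈ Module.End.maxGenEigenspace (Matrix.toLin' A) σ :=
    Module.End.mem_maxGenEigenspace _ _ _ |>.2 ⟨1, by
      have := hv.apply_eq_smul
      simp [LinearMap.sub_apply, this]⟩
  have hAv : A *ᵥ v = σ • v := by rw [← Matrix.toLin'_apply]; exact hv.apply_eq_smul
  obtain ⟨k, hk⟩ := Matrix.exists_pow_mul_eq_zero hmem
  have h1 : centerProj α ρ A *ᵥ v = v :=
    Matrix.mulVec_eq_of_mul_of (h.toIsSplit.centerProj_mul_of_abs_lt hre hk)
  have h2 : A *ᵥ v = stripEigenvalue α ρ A • v := by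
    conv_lhs => rw [← h1]
    rw [mulVec_mulVec, h.mul_center, smul_mulVec, h1]
  rw [hAv, ← sub_eq_zero, ← sub_smul, smul_eq_zero] at h2
  rcases h2 with h2 | h2
  · exact hne (sub_eq_zero.1 h2)
  · exact hv.2 h2

end IsSimpleCenter

/-- Algebraic multiplicity is the dimension of the generalized eigenspace. Eigenvalues outside the
strip do not contribute to the range of the center projection, which thus lies in one line, and the
projection fixes a generator of that line. -/
theorem isSimpleCenter_of_rootMultiplicity (h : IsSplit α ρ A) {σ : ℂ} (hre : |σ.re| < α)
    (huniq : ∀ μ ∈ spectrum ℂ A, |μ.re| < α → μ = σ) (hmult : A.charpoly.rootMultiplicity σ = 1) :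
    IsSimpleCenter α ρ A := by
  have hfin : Module.finrank ℂ (Module.End.maxGenEigenspace (Matrix.toLin' A) σ) = 1 := by
    rw [LinearMap.finrank_maxGenEigenspace_eq, Matrix.charpoly_toLin', hmult]
  obtain ⟨⟨u, hu⟩, hu0, hspan⟩ := finrank_eq_one_iff'.1 hfin
  have hu0' : u ≠ 0 := fun h0 => hu0 (Subtype.ext h0)
  have key : ∀ (μ : ℂ) (w : Fin N → ℂ), w ∈ Module.End.maxGenEigenspace (Matrix.toLin' A) μ →
      centerProj α ρ A *ᵥ w ∈ Module.End.maxGenEigenspace (Matrix.toLin' A) σ := by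
    intro μ w hw
    by_cases hs : μ ∈ spectrum ℂ A
    · obtain ⟨k, hk⟩ := Matrix.exists_pow_mul_eq_zero hw
      rcases h.spec μ hs with h1 | h1 | h1
      · have e : centerProj α ρ A * Matrix.of (fun i (_ : Fin N) => w i) =
            Matrix.of (fun i (_ : Fin N) => (0 : Fin N → ℂ) i) := by
          rw [centerProj, sub_mul, sub_mul, h.stableProj_mul_of_mem h1 hk,
            h.unstableProj_mul_of_lt (by linarith [re_lt_of_mem_ball_neg h1, h.pos]) hk]
          ext; simp
        rw [Matrix.mulVec_eq_of_mul_of e]; exact Submodule.zero_mem _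
      · have e : centerProj α ρ A * Matrix.of (fun i (_ : Fin N) => w i) =
            Matrix.of (fun i (_ : Fin N) => (0 : Fin N → ℂ) i) := by
          rw [centerProj, sub_mul, sub_mul,
            h.stableProj_mul_of_lt (by linarith [lt_re_of_mem_ball h1, h.pos]) hk,
            h.unstableProj_mul_of_mem h1 hk]
          ext; simp
        rw [Matrix.mulVec_eq_of_mul_of e]; exact Submodule.zero_mem _
      · rw [Matrix.mulVec_eq_of_mul_of (h.centerProj_mul_of_abs_lt h1 hk), ← huniq μ hs h1]
        exact hw
    · rw [Matrix.maxGenEigenspace_eq_bot hs] at hw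
      rw [(Submodule.mem_bot _).1 hw]; simp
  have hall : ∀ w : Fin N → ℂ, centerProj α ρ A *ᵥ w ∈
      Module.End.maxGenEigenspace (Matrix.toLin' A) σ := by
    have : (⊤ : Submodule ℂ (Fin N → ℂ)) ≤
        (Module.End.maxGenEigenspace (Matrix.toLin' A) σ).comap
          (Matrix.toLin' (centerProj α ρ A)) := by
      rw [← Module.End.iSup_maxGenEigenspace_eq_top (Matrix.toLin' A)]
      exact iSup_le fun μ w hw => by simpa using key μ w hw
    intro w
    simpa using this (Submodule.mem_top (x := w))
  have hc : ∀ j, ∃ c : ℂ, c • u = (centerProj α ρ A).col j := fun j => by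
    obtain ⟨c, hc⟩ := hspan ⟨_, hall (Pi.single j 1)⟩
    exact ⟨c, by simpa using congrArg Subtype.val hc⟩
  choose v hv using hc
  have he : centerProj α ρ A = vecMulVec u v := by
    ext i j
    have := congrFun (hv j) i
    simp only [Pi.smul_apply, smul_eq_mul, col_apply] at this
    rw [← this, vecMulVec_apply, mul_comm]
  have hPu : centerProj α ρ A *ᵥ u = u := by
    obtain ⟨k, hk⟩ := Matrix.exists_pow_mul_eq_zero hu
    exact Matrix.mulVec_eq_of_mul_of (h.centerProj_mul_of_abs_lt hre hk)
  refine ⟨h, u, v, he, ?_⟩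
  rw [he, vecMulVec_mulVec] at hPu
  have h3 : (v ⬝ᵥ u - 1) • u = 0 := by
    rw [sub_smul, one_smul, sub_eq_zero]; simpa using hPu
  exact sub_eq_zero.1 ((smul_eq_zero.1 h3).resolve_right hu0')

/-- Idempotents at distance less than one have equal rank: a nonzero vector in the range of one and
the kernel of the other would be mapped to plus or minus itself by the difference. Hence pairing
with v is injective on the range of P, and P ≠ 0. -/
theorem Matrix.exists_vecMulVec_of_norm_sub_lt_one {P : Matrix (Fin N) (Fin N) ℂ} {u v : Fin N → ℂ}
    (huv : v ⬝ᵥ u = 1) (hP : P * P = P) (hlt : ‖P - vecMulVec u v‖ < 1) :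
    ∃ u' v' : Fin N → ℂ, P = vecMulVec u' v' ∧ v' ⬝ᵥ u' = 1 := by
  have hu0 : u ≠ 0 := fun h0 => by simp [h0] at huv
  have small : ∀ (w : Fin N → ℂ), (P - vecMulVec u v) *ᵥ w = w ∨
      (P - vecMulVec u v) *ᵥ w = -w → w = 0 := fun w hw => by
    have h1 := Matrix.linfty_opNorm_mulVec (P - vecMulVec u v) w
    have h2 : ‖(P - vecMulVec u v) *ᵥ w‖ = ‖w‖ := by
      rcases hw with hw | hw <;> simp [hw]
    rw [h2] at h1
    by_contra hne
    have := norm_pos_iff.2 hne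
    nlinarith
  have hQ : ∀ w, vecMulVec u v *ᵥ w = (v ⬝ᵥ w) • u := fun w => by
    rw [vecMulVec_mulVec]; simp
  have inj : ∀ w, P *ᵥ w = w → v ⬝ᵥ w = 0 → w = 0 := fun w h1 h2 =>
    small w (Or.inl (by rw [sub_mulVec, h1, hQ, h2]; simp))
  have hcol : ∀ j, P *ᵥ P.col j = P.col j := fun j => by
    rw [← mulVec_single_one, mulVec_mulVec, hP]
  have hne : ∃ j, P.col j ≠ 0 := by
    by_contra! hall
    have hP0 : P = 0 := by
      ext i j; exact congrFun (hall j) i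
    refine hu0 (small u (Or.inr ?_))
    rw [sub_mulVec, hQ, huv, hP0]; simp
  obtain ⟨j, hj⟩ := hne
  have hvj : v ⬝ᵥ P.col j ≠ 0 := fun h0 => hj (inj _ (hcol j) h0)
  refine ⟨P.col j, fun k => (v ⬝ᵥ P.col k) / (v ⬝ᵥ P.col j), ?_, ?_⟩
  · ext i k
    have h0 := inj ((v ⬝ᵥ P.col j) • P.col k - (v ⬝ᵥ P.col k) • P.col j)
      (by rw [mulVec_sub, mulVec_smul, mulVec_smul, hcol, hcol])
      (by rw [dotProduct_sub, dotProduct_smul, dotProduct_smul, smul_eq_mul, smul_eq_mul]; ring)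
    have h1 := congrFun h0 i
    simp only [Pi.sub_apply, Pi.smul_apply, smul_eq_mul, Pi.zero_apply, col_apply] at h1
    rw [vecMulVec_apply, col_apply, mul_div_assoc', eq_div_iff hvj]
    linear_combination h1
  · have e : (fun k => (v ⬝ᵥ P.col k) / (v ⬝ᵥ P.col j)) ⬝ᵥ P.col j =
        (v ⬝ᵥ (P *ᵥ P.col j)) / (v ⬝ᵥ P.col j) := by
      have : (fun k => v ⬝ᵥ P.col k) = v ᵥ* P := rfl
      rw [dotProduct_mulVec, ← this]
      change ∑ k, (v ⬝ᵥ P.col k) / (v ⬝ᵥ P.col j) * P.col j k =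
        (∑ k, (v ⬝ᵥ P.col k) * P.col j k) / (v ⬝ᵥ P.col j)
      rw [Finset.sum_div]
      exact Finset.sum_congr rfl fun k _ => by ring
    rw [e, hcol, div_self hvj]

/-- The center projection varies continuously, so nearby ones are at distance less than one and keep
rank one. -/
theorem IsSimpleCenter.eventually (h : IsSimpleCenter α ρ A₀) :
    ∀ᶠ A in 𝓝 A₀, IsSimpleCenter α ρ A := by
  obtain ⟨K, hK, hev⟩ := h.toIsSplit.exists_uniform
  obtain ⟨u, v, he, huv⟩ := h.rank_one
  have h1 : ∀ᶠ A in 𝓝 A₀, (K + K) * ‖A - A₀‖ < 1 := by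
    have : Tendsto (fun A => (K + K) * ‖A - A₀‖) (𝓝 A₀) (𝓝 0) := by
      have h2 : Continuous fun A => (K + K) * ‖A - A₀‖ := by fun_prop
      simpa using h2.tendsto A₀
    exact this.eventually (gt_mem_nhds one_pos)
  filter_upwards [hev, h1] with A hA hA1
  refine ⟨hA.1, Matrix.exists_vecMulVec_of_norm_sub_lt_one huv hA.1.center_mul_center ?_⟩
  rw [← he]
  refine lt_of_le_of_lt ?_ hA1
  have : centerProj α ρ A - centerProj α ρ A₀ = -(stableProj α ρ A - stableProj α ρ A₀) -
      (unstableProj α ρ A - unstableProj α ρ A₀) := by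
    simp only [centerProj]; abel
  rw [this, add_mul]
  refine (norm_sub_le _ _).trans ?_
  rw [norm_neg]
  exact add_le_add hA.2.1 hA.2.2.1

end SimpleCenter

/-! ### Consequences of the standing assumptions on the coefficients -/

section CoefficientFamilies

open scoped Matrix.Norms.Operator
open Metric

variable {N : ℕ} {M ε₀ : ℝ} {X : ℝ → ℝ} {A : ℝ → ℝ → ℂ → Matrix (Fin N) (Fin N) ℂ}
  {Ainf : ℂ → Matrix (Fin N) (Fin N) ℂ}

theorem Matrix.differentiableOn_of_entries {f : ℂ → Matrix (Fin N) (Fin N) ℂ} {s : Set ℂ}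
    (h : ∀ i j, DifferentiableOn ℂ (fun l => f l i j) s) : DifferentiableOn ℂ f s :=
  differentiableOn_pi.2 fun i => differentiableOn_pi.2 fun j => h i j

theorem Matrix.continuous_of_entries {f : ℝ → Matrix (Fin N) (Fin N) ℂ}
    (h : ∀ i j, Continuous fun x => f x i j) : Continuous f :=
  continuous_pi fun i => continuous_pi fun j => h i j

theorem Matrix.differentiableAt_det {f : ℂ → Matrix (Fin N) (Fin N) ℂ} {l : ℂ}
    (h : DifferentiableAt ℂ f l) : DifferentiableAt ℂ (fun l => (f l).det) l := by
  have he : ∀ i j, DifferentiableAt ℂ (fun l => f l i j) l := fun i j =>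
    differentiableAt_pi.1 (differentiableAt_pi.1 h i) j
  simp only [Matrix.det_apply]
  refine DifferentiableAt.fun_sum fun σ _ => DifferentiableAt.const_smul ?_ _
  exact DifferentiableAt.fun_finsetProd fun i _ => he _ _

namespace HomoclinicLimit

variable (hA : HomoclinicLimit M ε₀ X A Ainf)
include hA

theorem continuous {ε : ℝ} (hε : ε ∈ Set.Ico 0 ε₀) {l : ℂ} (hl : ‖l‖ ≤ M) :
    Continuous fun x => A ε x l :=
  Matrix.continuous_of_entries fun i j => (hA.smooth ε hε l hl i j).continuous

theorem zero_mem : (0 : ℝ) ∈ Set.Ico 0 ε₀ := ⟨le_rfl, hA.eps_pos⟩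

theorem exists_norm_sub_le : ∃ C ν : ℝ, 0 ≤ C ∧ 0 < ν ∧ ∀ l : ℂ, ‖l‖ ≤ M → ∀ x : ℝ,
    ‖A 0 x l - Ainf l‖ ≤ C * Real.exp (-ν * |x|) := by
  obtain ⟨C, ν, hν, h⟩ := hA.decay
  refine ⟨N * |C|, ν, by positivity, hν, fun l hl x => ?_⟩
  rw [mul_assoc]
  refine Matrix.opNorm_le_of_entries (by positivity) fun i j => (h l hl x i j).trans ?_
  gcongr
  exact le_abs_self C

theorem exists_norm_sub_zero_le : ∃ C θ : ℝ, 0 ≤ C ∧ 0 < θ ∧ ∀ ε ∈ Set.Ioo 0 ε₀, ∀ l : ℂ, ‖l‖ ≤ M →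
    ∀ x : ℝ, |x| ≤ X ε / 2 → ‖A ε x l - A 0 x l‖ ≤ C * Real.exp (-θ * (X ε / 2)) := by
  obtain ⟨C, θ, hθ, h⟩ := hA.close
  refine ⟨N * |C|, θ, by positivity, hθ, fun ε hε l hl x hx => ?_⟩
  rw [mul_assoc]
  refine Matrix.opNorm_le_of_entries (by positivity) fun i j => (h ε hε l hl x hx i j).trans ?_
  rw [mul_div_assoc]
  gcongr
  exact le_abs_self C

theorem differentiableOn {ε : ℝ} (hε : ε ∈ Set.Ico 0 ε₀) (x : ℝ) :
    DifferentiableOn ℂ (fun l => A ε x l) (ball 0 M) :=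
  Matrix.differentiableOn_of_entries fun i j => (hA.analytic ε hε x i j).differentiableOn

/-- Analyticity of the limit matrix is not assumed: it is inherited from the uniform convergence of
`A 0 x` to `Ainf` as x → ∞. -/
theorem differentiableOn_limit : DifferentiableOn ℂ Ainf (ball 0 M) := by
  obtain ⟨C, ν, hC, hν, h⟩ := hA.exists_norm_sub_le
  refine TendstoLocallyUniformlyOn.differentiableOn (φ := atTop) (F := fun x : ℝ => fun l => A 0 x l)
    ?_ (Eventually.of_forall fun x => hA.differentiableOn hA.zero_mem x) isOpen_ball
  refine TendstoUniformlyOn.tendstoLocallyUniformlyOn ?_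
  rw [Metric.tendstoUniformlyOn_iff]
  intro e he
  have h1 : Tendsto (fun x : ℝ => C * Real.exp (-ν * x)) atTop (𝓝 (C * 0)) := by
    refine Tendsto.const_mul _ (Real.tendsto_exp_atBot.comp ?_)
    exact tendsto_id.const_mul_atTop_of_neg (by linarith)
  rw [mul_zero] at h1
  filter_upwards [h1.eventually (gt_mem_nhds he), eventually_ge_atTop 0] with x hx hx0 l hl
  rw [dist_comm, dist_eq_norm]
  have := h l (by simpa using (mem_ball_zero_iff.1 hl).le) x
  rw [abs_of_nonneg hx0] at this
  exact this.trans_lt hx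

theorem differentiableAt_limit {l : ℂ} (hl : ‖l‖ < M) : DifferentiableAt ℂ Ainf l :=
  (hA.differentiableOn_limit l (mem_ball_zero_iff.2 hl)).differentiableAt
    (isOpen_ball.mem_nhds (mem_ball_zero_iff.2 hl))

theorem norm_le_of_periodic {ε : ℝ} (hε : ε ∈ Set.Ioo 0 ε₀) (hX : 0 < X ε) {l : ℂ} (hl : ‖l‖ ≤ M)
    {K : ℝ} (hK : ∀ x, |x| ≤ X ε / 2 → ‖A ε x l‖ ≤ K) (x : ℝ) : ‖A ε x l‖ ≤ K := by
  have hp : Function.Periodic (fun x => A ε x l) (X ε) := fun x => hA.periodic ε hε l hl x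
  have := hp.sub_int_mul_eq (round (x / X ε)) (x := x)
  rw [← this]
  refine hK _ ?_
  have h1 := abs_sub_round (x / X ε)
  have e : x - round (x / X ε) * X ε = (x / X ε - round (x / X ε)) * X ε := by
    field_simp
  rw [e, abs_mul, abs_of_pos hX]
  nlinarith

theorem exists_bound {l₀ : ℂ} (hl₀ : ‖l₀‖ < M) : ∃ r K : ℝ, 0 < r ∧ ball l₀ r ⊆ ball 0 M ∧
    ∀ ε ∈ Set.Ioo 0 ε₀, 0 < X ε → ∀ l ∈ ball l₀ r, ∀ x, ‖A ε x l‖ ≤ K := by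
  obtain ⟨C, ν, hC, hν, h⟩ := hA.exists_norm_sub_le
  obtain ⟨D, θ, hD, hθ, h'⟩ := hA.exists_norm_sub_zero_le
  have h1 : ∀ᶠ l in 𝓝 l₀, ‖Ainf l‖ < ‖Ainf l₀‖ + 1 :=
    (hA.differentiableAt_limit hl₀).continuousAt.norm.eventually (gt_mem_nhds (by linarith))
  have h2 : ∀ᶠ l in 𝓝 l₀, l ∈ ball (0 : ℂ) M := isOpen_ball.mem_nhds (mem_ball_zero_iff.2 hl₀)
  obtain ⟨r, hr, hball⟩ := Metric.eventually_nhds_iff_ball.1 (h1.and h2)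
  refine ⟨r, ‖Ainf l₀‖ + 1 + C + D, hr, fun l hl => (hball l hl).2, fun ε hε hX l hl x => ?_⟩
  obtain ⟨hl1, hl2⟩ := hball l hl
  have hlM : ‖l‖ ≤ M := (mem_ball_zero_iff.1 hl2).le
  refine hA.norm_le_of_periodic hε hX hlM (fun x hx => ?_) x
  have e : A ε x l = Ainf l + (A 0 x l - Ainf l) + (A ε x l - A 0 x l) := by abel
  rw [e]
  refine (norm_add_le _ _).trans (add_le_add ((norm_add_le _ _).trans (add_le_add hl1.le ?_)) ?_)
  · refine (h l hlM x).trans (mul_le_of_le_one_right hC (Real.exp_le_one_iff.2 ?_))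
    have := abs_nonneg x; nlinarith
  · refine (h' ε hε l hlM x hx).trans (mul_le_of_le_one_right hD (Real.exp_le_one_iff.2 ?_))
    nlinarith

theorem solutionOperator_spec {ε : ℝ} (hε : ε ∈ Set.Ioo 0 ε₀) (hX : 0 < X ε) {l : ℂ} (hl : ‖l‖ < M)
    :
    solutionOperator (fun x => A ε x l) 0 = 1 ∧ ∀ x, HasDerivAt (solutionOperator fun x => A ε x l)
      (A ε x l * solutionOperator (fun x => A ε x l) x) x := by
  obtain ⟨r, K, hr, -, hK⟩ := hA.exists_bound hl
  exact _root_.solutionOperator_spec (hA.continuous ⟨hε.1.le, hε.2⟩ hl.le)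
    (hK ε hε hX l (mem_ball_self hr))

theorem differentiableAt_periodicEvans {ε : ℝ} (hε : ε ∈ Set.Ioo 0 ε₀) (hX : 0 < X ε) {l₀ : ℂ}
    (hl₀ : ‖l₀‖ < M) (γ : ℂ) :
    DifferentiableAt ℂ (fun l => periodicEvans (fun x => A ε x l) (X ε) γ) l₀ := by
  obtain ⟨r, K, hr, hsub, hK⟩ := hA.exists_bound hl₀
  have hl : ∀ l ∈ ball l₀ r, ‖l‖ < M := fun l h => mem_ball_zero_iff.1 (hsub h)
  have h1 : DifferentiableAt ℂ (fun l => solutionOperator (fun x => A ε x l) (X ε)) l₀ :=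
    linearODE_differentiableAt_param (B := fun l x => A ε x l) hr
      (fun l h => hA.continuous ⟨hε.1.le, hε.2⟩ (hl l h).le) (fun l h => hK ε hε hX l h)
      (fun x => (hA.differentiableOn ⟨hε.1.le, hε.2⟩ x).mono hsub)
      (fun l h => (hA.solutionOperator_spec hε hX (hl l h)).1)
      (fun l h => (hA.solutionOperator_spec hε hX (hl l h)).2) (X ε)
  exact Matrix.differentiableAt_det (h1.sub_const _)

/-- Periodicity applied at -X/2. It expresses the monodromy through values at ±X/2, where the
periodic coefficient has been compared with the homoclinic one all the way from 0. -/
theorem solutionOperator_half {ε : ℝ} (hε : ε ∈ Set.Ioo 0 ε₀) (hX : 0 < X ε) {l : ℂ} (hl : ‖l‖ < M)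
    :
    solutionOperator (fun x => A ε x l) (X ε / 2) =
      solutionOperator (fun x => A ε x l) (-(X ε / 2)) *
      solutionOperator (fun x => A ε x l) (X ε) := by
  obtain ⟨r, K, hr, -, hK⟩ := hA.exists_bound hl
  obtain ⟨h0, hΨ⟩ := hA.solutionOperator_spec hε hX hl
  have := linearODE_periodic (hK ε hε hX l (mem_ball_self hr)) (hA.periodic ε hε l hl.le) h0 hΨ
    (-(X ε / 2))
  rw [← this]
  congr 1; ring

/-- Lipschitz dependence of the coefficients and of their limit on the spectral parameter. -/
theorem exists_lipschitz {C ν : ℝ} (hC : 0 ≤ C) (h : ∀ l : ℂ, ‖l‖ ≤ M → ∀ x : ℝ,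
    ‖A 0 x l - Ainf l‖ ≤ C * Real.exp (-ν * |x|)) {ls : ℂ} (hls : ‖ls‖ < M) :
    ∃ L : ℝ, 0 ≤ L ∧ ∀ᶠ l in 𝓝 ls, ‖l‖ < M ∧ ‖Ainf l - Ainf ls‖ ≤ L * ‖l - ls‖ ∧
      ∀ x, ‖(A 0 x l - Ainf l) - (A 0 x ls - Ainf ls)‖ ≤
        L * ‖l - ls‖ * Real.exp (-ν * |x|) := by
  obtain ⟨c, hc⟩ := (hA.differentiableAt_limit hls).isBigO_sub.bound
  obtain ⟨r, hr, hball⟩ := Metric.isOpen_ball.mem_nhds (mem_ball_zero_iff.2 hls) |>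
    Metric.mem_nhds_iff.1
  refine ⟨|c| + 2 * C / r, by positivity, ?_⟩
  filter_upwards [hc, ball_mem_nhds ls hr] with l h1 h2
  refine ⟨mem_ball_zero_iff.1 (hball h2), h1.trans ?_, fun x => ?_⟩
  · gcongr
    have : 0 ≤ 2 * C / r := by positivity
    linarith [le_abs_self c]
  · have hd : DifferentiableOn ℂ (fun l => A 0 x l - Ainf l) (ball ls r) :=
      ((hA.differentiableOn hA.zero_mem x).sub hA.differentiableOn_limit).mono hball
    -- The Schwarz lemma turns the bound on `A 0 x - Ainf` over a ball into a Lipschitz bound with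
    -- the same factor exp(-ν|x|), which the weighted comparison of conjugators requires.
    have hm : Set.MapsTo (fun l => A 0 x l - Ainf l) (ball ls r)
        (closedBall (A 0 x ls - Ainf ls) (2 * C * Real.exp (-ν * |x|))) := fun z hz => by
      rw [mem_closedBall, dist_eq_norm]
      refine (norm_sub_le _ _).trans ?_
      linarith [h z (mem_ball_zero_iff.1 (hball hz)).le x, h ls hls.le x]
    have := Complex.dist_le_div_mul_dist_of_mapsTo_ball hd hm h2
    rw [dist_eq_norm, dist_eq_norm] at this
    refine this.trans ?_
    have h3 : 0 ≤ |c| * ‖l - ls‖ * Real.exp (-ν * |x|) := by positivity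
    have e : 2 * C * Real.exp (-ν * |x|) / r * ‖l - ls‖ =
      2 * C / r * ‖l - ls‖ * Real.exp (-ν * |x|) := by ring
    rw [e]; linarith

end HomoclinicLimit

end CoefficientFamilies

/-! ### Extending the periodic coefficient beyond one period -/

section Gluing

variable {𝔸 : Type*} [NormedRing 𝔸] [NormedAlgebra ℂ 𝔸] {B₀ B₁ : ℝ → 𝔸} {T θ D : ℝ}

/-- The coefficient that agrees with `B₁` on `[-T, T]` and approaches `B₀` exponentially outside. -/
noncomputable def glueCoeff (B₀ B₁ : ℝ → 𝔸) (T θ : ℝ) (x : ℝ) : 𝔸 :=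
  B₀ x + Real.exp (-θ * max (|x| - T) 0) •
    (B₁ (max (-T) (min T x)) - B₀ (max (-T) (min T x)))

theorem continuous_glueCoeff (h₀ : Continuous B₀) (h₁ : Continuous B₁) :
    Continuous (glueCoeff B₀ B₁ T θ) := by
  unfold glueCoeff
  fun_prop

theorem glueCoeff_of_abs_le {x : ℝ} (hx : |x| ≤ T) : glueCoeff B₀ B₁ T θ x = B₁ x := by
  obtain ⟨h1, h2⟩ := abs_le.1 hx
  simp [glueCoeff, hx, min_eq_right h2, max_eq_right h1]

theorem norm_glueCoeff_sub_le (hT : 0 ≤ T)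
    (h : ∀ x, |x| ≤ T → ‖B₁ x - B₀ x‖ ≤ D * Real.exp (-θ * T)) (x : ℝ) :
    ‖glueCoeff B₀ B₁ T θ x - B₀ x‖ ≤ D * Real.exp (-θ * max |x| T) := by
  have hc : |max (-T) (min T x)| ≤ T := abs_le.2 ⟨le_max_left _ _,
    max_le (by linarith) (min_le_left _ _)⟩
  rw [glueCoeff, add_sub_cancel_left, norm_smul, Real.norm_of_nonneg (Real.exp_pos _).le]
  have e : Real.exp (-θ * max |x| T) = Real.exp (-θ * max (|x| - T) 0) * Real.exp (-θ * T) := by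
    rw [← Real.exp_add, ← mul_add, max_add]; simp
  rw [e]
  calc _ ≤ Real.exp (-θ * max (|x| - T) 0) * (D * Real.exp (-θ * T)) := by gcongr; exact h _ hc
    _ = _ := by ring

/-- The rate θ is split: η is used for decay in x, and θ - η remains as smallness in T. -/
theorem norm_glueCoeff_sub_le_weighted {η : ℝ} (hη : 0 < η) (hηθ : η < θ) (hD : 0 ≤ D) (hT : 0 ≤ T)
    (h : ∀ x, |x| ≤ T → ‖B₁ x - B₀ x‖ ≤ D * Real.exp (-θ * T)) (x : ℝ) :
    ‖glueCoeff B₀ B₁ T θ x - B₀ x‖ ≤ D * Real.exp (-(θ - η) * T) * Real.exp (-η * |x|) := by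
  refine (norm_glueCoeff_sub_le hT h x).trans ?_
  rw [mul_assoc, ← Real.exp_add]
  gcongr
  nlinarith [le_max_left |x| T, le_max_right |x| T]

theorem mul_exp_eq_of_hasDerivAt [CompleteSpace 𝔸] {B P Φ : ℝ → 𝔸} {A : 𝔸} {K : ℝ}
    (hK : ∀ x, ‖B x‖ ≤ K) (hP : ∀ x, HasDerivAt P (B x * P x - P x * A) x) (h0 : Φ 0 = 1)
    (hΦ : ∀ x, HasDerivAt Φ (B x * Φ x) x) (x : ℝ) :
    Φ x * P 0 = P x * NormedSpace.exp ((x : ℂ) • A) := by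
  refine congrFun (linearODE_eq hK (F := fun x => Φ x * P 0) (fun x => ?_)
    (G := fun x => P x * NormedSpace.exp ((x : ℂ) • A)) (fun x => ?_) (x₀ := 0) (by simp [h0])) x
  · simpa [mul_assoc] using (hΦ x).mul_const (P 0)
  · convert! (hP x).mul (hasDerivAt_exp_ofReal_smul_const A x) using 1
    noncomm_ring

theorem linearODE_eq_of_abs_le {B B' F F' : ℝ → 𝔸} {K K' : ℝ} (hT : 0 ≤ T)
    (hK : ∀ x, ‖B x‖ ≤ K) (hK' : ∀ x, ‖B' x‖ ≤ K') (hB : ∀ x, |x| ≤ T → B x = B' x)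
    (hF : ∀ x, HasDerivAt F (B x * F x) x) (hF' : ∀ x, HasDerivAt F' (B' x * F' x) x)
    (h0 : F 0 = 1) (h0' : F' 0 = 1) {x : ℝ} (hx : |x| ≤ T) : F x = F' x := by
  have hKp : 0 < |K| + |K'| + 1 := by positivity
  obtain ⟨c, -, hc⟩ := linearODE_norm_sub_le (𝔸 := 𝔸) hKp hT
  have := hc B B' F F' 0 (fun x => (hK x).trans (by linarith [le_abs_self K, abs_nonneg K']))
    (fun x => (hK' x).trans (by linarith [le_abs_self K', abs_nonneg K]))
    (fun x hx => by simp [hB x hx]) hF hF' h0 h0' x hx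
  rw [mul_zero] at this
  exact sub_eq_zero.1 (norm_le_zero_iff.1 this)

theorem exp_neg_mul_le_div {a x : ℝ} (ha : 0 < a) (hx : 0 < x) : Real.exp (-a * x) ≤ a⁻¹ / x := by
  rw [neg_mul, Real.exp_neg, ← one_div, inv_eq_one_div, div_div]
  gcongr
  linarith [Real.add_one_le_exp (a * x)]

end Gluing

/-! ### Conjugators for the periodic problem on half a period -/

section AsymptoticData

open scoped Matrix.Norms.Operator
open Metric

variable {N : ℕ} {M ε₀ : ℝ} {X : ℝ → ℝ} {A : ℝ → ℝ → ℂ → Matrix (Fin N) (Fin N) ℂ}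
  {Ainf : ℂ → Matrix (Fin N) (Fin N) ℂ}

theorem isConjugator_of_hasDerivAt {s : Set ℝ} {B : ℝ → Matrix (Fin N) (Fin N) ℂ}
    {A : Matrix (Fin N) (Fin N) ℂ} {P : ℝ → Matrix (Fin N) (Fin N) ℂ}
    (h : ∀ x, HasDerivAt P (B x * P x - P x * A) x) {c η : ℝ} (hη : 0 < η)
    (hb : ∀ x ∈ s, ‖P x - 1‖ ≤ c * Real.exp (-η * |x|)) : IsConjugator s B A P :=
  isConjugator_iff.2 ⟨fun x _ => (h x).hasDerivWithinAt, c, η, hη, hb⟩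

/-- Values at `x = 0` and asymptotics at `x = ± X / 2` of conjugators for the periodic problem,
compared to those of the homoclinic problem at `ls`. -/
theorem HomoclinicLimit.exists_asymptotics (hA : HomoclinicLimit M ε₀ X A Ainf) {ls : ℂ}
    (hls : ‖ls‖ < M) :
    ∃ Pp₀ Pm₀ : Matrix (Fin N) (Fin N) ℂ, IsUnit Pp₀ ∧ IsUnit Pm₀ ∧
      (∃ Pp Pm : ℂ → Matrix (Fin N) (Fin N) ℂ, Tendsto Pp (𝓝 ls) (𝓝 Pp₀) ∧
        Tendsto Pm (𝓝 ls) (𝓝 Pm₀) ∧ ∀ᶠ l in 𝓝 ls, ∀ Q, IsHyperbolicProj (Ainf l) Q →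
          homoclinicEvans (fun x => A 0 x l) (Ainf l) = (Pp l * Q + Pm l * (1 - Q)).det) ∧
      ∀ C : ℝ, 0 < C → ∃ K X₀ : ℝ, 0 ≤ K ∧ 0 < X₀ ∧ ∀ ε ∈ Set.Ioo 0 ε₀, X₀ ≤ X ε →
        ∀ l : ℂ, ‖l - ls‖ ≤ C / X ε → ‖l‖ < M ∧ ‖Ainf l - Ainf ls‖ ≤ K / X ε ∧
          ∃ Pp Pm p q : Matrix (Fin N) (Fin N) ℂ,
            ‖Pp - Pp₀‖ ≤ K / X ε ∧ ‖Pm - Pm₀‖ ≤ K / X ε ∧ ‖p - 1‖ ≤ K / X ε ∧ ‖q - 1‖ ≤ K / X ε ∧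
            solutionOperator (fun x => A ε x l) (X ε / 2) * Pp =
              p * NormedSpace.exp (((X ε / 2 : ℝ) : ℂ) • Ainf l) ∧
            solutionOperator (fun x => A ε x l) (-(X ε / 2)) * Pm =
              q * NormedSpace.exp (((-(X ε / 2) : ℝ) : ℂ) • Ainf l) := by
  obtain ⟨C₁, ν, hC₁, hν, hdec⟩ := hA.exists_norm_sub_le
  obtain ⟨C₂, θ, hC₂, hθ, hcl⟩ := hA.exists_norm_sub_zero_le
  obtain ⟨L, hL, hlip⟩ := hA.exists_lipschitz hC₁ hdec hls
  -- The glued coefficient approaches its limit at the slower of the two rates.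
  set ν' := min ν θ with hν'
  have hν'pos : 0 < ν' := lt_min hν hθ
  obtain ⟨η, δ, c, hη, hην, hδ, hc, Pp, Pm, hP, hPl⟩ :=
    exists_conjugators (Ainf ls) hν'pos (C₁ + C₂)
  obtain ⟨r, hr, hball⟩ := Metric.eventually_nhds_iff_ball.1 hlip
  have hηθ : η < θ := hην.trans_le (min_le_right _ _)
  have hην2 : η < ν := hην.trans_le (min_le_left _ _)
  have hexp : ∀ (x a b : ℝ), a ≤ b → Real.exp (-b * |x|) ≤ Real.exp (-a * |x|) := fun x a b hab => by
    refine Real.exp_le_exp.2 ?_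
    have := abs_nonneg x; nlinarith
  have hnear : ∀ l, ‖l - ls‖ < r → L * ‖l - ls‖ ≤ δ →
      IsAsymptoticallyConstant (Ainf ls) δ (C₁ + C₂) ν' (fun x => A 0 x l) (Ainf l) := by
    intro l hl1 hl2
    obtain ⟨h1, h2, -⟩ := hball l (mem_ball_iff_norm.2 hl1)
    refine ⟨hA.continuous hA.zero_mem h1.le, h2.trans hl2, fun x => (hdec l h1.le x).trans ?_⟩
    exact mul_le_mul (by linarith) (hexp x _ _ (min_le_left _ _)) (Real.exp_pos _).le (by positivity)
  have hls0 : IsAsymptoticallyConstant (Ainf ls) δ (C₁ + C₂) ν' (fun x => A 0 x ls) (Ainf ls) :=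
    hnear ls (by simpa using hr) (by simpa using hδ.le)
  obtain ⟨hp0, hm0, hpb0, hmb0⟩ := hP _ _ hls0
  have hcp0 : IsConjugator (Set.Ici 0) _ _ (Pp (fun x => A 0 x ls) (Ainf ls)) :=
    isConjugator_of_hasDerivAt hp0 hη hpb0
  have hcm0 : IsConjugator (Set.Iic 0) _ _ (Pm (fun x => A 0 x ls) (Ainf ls)) :=
    isConjugator_of_hasDerivAt hm0 hη hmb0
  refine ⟨Pp (fun x => A 0 x ls) (Ainf ls) 0, Pm (fun x => A 0 x ls) (Ainf ls) 0,
    hcp0.isRightConjugator.isUnit_zero hls0.cont (hls0.norm_le hν'pos), ?_, ?_, ?_⟩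
  · have := hcm0.reflect.isRightConjugator.isUnit_zero (hls0.cont.comp continuous_neg).neg
      (fun x => by simpa using hls0.norm_le hν'pos (-x))
    simpa using this
  · have hev : ∀ᶠ l in 𝓝 ls, ‖l - ls‖ < r ∧ L * ‖l - ls‖ ≤ δ := by
      have h1 : ∀ᶠ l in 𝓝 ls, ‖l - ls‖ < r := by
        filter_upwards [ball_mem_nhds ls hr] with l hl using mem_ball_iff_norm.1 hl
      have h2 : Tendsto (fun l => L * ‖l - ls‖) (𝓝 ls) (𝓝 0) := by
        have : Continuous fun l => L * ‖l - ls‖ := by fun_prop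
        simpa using this.tendsto ls
      exact h1.and ((h2.eventually (gt_mem_nhds hδ)).mono fun l h => h.le)
    have hest : ∀ᶠ l in 𝓝 ls,
        ‖Pp (fun x => A 0 x l) (Ainf l) 0 - Pp (fun x => A 0 x ls) (Ainf ls) 0‖ ≤
          c * (L * ‖l - ls‖ + L * ‖l - ls‖) ∧
        ‖Pm (fun x => A 0 x l) (Ainf l) 0 - Pm (fun x => A 0 x ls) (Ainf ls) 0‖ ≤
          c * (L * ‖l - ls‖ + L * ‖l - ls‖) := by
      filter_upwards [hev] with l hl
      obtain ⟨h1, h2, h3⟩ := hball l (mem_ball_iff_norm.2 hl.1)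
      have := hPl _ _ _ _ (L * ‖l - ls‖) (hnear l hl.1 hl.2) hls0 fun x => (h3 x).trans (by
        gcongr ?_ * ?_
        exact hexp x _ _ hην2.le)
      exact ⟨this.1.trans (by gcongr), this.2.trans (by gcongr)⟩
    have hz : Tendsto (fun l => c * (L * ‖l - ls‖ + L * ‖l - ls‖)) (𝓝 ls) (𝓝 0) := by
      have : Continuous fun l => c * (L * ‖l - ls‖ + L * ‖l - ls‖) := by fun_prop
      simpa using this.tendsto ls
    refine ⟨fun l => Pp (fun x => A 0 x l) (Ainf l) 0, fun l => Pm (fun x => A 0 x l) (Ainf l) 0,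
      ?_, ?_, ?_⟩
    · exact tendsto_iff_norm_sub_tendsto_zero.2 (squeeze_zero'
        (Eventually.of_forall fun _ => norm_nonneg _) (hest.mono fun l h => h.1) hz)
    · exact tendsto_iff_norm_sub_tendsto_zero.2 (squeeze_zero'
        (Eventually.of_forall fun _ => norm_nonneg _) (hest.mono fun l h => h.2) hz)
    · filter_upwards [hev] with l hl Q hQ
      have hac := hnear l hl.1 hl.2
      obtain ⟨hp, hm, hpb, hmb⟩ := hP _ _ hac
      exact hQ.homoclinicEvans_eq hac.cont (hac.norm_le hν'pos)
        (isConjugator_of_hasDerivAt hp hη hpb) (isConjugator_of_hasDerivAt hm hη hmb)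
  · intro C hC
    -- With T = X/2 the gluing error is exp(-aX) in the weight exp(-η|x|). All exponentially small
    -- errors are then weakened to multiples of 1/X, the size of l - ls.
    set a := (θ - η) / 2 with ha
    have hapos : 0 < a := by rw [ha]; linarith
    set K : ℝ := L * C + c * (L * C + (L * C + C₂ * a⁻¹)) + c * (η / 2)⁻¹ with hK
    have hinv : 0 ≤ a⁻¹ := by positivity
    refine ⟨K, 1 + 2 * C / r + (L * C) / δ, by positivity, by positivity, fun ε hε hXε l hl => ?_⟩
    have hX : 0 < X ε := lt_of_lt_of_le (by positivity) hXε
    have hl1 : ‖l - ls‖ < r := by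
      refine hl.trans_lt ?_
      rw [div_lt_iff₀ hX]
      have h1 : 2 * C / r ≤ X ε := by
        have : 0 ≤ (L * C) / δ := by positivity
        linarith
      rw [div_le_iff₀ hr] at h1
      linarith
    have hl2 : L * ‖l - ls‖ ≤ L * C / X ε := by
      rw [mul_div_assoc]; gcongr
    have hl3 : L * ‖l - ls‖ ≤ δ := by
      refine hl2.trans ?_
      rw [div_le_iff₀ hX]
      have h1 : L * C / δ ≤ X ε := by
        have : 0 ≤ 2 * C / r := by positivity
        linarith
      rw [div_le_iff₀ hδ] at h1
      linarith
    obtain ⟨hlM, hA1, hA2⟩ := hball l (mem_ball_iff_norm.2 hl1)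
    have hcont0 := hA.continuous hA.zero_mem hlM.le
    have hcont1 := hA.continuous ⟨hε.1.le, hε.2⟩ hlM.le
    set T := X ε / 2 with hT
    have hT0 : 0 ≤ T := by positivity
    -- A conjugator needs a coefficient with a limit at infinity, which the periodic one lacks. The
    -- glued one has the limit `Ainf l` and gives the same solutions on [-X/2, X/2].
    set B := glueCoeff (fun x => A 0 x l) (fun x => A ε x l) T θ with hB
    have hglue := norm_glueCoeff_sub_le hT0 (hcl ε hε l hlM.le)
    have hglue' := norm_glueCoeff_sub_le_weighted hη hηθ hC₂ hT0 (hcl ε hε l hlM.le)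
    have hBac : IsAsymptoticallyConstant (Ainf ls) δ (C₁ + C₂) ν' B (Ainf l) := by
      refine ⟨continuous_glueCoeff hcont0 hcont1, hA1.trans hl3, fun x => ?_⟩
      have e : B x - Ainf l = (B x - A 0 x l) + (A 0 x l - Ainf l) := by abel
      rw [e, add_comm C₁, add_mul]
      refine (norm_add_le _ _).trans (add_le_add ((hglue x).trans ?_) ((hdec l hlM.le x).trans ?_))
      · refine mul_le_mul_of_nonneg_left (Real.exp_le_exp.2 ?_) hC₂
        have := mul_le_mul (min_le_right ν θ) (le_max_left |x| T) (abs_nonneg x) hθ.le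
        rw [neg_mul, neg_mul]
        exact neg_le_neg this
      · gcongr
        exact min_le_left _ _
    obtain ⟨hp, hm, hpb, hmb⟩ := hP _ _ hBac
    have hdiff : ∀ x, ‖(B x - Ainf l) - (A 0 x ls - Ainf ls)‖ ≤
        (L * C / X ε + C₂ * a⁻¹ / X ε) * Real.exp (-η * |x|) := fun x => by
      have e : (B x - Ainf l) - (A 0 x ls - Ainf ls) =
        ((A 0 x l - Ainf l) - (A 0 x ls - Ainf ls)) + (B x - A 0 x l) := by abel
      rw [e, add_mul]
      refine (norm_add_le _ _).trans (add_le_add ((hA2 x).trans ?_) ((hglue' x).trans ?_))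
      · gcongr ?_ * ?_
        · exact hexp x _ _ hην2.le
      · gcongr ?_ * ?_
        rw [mul_div_assoc]
        gcongr
        have := exp_neg_mul_le_div hapos hX
        refine le_trans (le_of_eq ?_) this
        congr 1; rw [ha, hT]; ring
    have hcomp := hPl _ _ _ _ _ hBac hls0 hdiff
    have hcK : c * (‖Ainf l - Ainf ls‖ + (L * C / X ε + C₂ * a⁻¹ / X ε)) ≤ K / X ε := by
      have h1 : ‖Ainf l - Ainf ls‖ ≤ L * C / X ε := hA1.trans hl2
      calc _ ≤ c * (L * C / X ε + (L * C / X ε + C₂ * a⁻¹ / X ε)) := by gcongr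
        _ = c * (L * C + (L * C + C₂ * a⁻¹)) / X ε := by ring
        _ ≤ _ := by
          gcongr
          have h2 : 0 ≤ L * C := by positivity
          have h3 : 0 ≤ c * (η / 2)⁻¹ := by positivity
          rw [hK]; linarith
    have hηK : c * Real.exp (-η * T) ≤ K / X ε := by
      have h1 := exp_neg_mul_le_div (a := η / 2) (by positivity) hX
      have h2 : -η * T = -(η / 2) * X ε := by rw [hT]; ring
      rw [h2]
      calc _ ≤ c * ((η / 2)⁻¹ / X ε) := by gcongr
        _ = c * (η / 2)⁻¹ / X ε := by ring
        _ ≤ _ := by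
          gcongr
          have h3 : 0 ≤ L * C := by positivity
          have h4 : 0 ≤ c * (L * C + (L * C + C₂ * a⁻¹)) := by positivity
          rw [hK]; linarith
    obtain ⟨Φ, hΦ0, hΦ⟩ := exists_linearODE_solution hBac.cont (hBac.norm_le hν'pos)
    obtain ⟨r', K', hr', -, hK'⟩ := hA.exists_bound hlM
    obtain ⟨hΨ0, hΨ⟩ := hA.solutionOperator_spec hε hX hlM
    have hΦΨ : ∀ x, |x| ≤ T → Φ x = solutionOperator (fun x => A ε x l) x := fun x hx =>
      linearODE_eq_of_abs_le hT0 (hBac.norm_le hν'pos) (hK' ε hε hX l (mem_ball_self hr'))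
        (fun y hy => glueCoeff_of_abs_le hy) hΦ hΨ hΦ0 hΨ0 hx
    have habs : |T| = T := abs_of_nonneg hT0
    refine ⟨hlM, (hA1.trans hl2).trans ?_, Pp B (Ainf l) 0, Pm B (Ainf l) 0, Pp B (Ainf l) T,
      Pm B (Ainf l) (-T), hcomp.1.trans hcK, hcomp.2.trans hcK, ?_, ?_, ?_, ?_⟩
    · gcongr
      have h3 : 0 ≤ c * (η / 2)⁻¹ := by positivity
      have h4 : 0 ≤ c * (L * C + (L * C + C₂ * a⁻¹)) := by positivity
      rw [hK]; linarith
    · have := hpb T hT0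
      rw [habs] at this
      exact this.trans hηK
    · have := hmb (-T) (by linarith)
      rw [abs_neg, habs] at this
      exact this.trans hηK
    · rw [← hΦΨ T habs.le]
      exact mul_exp_eq_of_hasDerivAt (hBac.norm_le hν'pos) hp hΦ0 hΦ T
    · rw [← hΦΨ (-T) (by rw [abs_neg, habs])]
      exact mul_exp_eq_of_hasDerivAt (hBac.norm_le hν'pos) hm hΦ0 hΦ (-T)

end AsymptoticData

/-- The curves 1 + rA and exp(rA) are tangent at 0, so D has the same derivative along both; the
first one is polynomial and easier for determinants. -/
theorem hasDerivAt_comp_exp_zero {𝔸 : Type*} [NormedRing 𝔸] [NormedAlgebra ℂ 𝔸] [CompleteSpace 𝔸]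
    {D : 𝔸 → ℂ} (hD : DifferentiableAt ℂ D 1) {A : 𝔸} {d : ℂ}
    (h : HasDerivAt (fun r : ℂ => D (1 + r • A)) d 0) :
    HasDerivAt (fun t : ℝ => D (NormedSpace.exp ((t : ℂ) • A))) d 0 := by
  have h1 : HasDerivAt (fun r : ℂ => (1 : 𝔸) + r • A) A 0 := by
    simpa using ((hasDerivAt_id (0 : ℂ)).smul_const A).const_add (1 : 𝔸)
  have h2 : HasDerivAt (fun t : ℂ => NormedSpace.exp (t • A)) A 0 := by
    simpa using hasDerivAt_exp_smul_const' A (0 : ℂ)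
  have hd1 : HasFDerivAt D (fderiv ℂ D 1) ((1 : 𝔸) + (0 : ℂ) • A) := by
    simpa using hD.hasFDerivAt
  have hd2 : HasFDerivAt D (fderiv ℂ D 1) (NormedSpace.exp ((0 : ℂ) • A)) := by
    simpa using hD.hasFDerivAt
  have h4 := hd2.comp_hasDerivAt (0 : ℂ) h2
  rw [← h.unique (hd1.comp_hasDerivAt (0 : ℂ) h1)] at h4
  have := HasDerivAt.scomp (0 : ℝ) (h := Complex.ofReal) (h' := 1) (by simpa using h4)
    Complex.ofRealCLM.hasDerivAt
  simpa [Function.comp_def] using this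

/-! ### Determinants: Lipschitz estimates and the exponential -/

section DetAnalysis

open scoped Matrix.Norms.Operator
open Asymptotics

variable {n : Type*} [Fintype n] [DecidableEq n]

theorem Matrix.contDiff_det : ContDiff ℂ 1 (Matrix.det : Matrix n n ℂ → ℂ) := by
  have : (Matrix.det : Matrix n n ℂ → ℂ) =
      fun A => ∑ σ : Equiv.Perm n, Equiv.Perm.sign σ • ∏ i, A (σ i) i := by
    funext A; exact Matrix.det_apply A
  rw [this]
  refine ContDiff.sum fun σ _ => ContDiff.const_smul _ (contDiff_prod fun i _ => ?_)
  exact (ContinuousLinearMap.mk (Matrix.entryLinearMap ℂ ℂ (σ i) i)).contDiff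

theorem Matrix.exists_norm_det_sub_le (R : ℝ) : ∃ L : ℝ, 0 ≤ L ∧ ∀ A B : Matrix n n ℂ, ‖A‖ ≤ R →
    ‖B‖ ≤ R → ‖A.det - B.det‖ ≤ L * ‖A - B‖ := by
  have h1 : LocallyLipschitz (Matrix.det : Matrix n n ℂ → ℂ) := Matrix.contDiff_det.locallyLipschitz
  have : ProperSpace (Matrix n n ℂ) := FiniteDimensional.proper ℂ _
  obtain ⟨L, hL⟩ := (h1.locallyLipschitzOn (s := Metric.closedBall 0 R)).exists_lipschitzOnWith_of_compact
    (isCompact_closedBall _ _)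
  refine ⟨L, L.2, fun A B hA hB => ?_⟩
  have := hL.dist_le_mul A (mem_closedBall_zero_iff.2 hA) B (mem_closedBall_zero_iff.2 hB)
  rwa [dist_eq_norm, dist_eq_norm] at this

variable {ι : Type*} {f : Filter ι} {F G : ι → Matrix n n ℂ} {o : ι → ℝ}

theorem isBigO_one_det_sub (hF : F =O[f] fun _ => (1 : ℝ)) (hG : G =O[f] fun _ => (1 : ℝ))
    (h : (fun i => F i - G i) =O[f] o) : (fun i => (F i).det - (G i).det) =O[f] o := by
  obtain ⟨R₁, h1⟩ := hF.bound
  obtain ⟨R₂, h2⟩ := hG.bound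
  obtain ⟨L, hL, hdet⟩ := Matrix.exists_norm_det_sub_le (n := n) (max R₁ R₂)
  refine IsBigO.trans (IsBigO.of_bound L ?_) h
  filter_upwards [h1, h2] with i h1 h2
  simp only [norm_one, mul_one] at h1 h2
  exact hdet _ _ (h1.trans (le_max_left _ _)) (h2.trans (le_max_right _ _))

theorem isBigO_one_det (hF : F =O[f] fun _ => (1 : ℝ)) :
    (fun i => (F i).det) =O[f] fun _ => (1 : ℝ) := by
  have h0 : (fun _ => (0 : Matrix n n ℂ)) =O[f] fun _ : ι => (1 : ℝ) := isBigO_zero _ _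
  have h1 := isBigO_one_det_sub hF h0 (by simpa only [sub_zero] using hF)
  have h2 : (fun _ => (0 : Matrix n n ℂ).det) =O[f] fun _ : ι => (1 : ℝ) :=
    isBigO_const_const _ one_ne_zero _
  simpa only [sub_add_cancel] using h1.add h2

theorem Matrix.norm_fromBlocks_le {m : Type*} [Fintype m] (A B C D : Matrix m m ℂ) :
    ‖Matrix.fromBlocks A B C D‖ ≤ ‖A‖ + ‖B‖ + (‖C‖ + ‖D‖) := by
  have row : ∀ (A : Matrix m m ℂ) (i : m), ∑ j, ‖A i j‖₊ ≤ ‖A‖₊ := fun A i => by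
    rw [Matrix.linfty_opNNNorm_def]
    exact Finset.le_sup (f := fun i => ∑ j, ‖A i j‖₊) (Finset.mem_univ i)
  have : ‖Matrix.fromBlocks A B C D‖₊ ≤ ‖A‖₊ + ‖B‖₊ + (‖C‖₊ + ‖D‖₊) := by
    rw [Matrix.linfty_opNNNorm_def]
    refine Finset.sup_le fun i _ => ?_
    rw [Fintype.sum_sum_type]
    rcases i with i | i
    · simp only [Matrix.fromBlocks_apply₁₁, Matrix.fromBlocks_apply₁₂]
      exact le_add_of_le_of_nonneg (add_le_add (row A i) (row B i)) zero_le
    · simp only [Matrix.fromBlocks_apply₂₁, Matrix.fromBlocks_apply₂₂]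
      exact le_add_of_nonneg_of_le zero_le (add_le_add (row C i) (row D i))
  exact_mod_cast this

theorem isBigO_fromBlocks {m : Type*} [Fintype m] {A B C D : ι → Matrix m m ℂ} (hA : A =O[f] o)
    (hB : B =O[f] o) (hC : C =O[f] o) (hD : D =O[f] o) :
    (fun i => Matrix.fromBlocks (A i) (B i) (C i) (D i)) =O[f] o := by
  refine IsBigO.trans (g := fun i => ‖A i‖ + ‖B i‖ + (‖C i‖ + ‖D i‖)) (IsBigO.of_bound 1 ?_)
    ((hA.norm_left.add hB.norm_left).add (hC.norm_left.add hD.norm_left))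
  refine Eventually.of_forall fun i => ?_
  rw [one_mul, Real.norm_of_nonneg (by positivity)]
  exact Matrix.norm_fromBlocks_le _ _ _ _

theorem Matrix.hasDerivAt_det_exp_zero (A : Matrix n n ℂ) :
    HasDerivAt (fun t : ℝ => (NormedSpace.exp ((t : ℂ) • A)).det) A.trace 0 := by
  refine hasDerivAt_comp_exp_zero (D := Matrix.det)
    (Matrix.contDiff_det.differentiable one_ne_zero 1) ?_
  obtain ⟨p, hp⟩ : ∃ p : Polynomial ℂ, ∀ r : ℂ, (1 + r • A).det =
      1 + A.trace * r + p.eval r * r ^ 2 := ⟨_, fun r => Matrix.det_one_add_smul r A⟩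
  have h7 := (((hasDerivAt_id (0 : ℂ)).const_mul A.trace).const_add 1).add
    ((p.hasDerivAt 0).mul (hasDerivAt_pow 2 (0 : ℂ)))
  convert! h7 using 1
  · funext r; simp [hp]
  · simp

/-- By multiplicativity the derivative at 0 determines the derivative everywhere, so both sides
solve y' = (tr A) y with y(0) = 1. -/
theorem Matrix.det_exp_ofReal_smul (A : Matrix n n ℂ) (t : ℝ) :
    (NormedSpace.exp ((t : ℂ) • A)).det = Complex.exp (t * A.trace) := by
  have h1 : ∀ x : ℝ, HasDerivAt (fun t : ℝ => (NormedSpace.exp ((t : ℂ) • A)).det)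
      (A.trace * (NormedSpace.exp ((x : ℂ) • A)).det) x := fun x => by
    have h2 : HasDerivAt (fun t : ℝ => (NormedSpace.exp ((t : ℂ) • A)).det) A.trace (x - x) := by
      rw [sub_self]; exact Matrix.hasDerivAt_det_exp_zero A
    have h3 := (h2.comp_sub_const x x).mul_const (NormedSpace.exp ((x : ℂ) • A)).det
    convert! h3 using 1
    funext y
    have e : NormedSpace.exp ((y : ℂ) • A) =
        NormedSpace.exp (((y - x : ℝ) : ℂ) • A) * NormedSpace.exp ((x : ℂ) • A) := by
      let _ : NormedAlgebra ℚ (Matrix n n ℂ) := NormedAlgebra.restrictScalars ℚ ℂ _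
      have := NormedSpace.exp_add_of_commute
        (((Commute.refl A).smul_left ((y - x : ℝ) : ℂ)).smul_right (x : ℂ))
      rw [← add_smul] at this
      rw [← Complex.ofReal_add, sub_add_cancel] at this
      exact this
    rw [e, Matrix.det_mul]
  have h2 : ∀ x : ℝ, HasDerivAt (fun t : ℝ => Complex.exp (t * A.trace))
      (A.trace * Complex.exp (x * A.trace)) x := fun x => by
    have := ((Complex.ofRealCLM.hasDerivAt (x := x)).mul_const A.trace).cexp
    convert! this using 1
    simp [mul_comm]
  exact congrFun (linearODE_eq (B := fun _ => A.trace) (K := ‖A.trace‖) (fun _ => le_rfl) h1 h2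
    (x₀ := 0) (by simp)) t

end DetAnalysis

/-! ### Exact determinant identities for the matching problem -/

section BlockDeterminants

variable {N : ℕ}

/-- Three complementary projections. -/
structure IsTriple {𝔸 : Type*} [Ring 𝔸] (s c u : 𝔸) : Prop where
  ss : s * s = s
  cc : c * c = c
  uu : u * u = u
  sc : s * c = 0
  cs : c * s = 0
  su : s * u = 0
  us : u * s = 0
  cu : c * u = 0
  uc : u * c = 0
  sum : s + c + u = 1

theorem IsSplit.isTriple {𝔸 : Type*} [NormedRing 𝔸] [NormedAlgebra ℂ 𝔸] [CompleteSpace 𝔸]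
    [FiniteDimensional ℂ 𝔸] {α ρ : ℝ} {a : 𝔸} (h : IsSplit α ρ a) :
    IsTriple (stableProj α ρ a) (centerProj α ρ a) (unstableProj α ρ a) :=
  ⟨h.stable_mul_stable, h.center_mul_center, h.unstable_mul_unstable, h.stable_mul_center,
    h.center_mul_stable, h.stable_mul_unstable, h.unstable_mul_stable, h.center_mul_unstable,
    h.unstable_mul_center, by rw [centerProj]; abel⟩

open Matrix

variable {s c u P R : Matrix (Fin N) (Fin N) ℂ}

theorem Matrix.det_one_add_vecMulVec (a b : Fin N → ℂ) : (1 + vecMulVec a b).det = 1 + b ⬝ᵥ a := by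
  rw [vecMulVec_eq Unit, det_one_add_replicateCol_mul_replicateRow]

/-- P c has rank one, so the determinant is affine in w. The matrix P (s + c) + R u is also a
rank-one modification of M, and the matrix determinant lemma shows that its determinant is the
required slope. -/
theorem IsTriple.det_sub_smul (h : IsTriple s c u) {a b : Fin N → ℂ} (hc : c = vecMulVec a b)
    (hab : b ⬝ᵥ a = 1) (hM : (P * s + R * (c + u)).det ≠ 0) (w : ℂ) :
    (P * s + R * (c + u) - w • (P * c)).det =
      (P * s + R * (c + u)).det - w * (P * (s + c) + R * u).det := by
  set M := P * s + R * (c + u) with hMdef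
  have hMu : IsUnit M.det := hM.isUnit
  have hMi : M * M⁻¹ = 1 := Matrix.mul_nonsing_inv _ hMu
  have hMi' : M⁻¹ * M = 1 := Matrix.nonsing_inv_mul _ hMu
  have hMc : M * c = R * c := by
    rw [hMdef]; simp only [add_mul, mul_assoc, h.sc, h.cc, h.uc]; simp
  have e1 : M - w • (P * c) = M * (1 + vecMulVec (-w • (M⁻¹ * P) *ᵥ a) b) := by
    rw [smul_vecMulVec, ← mul_vecMulVec, ← hc, mul_add, mul_one, mul_smul_comm,
      ← mul_assoc, ← mul_assoc, hMi, one_mul, neg_smul, sub_eq_add_neg]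
  have e2 : P * (s + c) + R * u = M * (1 + vecMulVec ((M⁻¹ * P) *ᵥ a - a) b) := by
    rw [sub_vecMulVec, ← mul_vecMulVec, ← hc, mul_add M, mul_one M, mul_sub M, hMc, ← mul_assoc,
      ← mul_assoc, hMi, one_mul, hMdef]
    noncomm_ring
  rw [e1, e2, det_mul, det_mul, det_one_add_vecMulVec, det_one_add_vecMulVec,
    dotProduct_smul, dotProduct_sub, hab, smul_eq_mul]
  ring

theorem IsTriple.det_sign_sq (h : IsTriple s c u) : (s - (c + u)).det ^ 2 = 1 := by
  rw [sq, ← det_mul]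
  have : (s - (c + u)) * (s - (c + u)) = 1 := by
    rw [← h.sum]
    simp only [sub_mul, mul_sub, add_mul, mul_add, h.ss, h.cc, h.uu, h.sc, h.cs, h.su, h.us, h.cu,
      h.uc]
    abel
  rw [this, det_one]

theorem IsTriple.det_swap_sq (h : IsTriple s c u) :
    (fromBlocks s (c + u) (c + u) s).det ^ 2 = 1 := by
  rw [sq, ← det_mul, fromBlocks_multiply]
  have e1 : s * s + (c + u) * (c + u) = 1 := by
    rw [← h.sum]
    simp only [add_mul, mul_add, h.ss, h.cc, h.uu, h.cu, h.uc]
    abel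
  have e2 : s * (c + u) + (c + u) * s = 0 := by
    simp only [add_mul, mul_add, h.sc, h.cs, h.su, h.us]; simp
  have e3 : (c + u) * s + s * (c + u) = 0 := by rw [add_comm, e2]
  have e4 : (c + u) * (c + u) + s * s = 1 := by rw [add_comm, e1]
  rw [e1, e2, e3, e4, fromBlocks_one, det_one]

/-- The determinant of the limiting matching problem. -/
theorem IsTriple.det_matching (h : IsTriple s c u) {a b : Fin N → ℂ} (hc : c = vecMulVec a b)
    (hab : b ⬝ᵥ a = 1) (hM : (P * s + R * (c + u)).det ≠ 0) {g : ℂ} (hg : g ≠ 0) (γ : ℂ) :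
    (fromBlocks (P * (s + c)) (-(R * (u + c))) (u + g • c) (-(γ • (s + g⁻¹ • c)))).det *
      ((fromBlocks s (c + u) (c + u) s).det * (s - (c + u)).det) =
    ((P * s + R * (c + u)).det - γ * g⁻¹ ^ 2 * (P * (s + c) + R * u).det) *
      (u + g • c - γ • s).det := by
  -- Adding the first block column times z c to the second removes the center term from the lower
  -- right block. Exchanging the ranges of c + u between the two block columns then makes the matrix
  -- block triangular, and a sign change brings the upper block to the form of
  -- `IsTriple.det_sub_smul`.
  set z := γ * g⁻¹ ^ 2 with hz
  have e : fromBlocks (P * (s + c)) (-(R * (u + c))) (u + g • c) (-(γ • (s + g⁻¹ • c))) *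
      fromBlocks 1 (z • c) 0 1 * fromBlocks s (c + u) (c + u) s =
      fromBlocks (P * s + z • (P * c) - R * (u + c))
        (P * (s + c) * (c + u) + (P * (s + c) * (z • c) - R * (u + c)) * s) 0
        (u + g • c - γ • s) := by
    rw [fromBlocks_multiply, fromBlocks_multiply]
    have e0 : (u + g • c) * (z • c) + -(γ • (s + g⁻¹ • c)) = -(γ • s) := by
      simp only [add_mul, mul_smul_comm, smul_mul_assoc, h.uc, h.cc, smul_add, smul_smul]
      have : z * g = γ * g⁻¹ := by rw [hz]; field_simp
      rw [this]; simp
    congr 1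
    · simp only [mul_zero, add_zero, mul_one, add_mul, mul_add, mul_smul_comm, smul_mul_assoc,
        mul_assoc, h.ss, h.cs, h.sc, h.cc, h.cu, h.uc, h.uu, neg_mul]
      simp
      abel
    · simp only [mul_zero, add_zero, mul_one]
      rw [sub_eq_add_neg]
    · rw [mul_one, mul_one, e0, mul_zero, add_zero]
      simp only [add_mul, mul_add, smul_mul_assoc, h.us, h.cs, neg_mul, h.sc, h.su]
      simp
    · rw [mul_one, mul_one, e0]
      simp only [add_mul, mul_add, smul_mul_assoc, h.uc, h.uu, h.cc, h.cu, neg_mul, h.ss]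
      simp [sub_eq_add_neg]
      abel
  have e1 : (P * s + z • (P * c) - R * (u + c)) * (s - (c + u)) =
      P * s + R * (c + u) - z • (P * c) := by
    simp only [sub_mul, mul_sub, add_mul, mul_add, smul_mul_assoc, mul_assoc, h.ss, h.cc, h.uu,
      h.sc, h.cs, h.su, h.us, h.cu, h.uc]
    simp
    abel
  have hd := congrArg det e
  rw [det_mul, det_mul, det_fromBlocks_zero₂₁, det_fromBlocks_zero₂₁, det_one, one_mul,
    mul_one] at hd
  rw [← mul_assoc, hd, mul_right_comm, ← det_mul, e1, h.det_sub_smul hc hab hM]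

/-- Reduction of the periodic Evans function to a matching problem at `0` and `± X / 2`. -/
theorem IsTriple.det_evans (h : IsTriple s c u) {Ψh Ψm Ψ Pp Pm p q G Gi : Matrix (Fin N) (Fin N) ℂ}
    {g γ : ℂ} (hG : G * Gi = 1) (hGc : G * c = g • c) (hGic : Gi * c = g⁻¹ • c)
    (hGs : G * s = s * G) (hGiu : Gi * u = u * Gi)
    (hp : Ψh * Pp = p * G) (hm : Ψm * Pm = q * Gi) (hΨ : Ψh = Ψm * Ψ) :
    (fromBlocks (Pp * (s + c + Gi * u)) (-(Pm * (u + c + G * s))) (p * (G * s + g • c + u))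
      (-(γ • (q * (Gi * u + g⁻¹ • c + s))))).det =
    (Ψ - γ • (1 : Matrix (Fin N) (Fin N) ℂ)).det * (Pp.det * q.det *
      (s + g⁻¹ • c + Gi * (Gi * u)).det) := by
  have hGi : Gi * G = 1 := mul_eq_one_comm.1 hG
  have a1 : G * (s + c + Gi * u) = G * s + g • c + u := by
    rw [mul_add, mul_add, hGc, ← mul_assoc, hG, one_mul]
  have a2 : Gi * (u + c + G * s) = Gi * u + g⁻¹ • c + s := by
    rw [mul_add, mul_add, hGic, ← mul_assoc, hGi, one_mul]
  -- The matching matrix is the unscaled one times a diagonal block of column scalings. Its first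
  -- factor has determinant det Ψm det(Ψ - γ); the relation for Ψm replaces det Ψm det Pm by det q
  -- det Gi, and det Gi combines with the scalings in `e3`.
  have e : fromBlocks (Pp * (s + c + Gi * u)) (-(Pm * (u + c + G * s))) (p * (G * s + g • c + u))
      (-(γ • (q * (Gi * u + g⁻¹ • c + s)))) =
      fromBlocks 1 (-1) Ψh (-(γ • Ψm)) *
        fromBlocks (Pp * (s + c + Gi * u)) 0 0 (Pm * (u + c + G * s)) := by
    rw [fromBlocks_multiply]
    congr 1
    · simp
    · simp
    · rw [mul_zero, add_zero, ← mul_assoc, hp, mul_assoc, a1]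
    · rw [mul_zero, zero_add, neg_mul, smul_mul_assoc, ← mul_assoc, hm, mul_assoc, a2]
  have e2 : -(γ • Ψm) - Ψh * -1 = Ψm * (Ψ - γ • (1 : Matrix (Fin N) (Fin N) ℂ)) := by
    rw [hΨ, mul_sub, mul_smul_comm, mul_one, mul_neg, mul_one]; abel
  have e3 : (s + c + Gi * u) * (u + c + G * s) * Gi = s + g⁻¹ • c + Gi * (Gi * u) := by
    have b1 : (s + c + Gi * u) * (u + c + G * s) = G * s + c + Gi * u := by
      rw [hGs, hGiu]
      have : ∀ x, u * Gi * (s * x) = 0 := fun x => by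
        rw [← hGiu, mul_assoc, ← mul_assoc u, h.us, zero_mul, mul_zero]
      simp only [add_mul, mul_add, ← mul_assoc, h.su, h.sc, h.ss, h.cu, h.cc, h.cs]
      rw [mul_assoc _ s G, this, ← hGiu, mul_assoc, mul_assoc, h.uu, h.uc]
      simp
      abel
    have hcGi : c * Gi = g⁻¹ • c := by
      have k : Gi * c = c * Gi := by
        have k1 : c = 1 - s - u := by rw [← h.sum]; abel
        have k2 : Gi * s = s * Gi := by
          calc Gi * s = Gi * (s * G) * Gi := by rw [mul_assoc, mul_assoc, hG, mul_one]
            _ = s * Gi := by rw [← hGs, ← mul_assoc, hGi, one_mul]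
        rw [k1, mul_sub, mul_sub, sub_mul, sub_mul, k2, hGiu, mul_one, one_mul]
      rw [← k, hGic]
    rw [b1, add_mul, add_mul, hcGi, hGs, mul_assoc, hG, mul_one, hGiu, mul_assoc, ← hGiu,
      ← mul_assoc, ← hGiu, mul_assoc, hGiu]
  have d1 := congrArg det hm
  have d3 := congrArg det e3
  rw [det_mul, det_mul] at d1 d3
  rw [e, det_mul, det_fromBlocks_one₁₁, e2, det_fromBlocks_zero₂₁, det_mul, det_mul, det_mul, ← d3]
  linear_combination (Ψ - γ • (1 : Matrix (Fin N) (Fin N) ℂ)).det * Pp.det *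
    (s + c + Gi * u).det * (u + c + G * s).det * d1

end BlockDeterminants

/-! ### Asymptotic calculus in powers of 1/X -/

section BigO

open Asymptotics

variable {ι : Type*} {f : Filter ι}

/-- Only the real part matters: the imaginary part of the exponent may grow with X. -/
theorem isBigO_cexp_of_re {h : ι → ℂ} (hh : (fun i => (h i).re) =O[f] fun _ => (1 : ℝ)) :
    (fun i => Complex.exp (h i)) =O[f] fun _ => (1 : ℝ) := by
  obtain ⟨c, hc⟩ := hh.bound
  refine IsBigO.of_bound (Real.exp c) (hc.mono fun i hi => ?_)
  rw [Complex.norm_exp, norm_one, mul_one, Real.exp_le_exp]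
  rw [norm_one, mul_one] at hi
  exact (le_abs_self _).trans hi

theorem isBigO_mul_of_inv {X : ι → ℝ} {h : ι → ℂ} (hX : Tendsto X f atTop)
    (hh : h =O[f] fun i => (X i)⁻¹) : (fun i => (X i : ℂ) * h i) =O[f] fun _ => (1 : ℝ) := by
  obtain ⟨c, hc⟩ := hh.bound
  refine IsBigO.of_bound c ?_
  filter_upwards [hc, hX.eventually_gt_atTop 0] with i hi hpos
  rw [norm_mul, Complex.norm_real, Real.norm_of_nonneg hpos.le]
  rw [norm_inv, Real.norm_of_nonneg hpos.le] at hi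
  calc X i * ‖h i‖ ≤ X i * (c * (X i)⁻¹) := by gcongr
    _ = c * ‖(1 : ℝ)‖ := by rw [norm_one]; field_simp

theorem isBigO_re {h : ι → ℂ} {o : ι → ℝ} (hh : h =O[f] o) : (fun i => (h i).re) =O[f] o :=
  (IsBigO.of_bound 1 (Eventually.of_forall fun i => by
    rw [one_mul]; exact Complex.abs_re_le_norm _)).trans hh

variable {𝔸 : Type*} [NormedRing 𝔸] [NormedAlgebra ℂ 𝔸] {o : ι → ℝ}

theorem isBigO_one_of_sub {𝔸 : Type*} [NormedRing 𝔸] {o : ι → ℝ} {a : ι → 𝔸} {a₀ : 𝔸}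
    (ho : o =O[f] fun _ => (1 : ℝ))
    (h : (fun i => a i - a₀) =O[f] o) : a =O[f] fun _ => (1 : ℝ) := by
  have := (h.trans ho).add (isBigO_const_const a₀ one_ne_zero f)
  simpa only [sub_add_cancel] using this

theorem isBigO_mul_sub {𝔸 : Type*} [NormedRing 𝔸] {o : ι → ℝ} {a b : ι → 𝔸} {a₀ b₀ : 𝔸}
    (ho : o =O[f] fun _ => (1 : ℝ))
    (ha : (fun i => a i - a₀) =O[f] o) (hb : (fun i => b i - b₀) =O[f] o) :
    (fun i => a i * b i - a₀ * b₀) =O[f] o := by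
  have h1 := ha.mul (isBigO_one_of_sub ho hb)
  have h2 := hb.const_mul_left a₀
  simp only [mul_one] at h1
  refine (h1.add h2).congr_left fun i => ?_
  noncomm_ring

theorem isBigO_block₁ {𝔸 : Type*} [NormedRing 𝔸] {P s c y : ι → 𝔸} {P₀ s₀ c₀ : 𝔸}
    (ho : o =O[f] fun _ => (1 : ℝ))
    (hP : (fun i => P i - P₀) =O[f] o) (hs : (fun i => s i - s₀) =O[f] o)
    (hc : (fun i => c i - c₀) =O[f] o) (hy : y =O[f] o) :
    (fun i => P i * (s i + c i + y i) - P₀ * (s₀ + c₀)) =O[f] o := by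
  refine isBigO_mul_sub ho hP (((hs.add hc).add hy).congr_left fun i => ?_)
  abel

/-- The scalar g is only bounded, since it rotates as X grows, so it is kept in the comparison
matrix; just the projections and p are replaced by limits. -/
theorem isBigO_block₂ {p c u y : ι → 𝔸} {g : ι → ℂ} {c₀ u₀ : 𝔸} (ho : o =O[f] fun _ => (1 : ℝ))
    (hp : (fun i => p i - 1) =O[f] o) (hc : (fun i => c i - c₀) =O[f] o)
    (hu : (fun i => u i - u₀) =O[f] o) (hy : y =O[f] o) (hg : g =O[f] fun _ => (1 : ℝ)) :
    (fun i => p i * (y i + g i • c i + u i) - (u₀ + g i • c₀)) =O[f] o := by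
  have hgc : (fun i => g i • (c i - c₀)) =O[f] o := by simpa using hg.smul hc
  have hgc1 : (fun i => g i • c i) =O[f] fun _ => (1 : ℝ) := by
    simpa using hg.smul (isBigO_one_of_sub ho hc)
  have h1 := hp.mul (((hy.trans ho).add hgc1).add (isBigO_one_of_sub ho hu))
  simp only [mul_one] at h1
  refine (h1.add ((hy.add hgc).add hu)).congr_left fun i => ?_
  rw [sub_mul, one_mul, smul_sub]
  abel

variable [CompleteSpace 𝔸] [FiniteDimensional ℂ 𝔸] {α ρ : ℝ} {A₀ : 𝔸} {A : ι → 𝔸} {X : ι → ℝ}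

theorem tendsto_of_isBigO_inv {𝔸 : Type*} [NormedRing 𝔸] {A : ι → 𝔸} {A₀ : 𝔸}
    (hX : Tendsto X f atTop) (hA : (fun i => A i - A₀) =O[f] fun i => (X i)⁻¹) :
    Tendsto A f (𝓝 A₀) :=
  tendsto_sub_nhds_zero_iff.1 (hA.trans_tendsto (tendsto_inv_atTop_zero.comp hX))

/-- Asymptotics of the spectral projections and exponentials. -/
theorem IsSplit.isBigO (h : IsSplit α ρ A₀) (hX : Tendsto X f atTop)
    (hA : (fun i => A i - A₀) =O[f] fun i => (X i)⁻¹) :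
    ((fun i => stableProj α ρ (A i) - stableProj α ρ A₀) =O[f] fun i => (X i)⁻¹) ∧
    ((fun i => centerProj α ρ (A i) - centerProj α ρ A₀) =O[f] fun i => (X i)⁻¹) ∧
    ((fun i => unstableProj α ρ (A i) - unstableProj α ρ A₀) =O[f] fun i => (X i)⁻¹) ∧
    ((fun i => NormedSpace.exp (((X i / 2 : ℝ) : ℂ) • A i) * stableProj α ρ (A i))
      =O[f] fun i => (X i)⁻¹) ∧
    ((fun i => NormedSpace.exp (((-(X i / 2) : ℝ) : ℂ) • A i) * unstableProj α ρ (A i))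
      =O[f] fun i => (X i)⁻¹) := by
  obtain ⟨K, hK, hev⟩ := h.exists_uniform
  have hev' := (tendsto_of_isBigO_inv hX hA).eventually hev
  have hs : (fun i => stableProj α ρ (A i) - stableProj α ρ A₀) =O[f] fun i => (X i)⁻¹ :=
    (IsBigO.of_bound K (hev'.mono fun i hi => hi.2.1)).trans hA
  have hu : (fun i => unstableProj α ρ (A i) - unstableProj α ρ A₀) =O[f] fun i => (X i)⁻¹ :=
    (IsBigO.of_bound K (hev'.mono fun i hi => hi.2.2.1)).trans hA
  have hexp : ∀ i, 0 < X i → K * Real.exp (-α * (X i / 2)) ≤ K * (α / 2)⁻¹ * ‖(X i)⁻¹‖ := by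
    intro i hi
    have h1 := exp_neg_mul_le_div (a := α / 2) (by linarith [h.pos]) hi
    rw [norm_inv, Real.norm_of_nonneg hi.le]
    have h2 : -α * (X i / 2) = -(α / 2) * X i := by ring
    rw [h2, mul_assoc, ← div_eq_mul_inv]
    gcongr
  refine ⟨hs, ?_, hu, ?_, ?_⟩
  · refine (hs.neg_left.sub hu).congr_left fun i => ?_
    simp only [centerProj]; abel
  · refine IsBigO.of_bound (K * (α / 2)⁻¹) ?_
    filter_upwards [hev', hX.eventually_gt_atTop 0] with i hi hpos
    exact (hi.2.2.2.1 _ (by positivity)).trans (hexp i hpos)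
  · refine IsBigO.of_bound (K * (α / 2)⁻¹) ?_
    filter_upwards [hev', hX.eventually_gt_atTop 0] with i hi hpos
    have := hi.2.2.2.2 (X i / 2) (by positivity)
    rw [Complex.ofReal_neg]
    exact this.trans (hexp i hpos)

end BigO

/-! ### The normalization factor as a single exponential -/

section ScalingFactor

variable {𝔸 : Type*} [NormedRing 𝔸] [NormedAlgebra ℂ 𝔸] [CompleteSpace 𝔸] {A s c u : 𝔸} {τ : ℂ}

/-- Both sides solve the same linear equation with value 1 at t = 0. As an exponential, the scaling
factor has a determinant given by a trace. -/
theorem IsTriple.scaling_eq_exp (h : IsTriple s c u) (hu : A * u = u * A)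
    (t : ℝ) : s + Complex.exp ((t : ℂ) * -(τ / 2)) • c +
      NormedSpace.exp (((-(t / 2) : ℝ) : ℂ) • A) *
        (NormedSpace.exp (((-(t / 2) : ℝ) : ℂ) • A) * u) =
      NormedSpace.exp ((t : ℂ) • (-(A * u + (τ / 2) • c))) := by
  have e : ∀ t : ℝ, NormedSpace.exp (((-(t / 2) : ℝ) : ℂ) • A) *
      (NormedSpace.exp (((-(t / 2) : ℝ) : ℂ) • A) * u) = NormedSpace.exp ((t : ℂ) • (-A)) * u := by
    intro t
    let _ : NormedAlgebra ℚ 𝔸 := NormedAlgebra.restrictScalars ℚ ℂ _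
    rw [← mul_assoc, ← NormedSpace.exp_add_of_commute
      (((Commute.refl A).smul_left _).smul_right _), ← add_smul, smul_neg, ← neg_smul]
    congr 3
    push_cast; ring
  rw [e]
  set Y := -(A * u + (τ / 2) • c) with hY
  have h1 : ∀ x : ℝ, HasDerivAt (fun t : ℝ => s + Complex.exp ((t : ℂ) * -(τ / 2)) • c +
      NormedSpace.exp ((t : ℂ) • (-A)) * u)
      (Y * (s + Complex.exp ((x : ℂ) * -(τ / 2)) • c + NormedSpace.exp ((x : ℂ) • (-A)) * u)) x := by
    intro x
    have e1 : HasDerivAt (fun x : ℝ => Complex.exp ((x : ℂ) * -(τ / 2)))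
        (Complex.exp ((x : ℂ) * -(τ / 2)) * (1 * -(τ / 2))) x :=
      (Complex.ofRealCLM.hasDerivAt (x := x)).mul_const (-(τ / 2)) |>.cexp
    convert! (((e1.smul_const c).const_add s).add
      ((hasDerivAt_exp_ofReal_smul_const (-A) x).mul_const u)) using 1
    have hcomm : u * NormedSpace.exp ((x : ℂ) • (-A)) = NormedSpace.exp ((x : ℂ) • (-A)) * u := by
      refine (mul_exp_smul_comm ?_ _).symm
      rw [neg_mul, mul_neg, hu]
    have f1 : u * (NormedSpace.exp ((x : ℂ) • (-A)) * u) = NormedSpace.exp ((x : ℂ) • (-A)) * u := by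
      rw [← mul_assoc, hcomm, mul_assoc, h.uu]
    have f2 : c * (NormedSpace.exp ((x : ℂ) • (-A)) * u) = 0 := by
      rw [← hcomm, ← mul_assoc, h.cu, zero_mul]
    rw [hY]
    simp only [neg_mul, add_mul, mul_add, mul_assoc, smul_mul_assoc, mul_smul_comm, h.us, h.cs,
      h.uc,
      h.cc, f1, f2, smul_zero, mul_zero, add_zero, zero_add, one_mul]
    rw [neg_zero, zero_add, smul_neg, smul_smul, mul_neg (Complex.exp _), neg_smul]
  have h2 : ∀ x : ℝ, HasDerivAt (fun t : ℝ => NormedSpace.exp ((t : ℂ) • Y))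
      (Y * NormedSpace.exp ((x : ℂ) • Y)) x := hasDerivAt_exp_ofReal_smul_const Y
  refine congrFun (linearODE_eq (B := fun _ => Y) (K := ‖Y‖) (fun _ => le_rfl) h1 h2 (x₀ := 0) ?_) t
  simp [h.sum]

end ScalingFactor

/-! ### Asymptotics of the periodic Evans function -/

section EvansAsymptotics

open scoped Matrix.Norms.Operator
open Asymptotics Matrix

variable {N : ℕ} {ι : Type*} {f : Filter ι} {X : ι → ℝ} {α ρ : ℝ}
  {A₀ P₀ R₀ : Matrix (Fin N) (Fin N) ℂ} {A Pp Pm p q : ι → Matrix (Fin N) (Fin N) ℂ}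

theorem isBigO_trace {o : ι → ℝ} {F : ι → Matrix (Fin N) (Fin N) ℂ} (hF : F =O[f] o) :
    (fun i => (F i).trace) =O[f] o := by
  refine (IsBigO.of_bound N (Eventually.of_forall fun i => ?_)).trans hF
  refine (norm_sum_le _ _).trans ((Finset.sum_le_sum fun j _ =>
    Matrix.norm_entry_le_opNorm (F i) j j).trans (le_of_eq (by simp)))

theorem isBigO_one_inv_of_tendsto {z : ι → ℂ} {z₀ : ℂ} (hz : Tendsto z f (𝓝 z₀)) (h0 : z₀ ≠ 0) :
    z =O[f] (fun _ => (1 : ℝ)) ∧ (fun i => (z i)⁻¹) =O[f] (fun _ => (1 : ℝ)) :=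
  ⟨hz.isBigO_one ℝ, (hz.inv₀ h0).isBigO_one ℝ⟩

theorem tendsto_det_of_isBigO (hX : Tendsto X f atTop)
    (hA : (fun i => A i - A₀) =O[f] fun i => (X i)⁻¹) :
    Tendsto (fun i => (A i).det) f (𝓝 A₀.det) :=
  (Matrix.contDiff_det.continuous.tendsto A₀).comp (tendsto_of_isBigO_inv hX hA)

/-- The generator of the scaling factor. -/
noncomputable def scalingGenerator (α ρ : ℝ) (A : Matrix (Fin N) (Fin N) ℂ) :
    Matrix (Fin N) (Fin N) ℂ :=
  A * unstableProj α ρ A + (stripEigenvalue α ρ A / 2) • centerProj α ρ A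

/-- The limit of the homoclinic Evans function from the side where the eigenvalue in the strip is
unstable. -/
noncomputable def evansUnstableSide (α ρ : ℝ) (A P R : Matrix (Fin N) (Fin N) ℂ) : ℂ :=
  (P * stableProj α ρ A + R * (centerProj α ρ A + unstableProj α ρ A)).det

/-- The limit of the homoclinic Evans function from the side where the eigenvalue in the strip is
stable. -/
noncomputable def evansStableSide (α ρ : ℝ) (A P R : Matrix (Fin N) (Fin N) ℂ) : ℂ :=
  (P * (stableProj α ρ A + centerProj α ρ A) + R * unstableProj α ρ A).det

theorem IsSimpleCenter.isBigO_stripEigenvalue (h : IsSimpleCenter α ρ A₀) (hX : Tendsto X f atTop)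
    (hA : (fun i => A i - A₀) =O[f] fun i => (X i)⁻¹) :
    (fun i => stripEigenvalue α ρ (A i) - stripEigenvalue α ρ A₀) =O[f] fun i => (X i)⁻¹ := by
  have ho : (fun i => (X i)⁻¹) =O[f] fun _ => (1 : ℝ) :=
    (tendsto_inv_atTop_zero.comp hX).isBigO_one ℝ
  have h1 := isBigO_trace (isBigO_mul_sub ho hA (h.toIsSplit.isBigO hX hA).2.1)
  refine h1.congr_left fun i => ?_
  rw [trace_sub, stripEigenvalue, stripEigenvalue]

theorem IsSimpleCenter.isBigO_scalingGenerator (h : IsSimpleCenter α ρ A₀) (hX : Tendsto X f atTop)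
    (hA : (fun i => A i - A₀) =O[f] fun i => (X i)⁻¹) :
    (fun i => (scalingGenerator α ρ (A i)).trace - (scalingGenerator α ρ A₀).trace)
      =O[f] fun i => (X i)⁻¹ := by
  have ho : (fun i => (X i)⁻¹) =O[f] fun _ => (1 : ℝ) :=
    (tendsto_inv_atTop_zero.comp hX).isBigO_one ℝ
  have hsp := h.toIsSplit.isBigO hX hA
  have h1 := isBigO_trace (isBigO_mul_sub ho hA hsp.2.2.1)
  have h2 := isBigO_mul_sub ho (h.isBigO_stripEigenvalue hX hA) (isBigO_trace hsp.2.1 |>.congr_left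
    fun i => trace_sub _ _)
  refine (h1.add (h2.const_mul_left (1 / 2))).congr_left fun i => ?_
  simp only [scalingGenerator, trace_add, trace_smul, trace_sub, smul_eq_mul]
  ring

/-- Asymptotics of the periodic Evans function. -/
theorem IsSimpleCenter.exists_evans_asymptotics (h : IsSimpleCenter α ρ A₀)
    (hre : (stripEigenvalue α ρ A₀).re = 0) (hX : Tendsto X f atTop)
    (hA : (fun i => A i - A₀) =O[f] fun i => (X i)⁻¹)
    (hP₀ : P₀.det ≠ 0)
    (hPp : (fun i => Pp i - P₀) =O[f] fun i => (X i)⁻¹)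
    (hPm : (fun i => Pm i - R₀) =O[f] fun i => (X i)⁻¹)
    (hp : (fun i => p i - 1) =O[f] fun i => (X i)⁻¹)
    (hq : (fun i => q i - 1) =O[f] fun i => (X i)⁻¹)
    (hd : evansUnstableSide α ρ A₀ P₀ R₀ ≠ 0)
    {Ψh Ψm Ψ : ι → Matrix (Fin N) (Fin N) ℂ} {γ : ι → ℂ} (hγ : ∀ i, ‖γ i‖ = 1)
    (h1 : ∀ᶠ i in f, Ψh i * Pp i = p i * NormedSpace.exp (((X i / 2 : ℝ) : ℂ) • A i))
    (h2 : ∀ᶠ i in f, Ψm i * Pm i = q i * NormedSpace.exp (((-(X i / 2) : ℝ) : ℂ) • A i))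
    (h3 : ∀ᶠ i in f, Ψh i = Ψm i * Ψ i) :
    ∃ U : ι → ℂ, (∀ᶠ i in f, U i ≠ 0) ∧
      (fun i => (Ψ i - γ i • (1 : Matrix (Fin N) (Fin N) ℂ)).det * U i -
        (evansUnstableSide α ρ A₀ P₀ R₀ - γ i * Complex.exp (-(X i * stripEigenvalue α ρ (A i))) *
          evansStableSide α ρ A₀ P₀ R₀)) =O[f] (fun i => (X i)⁻¹) ∧
      (fun i => U i * Complex.exp (X i * (scalingGenerator α ρ A₀).trace)) =O[f]
        (fun _ => (1 : ℝ)) ∧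
      (fun i => (U i * Complex.exp (X i * (scalingGenerator α ρ A₀).trace))⁻¹) =O[f]
        (fun _ => (1 : ℝ)) := by
  have ho : (fun i => (X i)⁻¹) =O[f] fun _ => (1 : ℝ) :=
    (tendsto_inv_atTop_zero.comp hX).isBigO_one ℝ
  obtain ⟨hs, hc, hu, hGs, hGu⟩ := h.toIsSplit.isBigO hX hA
  have hsimple : ∀ᶠ i in f, IsSimpleCenter α ρ (A i) :=
    (tendsto_of_isBigO_inv hX hA).eventually h.eventually
  have hτ := h.isBigO_stripEigenvalue hX hA
  -- The strip eigenvalue is imaginary at A₀ and moves by O(1/X), so X times its real part is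
  -- bounded. Hence g and its inverse are bounded even though the exponent has length of order X.
  have hXτ : (fun i => X i * (stripEigenvalue α ρ (A i)).re) =O[f] fun _ => (1 : ℝ) := by
    have := isBigO_re (isBigO_mul_of_inv hX hτ)
    refine this.congr_left fun i => ?_
    simp [hre]
  set s₀ := stableProj α ρ A₀ with hs₀
  set c₀ := centerProj α ρ A₀ with hc₀
  set u₀ := unstableProj α ρ A₀ with hu₀
  have htr : IsTriple s₀ c₀ u₀ := h.toIsSplit.isTriple
  set g : ι → ℂ := fun i => Complex.exp (((X i / 2 : ℝ) : ℂ) * stripEigenvalue α ρ (A i)) with hg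
  have hg0 : ∀ i, g i ≠ 0 := fun i => Complex.exp_ne_zero _
  have hgi : ∀ i, (g i)⁻¹ = Complex.exp (((-(X i / 2) : ℝ) : ℂ) * stripEigenvalue α ρ (A i)) :=
    fun i => by
      rw [hg, ← Complex.exp_neg]; congr 1; push_cast; ring
  have hgO : g =O[f] fun _ => (1 : ℝ) := by
    refine isBigO_cexp_of_re ((hXτ.const_mul_left (1 / 2)).congr_left fun i => ?_)
    rw [Complex.re_ofReal_mul]; ring
  have hgiO : (fun i => (g i)⁻¹) =O[f] fun _ => (1 : ℝ) := by
    simp only [hgi]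
    refine isBigO_cexp_of_re ((hXτ.const_mul_left (-(1 / 2))).congr_left fun i => ?_)
    rw [Complex.re_ofReal_mul]; ring
  have hγO : γ =O[f] fun _ => (1 : ℝ) :=
    IsBigO.of_bound 1 (Eventually.of_forall fun i => by simp [hγ i])
  have hγ0 : ∀ i, γ i ≠ 0 := fun i h0 => by simpa [h0] using hγ i
  have hγiO : (fun i => (γ i)⁻¹) =O[f] fun _ => (1 : ℝ) :=
    IsBigO.of_bound 1 (Eventually.of_forall fun i => by simp [hγ i])
  set s := fun i => stableProj α ρ (A i) with hsdef
  set c := fun i => centerProj α ρ (A i) with hcdef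
  set u := fun i => unstableProj α ρ (A i) with hudef
  set G := fun i => NormedSpace.exp (((X i / 2 : ℝ) : ℂ) • A i) with hG
  set Gi := fun i => NormedSpace.exp (((-(X i / 2) : ℝ) : ℂ) • A i) with hGi
  set F := fun i => fromBlocks (Pp i * (s i + c i + Gi i * u i)) (-(Pm i * (u i + c i + G i * s i)))
    (p i * (G i * s i + g i • c i + u i)) (-(γ i • (q i * (Gi i * u i + (g i)⁻¹ • c i + s i))))
    with hF
  set F₀ := fun i => fromBlocks (P₀ * (s₀ + c₀)) (-(R₀ * (u₀ + c₀))) (u₀ + g i • c₀)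
    (-(γ i • (s₀ + (g i)⁻¹ • c₀))) with hF₀
  have hFF₀ : (fun i => F i - F₀ i) =O[f] fun i => (X i)⁻¹ := by
    have b1 := isBigO_block₁ ho hPp hs hc hGu
    have b2 := (isBigO_block₁ ho hPm hu hc hGs).neg_left
    have b3 := isBigO_block₂ ho hp hc hu hGs hgO
    have b4 : (fun i => -(γ i • (q i * (Gi i * u i + (g i)⁻¹ • c i + s i) -
        (s₀ + (g i)⁻¹ • c₀)))) =O[f] fun i => (X i)⁻¹ := by
      have := (hγO.smul (isBigO_block₂ ho hq hc hs hGu hgiO)).neg_left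
      simp only [smul_eq_mul, one_mul] at this
      exact this
    refine (isBigO_fromBlocks b1 b2 b3 b4).congr_left fun i => ?_
    rw [hF, hF₀]
    simp only [sub_eq_add_neg, fromBlocks_neg, fromBlocks_add]
    congr 1
    · rw [neg_add, neg_neg]
      rfl
    · rw [smul_add, smul_neg, neg_add, neg_neg]
  have hF₀O : F₀ =O[f] fun _ => (1 : ℝ) := by
    have k : ∀ x : Matrix (Fin N) (Fin N) ℂ, (fun _ : ι => x) =O[f] fun _ => (1 : ℝ) := fun x =>
      isBigO_const_const x one_ne_zero f
    have b3 : (fun i => u₀ + g i • c₀) =O[f] fun _ => (1 : ℝ) := by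
      have := (k u₀).add (by simpa using hgO.smul (k c₀))
      exact this
    have b4 : (fun i => -(γ i • (s₀ + (g i)⁻¹ • c₀))) =O[f] fun _ => (1 : ℝ) := by
      have h4 : (fun i => s₀ + (g i)⁻¹ • c₀) =O[f] fun _ => (1 : ℝ) :=
        (k s₀).add (by simpa using hgiO.smul (k c₀))
      simpa using (hγO.smul h4).neg_left
    exact isBigO_fromBlocks (k _) (k _) b3 b4
  have hFO : F =O[f] fun _ => (1 : ℝ) := by
    have := (hFF₀.trans ho).add hF₀O
    simpa only [sub_add_cancel] using this
  have hdet := isBigO_one_det_sub hFO hF₀O hFF₀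
  obtain ⟨a, b, hab, hba⟩ := h.rank_one
  set d₁ := evansUnstableSide α ρ A₀ P₀ R₀ with hd₁
  set d₂ := evansStableSide α ρ A₀ P₀ R₀ with hd₂
  set σ := (fromBlocks s₀ (c₀ + u₀) (c₀ + u₀) s₀).det * (s₀ - (c₀ + u₀)).det with hσ
  have hσ2 : σ ^ 2 = 1 := by rw [hσ, mul_pow, htr.det_swap_sq, htr.det_sign_sq, one_mul]
  have hσ0 : σ ≠ 0 := fun h0 => by simp [h0] at hσ2
  -- κ is bounded, and so is its reciprocal: the matrix acts by scalars on the three ranges, and its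
  -- inverse is the matrix of the same form with inverted scalars, whose entries are bounded as
  -- well.
  set κ : ι → ℂ := fun i => (u₀ + g i • c₀ - γ i • s₀).det with hκ
  have hmatch : ∀ i, (F₀ i).det * σ = (d₁ - γ i * (g i)⁻¹ ^ 2 * d₂) * κ i := fun i =>
    htr.det_matching hab hba hd (hg0 i) (γ i)
  have hκi : ∀ i, κ i * (u₀ + (g i)⁻¹ • c₀ - (γ i)⁻¹ • s₀).det = 1 := fun i => by
    rw [hκ, ← det_mul, ← det_one (n := Fin N)]
    congr 1
    rw [← htr.sum]
    simp only [sub_mul, mul_sub, add_mul, mul_add, smul_mul_assoc, mul_smul_comm, htr.ss, htr.cc,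
      htr.uu, htr.sc, htr.cs, htr.su, htr.us, htr.cu, htr.uc, smul_zero]
    simp only [add_zero, zero_add, sub_zero, zero_sub, smul_neg, smul_smul,
      inv_mul_cancel₀ (hg0 i), inv_mul_cancel₀ (hγ0 i), one_smul, sub_neg_eq_add]
    abel
  have hκ0 : ∀ i, κ i ≠ 0 := fun i h0 => by have := hκi i; rw [h0, zero_mul] at this; simp at this
  have hκinv : ∀ i, (κ i)⁻¹ = (u₀ + (g i)⁻¹ • c₀ - (γ i)⁻¹ • s₀).det := fun i => by
    exact inv_eq_of_mul_eq_one_right (hκi i)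
  have hcomb : ∀ {x y : ι → ℂ}, x =O[f] (fun _ => (1 : ℝ)) → y =O[f] (fun _ => (1 : ℝ)) →
      (fun i => (u₀ + x i • c₀ - y i • s₀).det) =O[f] fun _ => (1 : ℝ) := fun hx hy => by
    have k : ∀ x : Matrix (Fin N) (Fin N) ℂ, (fun _ : ι => x) =O[f] fun _ => (1 : ℝ) := fun x =>
      isBigO_const_const x one_ne_zero f
    refine isBigO_one_det (((k u₀).add ?_).sub ?_)
    · simpa using hx.smul (k c₀)
    · simpa using hy.smul (k s₀)
  have hκO : κ =O[f] fun _ => (1 : ℝ) := hcomb hgO hγO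
  have hκiO : (fun i => (κ i)⁻¹) =O[f] fun _ => (1 : ℝ) := by
    simp only [hκinv]; exact hcomb hgiO hγiO
  set y := fun i => (scalingGenerator α ρ (A i)).trace with hy
  set y₀ := (scalingGenerator α ρ A₀).trace with hy₀
  have hFE : ∀ᶠ i in f, (F i).det = (Ψ i - γ i • (1 : Matrix (Fin N) (Fin N) ℂ)).det *
      ((Pp i).det * (q i).det * Complex.exp (-(X i * y i))) := by
    filter_upwards [h1, h2, h3, hsimple] with i h1 h2 h3 hi
    have hti : IsTriple (s i) (c i) (u i) := hi.toIsSplit.isTriple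
    have hGc : G i * c i = g i • c i := exp_ofReal_smul_mul_eigen hi.mul_center _
    have hGic : Gi i * c i = (g i)⁻¹ • c i := by
      rw [hgi]; exact exp_ofReal_smul_mul_eigen hi.mul_center _
    have hGG : G i * Gi i = 1 := by
      have := exp_smul_mul_exp_neg_smul (A i) ((X i / 2 : ℝ) : ℂ)
      rw [← Complex.ofReal_neg] at this
      exact this
    have hGs : G i * s i = s i * G i := mul_exp_smul_comm hi.toIsSplit.stableProj_comm _
    have hGiu : Gi i * u i = u i * Gi i := mul_exp_smul_comm hi.toIsSplit.unstableProj_comm _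
    rw [hF, hti.det_evans hGG hGc hGic hGs hGiu h1 h2 h3]
    congr 2
    have e := hti.scaling_eq_exp (τ := stripEigenvalue α ρ (A i)) hi.toIsSplit.unstableProj_comm (X i)
    have e' : s i + (g i)⁻¹ • c i + Gi i * (Gi i * u i) =
        NormedSpace.exp ((X i : ℂ) • (-scalingGenerator α ρ (A i))) := by
      refine Eq.trans ?_ e
      rw [hgi]
      congr 4
      push_cast; ring
    rw [e', Matrix.det_exp_ofReal_smul, trace_neg, mul_neg]
  -- Collects all nonzero factors between the Evans function and d₁ - γ exp(-μX) d₂. The only one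
  -- that may grow or decay is the exponential of -X y, which agrees with exp(-X y₀) up to bounded
  -- factors because y - y₀ = O(1/X).
  set U : ι → ℂ := fun i => (Pp i).det * (q i).det * Complex.exp (-(X i * y i)) * σ * (κ i)⁻¹ with hU
  have hg2 : ∀ i, (g i)⁻¹ ^ 2 = Complex.exp (-(X i * stripEigenvalue α ρ (A i))) := fun i => by
    rw [hgi, ← Complex.exp_nat_mul]; congr 1; push_cast; ring
  refine ⟨U, ?_, ?_, ?_, ?_⟩
  · filter_upwards [(tendsto_det_of_isBigO hX hPp).eventually_ne hP₀,
      (tendsto_det_of_isBigO hX hq).eventually_ne (by rw [det_one]; exact one_ne_zero)] with i e1 e2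
    exact mul_ne_zero (mul_ne_zero (mul_ne_zero (mul_ne_zero e1 e2) (Complex.exp_ne_zero _)) hσ0)
      (inv_ne_zero (hκ0 i))
  · have e1 : (fun i => ((F i).det - (F₀ i).det) * (σ * (κ i)⁻¹)) =O[f] fun i => (X i)⁻¹ := by
      simpa using hdet.mul (hκiO.const_mul_left σ)
    refine e1.congr' ?_ EventuallyEq.rfl
    filter_upwards [hFE] with i hi
    have h5 : d₁ - γ i * Complex.exp (-(X i * stripEigenvalue α ρ (A i))) * d₂ =
        (F₀ i).det * (σ * (κ i)⁻¹) := by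
      rw [← mul_assoc (F₀ i).det, hmatch, hg2, mul_assoc _ (κ i), mul_inv_cancel₀ (hκ0 i), mul_one]
    rw [h5, hi, hU]
    ring
  all_goals
    obtain ⟨z1, z1'⟩ := isBigO_one_inv_of_tendsto (tendsto_det_of_isBigO hX hPp) hP₀
    obtain ⟨z2, z2'⟩ := isBigO_one_inv_of_tendsto (tendsto_det_of_isBigO hX hq)
      (by rw [det_one]; exact one_ne_zero)
    have hXy := isBigO_re (isBigO_mul_of_inv hX (h.isBigO_scalingGenerator hX hA))
  · have z3 := isBigO_cexp_of_re (h := fun i => -(X i * (y i - y₀))) (by simpa using hXy.neg_left)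
    have := (((z1.mul z2).mul z3).const_mul_left σ).mul hκiO
    simp only [mul_one] at this
    refine this.congr_left fun i => ?_
    have e : Complex.exp (-(X i * (y i - y₀))) =
        Complex.exp (-(X i * y i)) * Complex.exp (X i * y₀) := by
      rw [← Complex.exp_add]; congr 1; ring
    rw [e, hU]; ring
  · have z3 := isBigO_cexp_of_re (h := fun i => X i * (y i - y₀)) hXy
    have := (((z1'.mul z2').mul z3).const_mul_left σ⁻¹).mul hκO
    simp only [mul_one] at this
    refine this.congr_left fun i => ?_
    have e : Complex.exp (X i * (y i - y₀)) =
        (Complex.exp (-(X i * y i)))⁻¹ * (Complex.exp (X i * y₀))⁻¹ := by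
      rw [← Complex.exp_neg, ← Complex.exp_neg, ← Complex.exp_add]; congr 1; ring
    rw [e, hU]
    simp only [_root_.mul_inv_rev, inv_inv]
    ring

end EvansAsymptotics

/-! ### The spectral splitting on either side of the arc -/

section SidesOfTheArc

open scoped Matrix.Norms.Operator
open Metric

variable {N : ℕ} {α ρ : ℝ} {A : Matrix (Fin N) (Fin N) ℂ}

theorem norm_exp_smul_center_le (h : IsSimpleCenter α ρ A) {t : ℝ}
    (ht : t * (stripEigenvalue α ρ A).re ≤ 0) :
    ‖NormedSpace.exp ((t : ℂ) • A) * centerProj α ρ A‖ ≤ ‖centerProj α ρ A‖ := by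
  have e : NormedSpace.exp ((t : ℂ) • A) * centerProj α ρ A =
      Complex.exp (t * stripEigenvalue α ρ A) • centerProj α ρ A :=
    exp_ofReal_smul_mul_eigen h.mul_center t
  rw [e, norm_smul, Complex.norm_exp, Complex.re_ofReal_mul]
  exact mul_le_of_le_one_left (norm_nonneg _) (Real.exp_le_one_iff.2 ht)

theorem IsSimpleCenter.re_ne (h : IsSimpleCenter α ρ A) (h0 : (stripEigenvalue α ρ A).re ≠ 0)
    {μ : ℂ} (hμ : μ ∈ spectrum ℂ A) : μ.re ≠ 0 := fun hre => by
  rw [h.eq_stripEigenvalue hμ (by rw [hre, abs_zero]; exact h.pos)] at hre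
  exact h0 hre

theorem IsSimpleCenter.stripEigenvalue_eq_of_imaginary (h : IsSimpleCenter α ρ A) {κ : ℝ}
    (hκ : Complex.I * κ ∈ spectrum ℂ A) : stripEigenvalue α ρ A = Complex.I * κ :=
  (h.eq_stripEigenvalue hκ (by simpa using h.pos)).symm

/-- When the strip eigenvalue has positive real part, the center range belongs to the unstable side.
There exp(-tA) is only known to be bounded, uniformly in t ≥ 0, which is all that the comparison of
conjugators uses. -/
theorem IsSimpleCenter.isHyperbolicProj_of_pos (h : IsSimpleCenter α ρ A)
    (h0 : 0 < (stripEigenvalue α ρ A).re) : IsHyperbolicProj A (stableProj α ρ A) where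
  comm := h.toIsSplit.stableProj_comm
  idem := h.toIsSplit.stable_mul_stable
  re_ne _ hμ := h.re_ne h0.ne' hμ
  bound := by
    obtain ⟨K, hK, hev⟩ := h.toIsSplit.exists_uniform
    obtain ⟨-, -, -, h1, h2⟩ := hev.self_of_nhds
    have hexp : ∀ t : ℝ, 0 ≤ t → K * Real.exp (-α * t) ≤ K := fun t ht =>
      mul_le_of_le_one_right hK (Real.exp_le_one_iff.2 (by nlinarith [h.pos]))
    refine ⟨K + ‖centerProj α ρ A‖, fun t ht => ?_, fun t ht => ?_⟩
    · exact ((h1 t ht).trans (hexp t ht)).trans (by linarith [norm_nonneg (centerProj α ρ A)])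
    · have e : (1 - stableProj α ρ A) = unstableProj α ρ A + centerProj α ρ A := by
        rw [centerProj]; abel
      rw [e, mul_add]
      refine (norm_add_le _ _).trans (add_le_add ?_ (norm_exp_smul_center_le h (by nlinarith)))
      rw [Complex.ofReal_neg]
      exact (h2 t ht).trans (hexp t ht)
  stable μ hμ hre k V hV := by
    rcases h.spec μ hμ with h1 | h1 | h1
    · exact h.toIsSplit.stableProj_mul_of_mem h1 hV
    · linarith [lt_re_of_mem_ball h1, h.pos]
    · rw [h.eq_stripEigenvalue hμ h1] at hre; linarith
  unstable μ hμ hre k V hV := h.toIsSplit.stableProj_mul_of_lt (by linarith [h.pos]) hV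

theorem IsSimpleCenter.isHyperbolicProj_of_neg (h : IsSimpleCenter α ρ A)
    (h0 : (stripEigenvalue α ρ A).re < 0) :
    IsHyperbolicProj A (stableProj α ρ A + centerProj α ρ A) where
  comm := by rw [mul_add, add_mul, h.toIsSplit.stableProj_comm, h.toIsSplit.centerProj_comm]
  idem := by
    have t := h.toIsSplit.isTriple
    rw [mul_add, add_mul, add_mul, t.ss, t.cs, t.sc, t.cc]; simp
  re_ne _ hμ := h.re_ne h0.ne hμ
  bound := by
    obtain ⟨K, hK, hev⟩ := h.toIsSplit.exists_uniform
    obtain ⟨-, -, -, h1, h2⟩ := hev.self_of_nhds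
    have hexp : ∀ t : ℝ, 0 ≤ t → K * Real.exp (-α * t) ≤ K := fun t ht =>
      mul_le_of_le_one_right hK (Real.exp_le_one_iff.2 (by nlinarith [h.pos]))
    refine ⟨K + ‖centerProj α ρ A‖, fun t ht => ?_, fun t ht => ?_⟩
    · rw [mul_add]
      exact (norm_add_le _ _).trans (add_le_add ((h1 t ht).trans (hexp t ht))
        (norm_exp_smul_center_le h (by nlinarith)))
    · have e : 1 - (stableProj α ρ A + centerProj α ρ A) = unstableProj α ρ A := by
        rw [centerProj]; abel
      rw [e, Complex.ofReal_neg]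
      exact ((h2 t ht).trans (hexp t ht)).trans (by linarith [norm_nonneg (centerProj α ρ A)])
  stable μ hμ hre k V hV := by
    have e : stableProj α ρ A + centerProj α ρ A = 1 - unstableProj α ρ A := by
      rw [centerProj]; abel
    rw [e, sub_mul, h.toIsSplit.unstableProj_mul_of_lt (by linarith [h.pos]) hV, one_mul, sub_zero]
  unstable μ hμ hre k V hV := by
    have e : stableProj α ρ A + centerProj α ρ A = 1 - unstableProj α ρ A := by
      rw [centerProj]; abel
    rcases h.spec μ hμ with h1 | h1 | h1
    · linarith [re_lt_of_mem_ball_neg h1, h.pos]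
    · rw [e, sub_mul, h.toIsSplit.unstableProj_mul_of_mem h1 hV, one_mul, sub_self]
    · rw [h.eq_stripEigenvalue hμ h1] at hre; linarith

/-- The spectrum is finite, so a thin enough strip contains no eigenvalue of nonzero real part; by
uniqueness it contains only i ks, which is algebraically simple. -/
theorem IsIsolatedArcPoint.exists_isSimpleCenter {M : ℝ}
    {Ainf : ℂ → Matrix (Fin N) (Fin N) ℂ} {I : Set ℝ} {lam : ℝ → ℂ} {ls : ℂ} {ks : ℝ}
    (h : IsIsolatedArcPoint M Ainf I lam ls ks) :
    ∃ α ρ, IsSimpleCenter α ρ (Ainf ls) ∧ stripEigenvalue α ρ (Ainf ls) = Complex.I * ks := by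
  have hfin : (spectrum ℂ (Ainf ls) ∩ {μ | μ.re ≠ 0}).Finite :=
    (finite_spectrum_of_finiteDimensional (Ainf ls)).inter_of_left _
  have hev : ∀ᶠ a : ℝ in 𝓝[>] 0, ∀ μ ∈ spectrum ℂ (Ainf ls) ∩ {μ | μ.re ≠ 0}, 2 * a ≤ |μ.re| :=
    (eventually_all_finite hfin).2 fun μ hμ => by
      have : 0 < |μ.re| / 2 := by have := abs_pos.2 hμ.2; positivity
      filter_upwards [nhdsWithin_le_nhds (gt_mem_nhds this)] with a ha
      linarith
  obtain ⟨a, hsep, ha⟩ := (hev.and self_mem_nhdsWithin).exists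
  have ha : 0 < a := ha
  have huniq : ∀ μ ∈ spectrum ℂ (Ainf ls), |μ.re| < a → μ = Complex.I * ks := fun μ hμ hre => by
    have h0 : μ.re = 0 := by
      by_contra hne
      have := hsep μ ⟨hμ, hne⟩
      linarith
    have e : μ = Complex.I * μ.im := by
      apply Complex.ext <;> simp [h0]
    rw [e] at hμ ⊢
    rw [h.unique _ hμ]
  obtain ⟨ρ, hsplit⟩ := exists_isSplit ha (a := Ainf ls) fun μ hμ => by
    by_cases h0 : μ.re = 0
    · left; rw [h0, abs_zero]; exact ha
    · exact Or.inr (hsep μ ⟨hμ, h0⟩)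
  have hs := isSimpleCenter_of_rootMultiplicity hsplit (σ := Complex.I * ks) (by simpa using ha)
    huniq h.simple
  refine ⟨a, ρ, hs, (hs.eq_stripEigenvalue ?_ (by simpa using ha)).symm⟩
  have := h.dispersion ks (mem_of_mem_nhds h.nhds)
  rwa [h.value] at this

end SidesOfTheArc

/-! ### Analyticity of the center eigenvalue, and one-sided limits of the homoclinic Evans function
-/

section CenterEigenvalue

open scoped Matrix.Norms.Operator
open Metric

theorem IsSplit.tendsto {𝔸 : Type*} [NormedRing 𝔸] [NormedAlgebra ℂ 𝔸] [CompleteSpace 𝔸]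
    [FiniteDimensional ℂ 𝔸] {α ρ : ℝ} {a : 𝔸} (h : IsSplit α ρ a) :
    Tendsto (stableProj α ρ) (𝓝 a) (𝓝 (stableProj α ρ a)) ∧
      Tendsto (unstableProj α ρ) (𝓝 a) (𝓝 (unstableProj α ρ a)) ∧
      Tendsto (centerProj α ρ) (𝓝 a) (𝓝 (centerProj α ρ a)) := by
  obtain ⟨K, hK, hev⟩ := h.exists_uniform
  have h0 : Tendsto (fun b => K * ‖b - a‖) (𝓝 a) (𝓝 0) := by
    have h2 : Continuous fun b => K * ‖b - a‖ := by fun_prop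
    simpa using h2.tendsto a
  have h1 : Tendsto (stableProj α ρ) (𝓝 a) (𝓝 (stableProj α ρ a)) :=
    tendsto_iff_norm_sub_tendsto_zero.2 (squeeze_zero' (Eventually.of_forall fun _ => norm_nonneg _)
      (hev.mono fun b hb => hb.2.1) h0)
  have h2 : Tendsto (unstableProj α ρ) (𝓝 a) (𝓝 (unstableProj α ρ a)) :=
    tendsto_iff_norm_sub_tendsto_zero.2 (squeeze_zero' (Eventually.of_forall fun _ => norm_nonneg _)
      (hev.mono fun b hb => hb.2.2.1) h0)
  exact ⟨h1, h2, (h1.const_sub 1).sub h2⟩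

variable {N : ℕ} {α ρ : ℝ} {F : ℂ → Matrix (Fin N) (Fin N) ℂ} {ls : ℂ} {ks : ℝ}

theorem tendsto_trace {ι : Type*} {f : Filter ι} {G : ι → Matrix (Fin N) (Fin N) ℂ}
    {B : Matrix (Fin N) (Fin N) ℂ} (h : Tendsto G f (𝓝 B)) :
    Tendsto (fun i => (G i).trace) f (𝓝 B.trace) :=
  ((continuous_id.matrix_trace).tendsto B).comp h

/-- With c the center projection, c(l) (F(l) - F(ls)) c(ls) = (μ(l) - μ(ls)) c(l) c(ls). Taking
traces and dividing gives the difference quotient of μ from that of F, with no differentiability of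
the projection. -/
theorem IsSimpleCenter.differentiableAt_stripEigenvalue (h : IsSimpleCenter α ρ (F ls))
    (hF : DifferentiableAt ℂ F ls) :
    DifferentiableAt ℂ (fun l => stripEigenvalue α ρ (F l)) ls := by
  obtain ⟨F', hF'⟩ : ∃ F', HasDerivAt F F' ls := ⟨_, hF.hasDerivAt⟩
  have hcont : Tendsto F (𝓝 ls) (𝓝 (F ls)) := hF.continuousAt
  have hc : Tendsto (fun l => centerProj α ρ (F l)) (𝓝[≠] ls) (𝓝 (centerProj α ρ (F ls))) :=
    (h.toIsSplit.tendsto.2.2.comp hcont).mono_left nhdsWithin_le_nhds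
  have hsl : Tendsto (slope F ls) (𝓝[≠] ls) (𝓝 F') := hasDerivAt_iff_tendsto_slope.1 hF'
  have h1 := tendsto_trace ((hc.mul hsl).mul_const (centerProj α ρ (F ls)))
  have h2 := tendsto_trace (hc.mul_const (centerProj α ρ (F ls)))
  have hcc : centerProj α ρ (F ls) * centerProj α ρ (F ls) = centerProj α ρ (F ls) :=
    h.toIsSplit.center_mul_center
  rw [hcc, h.trace_center] at h2
  have h3 := h1.div h2 one_ne_zero
  refine (hasDerivAt_iff_tendsto_slope.2 (h3.congr' ?_)).differentiableAt
  filter_upwards [(hcont.eventually h.eventually).filter_mono nhdsWithin_le_nhds,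
    h2.eventually_ne one_ne_zero] with l hl hl2
  rw [Pi.div_apply, div_eq_iff hl2, slope_def_module, slope_def_module, smul_eq_mul,
    mul_smul_comm, smul_mul_assoc, Matrix.trace_smul, smul_eq_mul]
  have e1 : centerProj α ρ (F l) * F l = F l * centerProj α ρ (F l) :=
    (hl.toIsSplit.centerProj_comm).symm
  rw [mul_sub, sub_mul, e1, hl.mul_center, mul_assoc _ (F ls), h.mul_center, mul_smul_comm,
    smul_mul_assoc, ← sub_smul, Matrix.trace_smul, smul_eq_mul]
  ring

theorem IsSimpleCenter.eventually_comp (h : IsSimpleCenter α ρ (F ls)) (hF : ContinuousAt F ls) :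
    ∀ᶠ l in 𝓝 ls, IsSimpleCenter α ρ (F l) :=
  Tendsto.eventually (hF : Tendsto F (𝓝 ls) (𝓝 (F ls))) h.eventually

theorem IsSimpleCenter.analyticAt_stripEigenvalue (h : IsSimpleCenter α ρ (F ls))
    (hF : ∀ᶠ l in 𝓝 ls, DifferentiableAt ℂ F l) :
    AnalyticAt ℂ (fun l => stripEigenvalue α ρ (F l)) ls :=
  Complex.analyticAt_iff_eventually_differentiableAt.2 <| by
    filter_upwards [hF, h.eventually_comp hF.self_of_nhds.continuousAt] with l hl hl2
    exact hl2.differentiableAt_stripEigenvalue hl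

/-- Whichever analytic eigenvalue was chosen, continuity keeps it in the strip near ls, where there
is only one eigenvalue. -/
theorem IsSimpleCenter.centerEigenvalue_eventuallyEq (h : IsSimpleCenter α ρ (F ls))
    (hF : ∀ᶠ l in 𝓝 ls, DifferentiableAt ℂ F l)
    (hks : stripEigenvalue α ρ (F ls) = Complex.I * ks) :
    centerEigenvalue F ls ks =ᶠ[𝓝 ls] fun l => stripEigenvalue α ρ (F l) := by
  have hev := h.eventually_comp hF.self_of_nhds.continuousAt
  have hc : IsCenterEigenvalue F ls ks (centerEigenvalue F ls ks) :=
    Classical.epsilon_spec (p := IsCenterEigenvalue F ls ks) ⟨fun l => stripEigenvalue α ρ (F l),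
      h.analyticAt_stripEigenvalue hF, hks, hev.mono fun l hl => hl.stripEigenvalue_mem⟩
  obtain ⟨han, hval, hmem⟩ := hc
  have hre : ∀ᶠ l in 𝓝 ls, |(centerEigenvalue F ls ks l).re| < α := by
    have h1 : ContinuousAt (fun l => |(centerEigenvalue F ls ks l).re|) ls :=
      (Complex.continuous_re.continuousAt.comp han.continuousAt).abs
    refine h1.eventually_lt continuousAt_const ?_
    rw [hval]; simpa using h.pos
  filter_upwards [hev, hmem, hre] with l h1 h2 h3
  exact h1.eq_stripEigenvalue h2 h3

/-- Along the arc μ(lam k) = ik, and the derivative of the right side does not vanish. -/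
theorem IsSimpleCenter.deriv_ne_zero (h : IsSimpleCenter α ρ (F ls))
    (hF : ∀ᶠ l in 𝓝 ls, DifferentiableAt ℂ F l) {M : ℝ} {I : Set ℝ} {lam : ℝ → ℂ}
    (harc : IsIsolatedArcPoint M F I lam ls ks) :
    deriv (fun l => stripEigenvalue α ρ (F l)) ls ≠ 0 := by
  intro h0
  have h1 : HasDerivAt (fun l => stripEigenvalue α ρ (F l)) 0 (lam ks) := by
    rw [harc.value, ← h0]
    exact (h.differentiableAt_stripEigenvalue hF.self_of_nhds).hasDerivAt
  have h2 := h1.scomp ks harc.differentiable.hasDerivAt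
  rw [smul_zero] at h2
  have h3 : HasDerivAt (fun k : ℝ => Complex.I * k) (Complex.I * 1) ks :=
    (Complex.ofRealCLM.hasDerivAt (x := ks)).const_mul Complex.I
  have hlam : Tendsto lam (𝓝 ks) (𝓝 ls) := by
    have := harc.differentiable.continuousAt.tendsto
    rwa [harc.value] at this
  have h4 : (fun k : ℝ => Complex.I * k) =ᶠ[𝓝 ks]
      (fun l => stripEigenvalue α ρ (F l)) ∘ lam := by
    filter_upwards [harc.nhds, hlam.eventually (h.eventually_comp hF.self_of_nhds.continuousAt)]
      with k hk hk2
    exact (hk2.stripEigenvalue_eq_of_imaginary (harc.dispersion k hk)).symm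
  have := h3.unique (h2.congr_of_eventuallyEq h4)
  simp at this

variable {M ε₀ : ℝ} {X : ℝ → ℝ} {A : ℝ → ℝ → ℂ → Matrix (Fin N) (Fin N) ℂ}
  {Pp Pm : ℂ → Matrix (Fin N) (Fin N) ℂ} {Pp₀ Pm₀ : Matrix (Fin N) (Fin N) ℂ} {Λ : Set ℂ}
  {B : ℝ → ℂ → Matrix (Fin N) (Fin N) ℂ}

/-- Inside Λ the hyperbolic stable projection is `stableProj`, which is continuous across the arc;
the limit is evaluated at ls, and the complementary projection becomes center plus unstable. -/
theorem homoclinicEvansOn_eq_unstableSide (h : IsSimpleCenter α ρ (F ls)) (hF : ContinuousAt F ls)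
    (hPp : Tendsto Pp (𝓝 ls) (𝓝 Pp₀)) (hPm : Tendsto Pm (𝓝 ls) (𝓝 Pm₀))
    (hE : ∀ᶠ l in 𝓝 ls, ∀ Q, IsHyperbolicProj (F l) Q →
      homoclinicEvans (fun x => B x l) (F l) = (Pp l * Q + Pm l * (1 - Q)).det)
    (hΛ : ls ∈ closure Λ) (hside : ∀ᶠ l in 𝓝[Λ] ls, 0 < (stripEigenvalue α ρ (F l)).re) :
    homoclinicEvansOn B F Λ ls = evansUnstableSide α ρ (F ls) Pp₀ Pm₀ := by
  have : (𝓝[Λ] ls).NeBot := mem_closure_iff_nhdsWithin_neBot.1 hΛ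
  have hs : Tendsto (fun l => stableProj α ρ (F l)) (𝓝 ls) (𝓝 (stableProj α ρ (F ls))) :=
    h.toIsSplit.tendsto.1.comp hF
  have h1 := (Matrix.contDiff_det.continuous.tendsto _).comp
    ((hPp.mul hs).add (hPm.mul (hs.const_sub 1)))
  refine Tendsto.limUnder_eq (Tendsto.congr' ?_ (h1.mono_left nhdsWithin_le_nhds)) |>.trans ?_
  · filter_upwards [hside, hE.filter_mono nhdsWithin_le_nhds,
      (h.eventually_comp hF).filter_mono nhdsWithin_le_nhds] with l h2 h3 h4
    exact (h3 _ (h4.isHyperbolicProj_of_pos h2)).symm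
  · rw [evansUnstableSide]
    congr 3
    rw [centerProj]; abel

theorem homoclinicEvansOn_eq_stableSide (h : IsSimpleCenter α ρ (F ls)) (hF : ContinuousAt F ls)
    (hPp : Tendsto Pp (𝓝 ls) (𝓝 Pp₀)) (hPm : Tendsto Pm (𝓝 ls) (𝓝 Pm₀))
    (hE : ∀ᶠ l in 𝓝 ls, ∀ Q, IsHyperbolicProj (F l) Q →
      homoclinicEvans (fun x => B x l) (F l) = (Pp l * Q + Pm l * (1 - Q)).det)
    (hΛ : ls ∈ closure Λ) (hside : ∀ᶠ l in 𝓝[Λ] ls, (stripEigenvalue α ρ (F l)).re < 0) :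
    homoclinicEvansOn B F Λ ls = evansStableSide α ρ (F ls) Pp₀ Pm₀ := by
  have : (𝓝[Λ] ls).NeBot := mem_closure_iff_nhdsWithin_neBot.1 hΛ
  have hs : Tendsto (fun l => stableProj α ρ (F l) + centerProj α ρ (F l)) (𝓝 ls)
      (𝓝 (stableProj α ρ (F ls) + centerProj α ρ (F ls))) :=
    (h.toIsSplit.tendsto.1.add h.toIsSplit.tendsto.2.2).comp hF
  have h1 := (Matrix.contDiff_det.continuous.tendsto _).comp
    ((hPp.mul hs).add (hPm.mul (hs.const_sub 1)))
  refine Tendsto.limUnder_eq (Tendsto.congr' ?_ (h1.mono_left nhdsWithin_le_nhds)) |>.trans ?_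
  · filter_upwards [hside, hE.filter_mono nhdsWithin_le_nhds,
      (h.eventually_comp hF).filter_mono nhdsWithin_le_nhds] with l h2 h3 h4
    exact (h3 _ (h4.isHyperbolicProj_of_neg h2)).symm
  · rw [evansStableSide]
    congr 3
    rw [centerProj]; abel

end CenterEigenvalue

/-! ### The Evans estimate, uniform in ε, l and k -/

section UniformEvansEstimate

open scoped Matrix.Norms.Operator
open Asymptotics

variable {N : ℕ} {M ε₀ : ℝ} {X : ℝ → ℝ} {A : ℝ → ℝ → ℂ → Matrix (Fin N) (Fin N) ℂ}
  {Ainf : ℂ → Matrix (Fin N) (Fin N) ℂ} {ls : ℂ} {α ρ : ℝ}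

/-- On discs of radius `O(1/X)` the periodic Evans function is, up to a factor bounded above and
below and up to a normalization, `d₁ - γ exp (-μ X) d₂ + O(1/X)`. -/
theorem HomoclinicLimit.exists_evans_estimate (hA : HomoclinicLimit M ε₀ X A Ainf)
    (hls : ‖ls‖ < M) (hc : IsSimpleCenter α ρ (Ainf ls))
    (hre : (stripEigenvalue α ρ (Ainf ls)).re = 0) :
    ∃ Pp₀ Pm₀ : Matrix (Fin N) (Fin N) ℂ,
      (∃ Pp Pm : ℂ → Matrix (Fin N) (Fin N) ℂ, Tendsto Pp (𝓝 ls) (𝓝 Pp₀) ∧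
        Tendsto Pm (𝓝 ls) (𝓝 Pm₀) ∧ ∀ᶠ l in 𝓝 ls, ∀ Q, IsHyperbolicProj (Ainf l) Q →
          homoclinicEvans (fun x => A 0 x l) (Ainf l) = (Pp l * Q + Pm l * (1 - Q)).det) ∧
      (evansUnstableSide α ρ (Ainf ls) Pp₀ Pm₀ ≠ 0 → ∀ C : ℝ, 0 < C →
        ∃ K X₀ : ℝ, 0 < K ∧ 0 < X₀ ∧ ∀ ε ∈ Set.Ioo 0 ε₀, X₀ ≤ X ε → ∃ w : ℂ, w ≠ 0 ∧
          ∀ l : ℂ, ‖l - ls‖ ≤ C / X ε → ‖l‖ < M ∧ ∀ k : ℝ, ∃ V : ℂ, V ≠ 0 ∧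
            ‖periodicEvans (fun x => A ε x l) (X ε) (Complex.exp (Complex.I * k * X ε)) * w⁻¹ * V -
              (evansUnstableSide α ρ (Ainf ls) Pp₀ Pm₀ - Complex.exp (Complex.I * k * X ε) *
                Complex.exp (-(X ε * stripEigenvalue α ρ (Ainf l))) *
                evansStableSide α ρ (Ainf ls) Pp₀ Pm₀)‖ ≤ K / X ε ∧ ‖V‖ ≤ K ∧ ‖V⁻¹‖ ≤ K) := by
  obtain ⟨Pp₀, Pm₀, hu, -, hlim, hest⟩ := hA.exists_asymptotics hls
  refine ⟨Pp₀, Pm₀, hlim, fun hd C hC => ?_⟩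
  obtain ⟨K, X₀, hK, hX₀, hest⟩ := hest C hC
  -- Triples (ε, l, k) along the single filter X → ∞ turn the asymptotic statement into one uniform
  -- in l and k.
  let S : Set (ℝ × ℂ × ℝ) :=
    {i | i.1 ∈ Set.Ioo 0 ε₀ ∧ X₀ ≤ X i.1 ∧ ‖i.2.1 - ls‖ ≤ C / X i.1}
  let f : Filter (ℝ × ℂ × ℝ) := comap (fun i => X i.1) atTop ⊓ 𝓟 S
  have hX : Tendsto (fun i : ℝ × ℂ × ℝ => X i.1) f atTop := tendsto_comap.mono_left inf_le_left
  have hS : ∀ᶠ i in f, i ∈ S := mem_inf_of_right (mem_principal_self S)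
  have hdata : ∀ i : ℝ × ℂ × ℝ, ∃ Pp Pm p q : Matrix (Fin N) (Fin N) ℂ, i ∈ S →
      ‖Ainf i.2.1 - Ainf ls‖ ≤ K / X i.1 ∧
      ‖Pp - Pp₀‖ ≤ K / X i.1 ∧ ‖Pm - Pm₀‖ ≤ K / X i.1 ∧ ‖p - 1‖ ≤ K / X i.1 ∧
      ‖q - 1‖ ≤ K / X i.1 ∧
      solutionOperator (fun x => A i.1 x i.2.1) (X i.1 / 2) * Pp =
        p * NormedSpace.exp (((X i.1 / 2 : ℝ) : ℂ) • Ainf i.2.1) ∧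
      solutionOperator (fun x => A i.1 x i.2.1) (-(X i.1 / 2)) * Pm =
        q * NormedSpace.exp (((-(X i.1 / 2) : ℝ) : ℂ) • Ainf i.2.1) := fun i => by
    by_cases hi : i ∈ S
    · obtain ⟨-, h1, Pp, Pm, p, q, h2⟩ := hest i.1 hi.1 hi.2.1 i.2.1 hi.2.2
      exact ⟨Pp, Pm, p, q, fun _ => ⟨h1, h2⟩⟩
    · exact ⟨0, 0, 0, 0, fun h => absurd h hi⟩
  choose Pp Pm p q hdata using hdata
  have hO : ∀ {G : ℝ × ℂ × ℝ → Matrix (Fin N) (Fin N) ℂ}, (∀ i ∈ S, ‖G i‖ ≤ K / X i.1) →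
      G =O[f] fun i => (X i.1)⁻¹ := fun {G} hG => IsBigO.of_bound K <| by
    filter_upwards [hS] with i hi
    have hpos : 0 < X i.1 := hX₀.trans_le hi.2.1
    refine (hG i hi).trans (le_of_eq ?_)
    rw [norm_inv, Real.norm_of_nonneg hpos.le, div_eq_mul_inv]
  obtain ⟨U, hU0, hU1, hU2, hU3⟩ := hc.exists_evans_asymptotics hre hX
    (A := fun i : ℝ × ℂ × ℝ => Ainf i.2.1)
    (hO fun i hi => (hdata i hi).1)
    (((Matrix.isUnit_iff_isUnit_det _).1 hu).ne_zero) (hO fun i hi => (hdata i hi).2.1)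
    (hO fun i hi => (hdata i hi).2.2.1) (hO fun i hi => (hdata i hi).2.2.2.1)
    (hO fun i hi => (hdata i hi).2.2.2.2.1) hd
    (Ψh := fun i => solutionOperator (fun x => A i.1 x i.2.1) (X i.1 / 2))
    (Ψm := fun i => solutionOperator (fun x => A i.1 x i.2.1) (-(X i.1 / 2)))
    (Ψ := fun i => solutionOperator (fun x => A i.1 x i.2.1) (X i.1))
    (γ := fun i => Complex.exp (Complex.I * i.2.2 * X i.1))
    (fun i => by rw [Complex.norm_exp]; simp)
    (hS.mono fun i hi => (hdata i hi).2.2.2.2.2.1) (hS.mono fun i hi => (hdata i hi).2.2.2.2.2.2)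
    (hS.mono fun i hi => hA.solutionOperator_half hi.1 (hX₀.trans_le hi.2.1)
      (hest i.1 hi.1 hi.2.1 i.2.1 hi.2.2).1)
  obtain ⟨K₁, h1⟩ := hU1.bound
  obtain ⟨K₂, h2⟩ := hU2.bound
  obtain ⟨K₃, h3⟩ := hU3.bound
  have hall := hU0.and (h1.and (h2.and h3))
  rw [eventually_inf_principal, eventually_comap] at hall
  obtain ⟨X₁, hall⟩ := eventually_atTop.1 hall
  -- The normalization w uses the generator at ls, hence is independent of l and k: dividing by it
  -- affects neither zeros nor analyticity in l. The entry 1 keeps the constant positive.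
  refine ⟨max (max K₁ K₂) (max K₃ 1), max X₀ X₁, by positivity, lt_max_of_lt_left hX₀,
    fun ε hε hXε => ⟨Complex.exp (X ε * (scalingGenerator α ρ (Ainf ls)).trace),
      Complex.exp_ne_zero _, fun l hl => ⟨?_, fun k => ?_⟩⟩⟩
  · exact (hest ε hε ((le_max_left _ _).trans hXε) l hl).1
  have hX0 : X₀ ≤ X ε := (le_max_left _ _).trans hXε
  have hpos : 0 < X ε := hX₀.trans_le hX0
  obtain ⟨e0, e1, e2, e3⟩ := hall (X ε) ((le_max_right _ _).trans hXε) (ε, l, k) rfl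
    ⟨hε, hX0, hl⟩
  refine ⟨_, mul_ne_zero e0 (Complex.exp_ne_zero (X ε * (scalingGenerator α ρ (Ainf ls)).trace)),
    ?_, ?_, ?_⟩
  · rw [norm_inv, Real.norm_of_nonneg hpos.le, ← div_eq_mul_inv] at e1
    refine le_trans (le_of_eq ?_) (e1.trans (by gcongr; exact (le_max_left _ _).trans (le_max_left _ _)))
    rw [mul_comm (U _), ← mul_assoc, inv_mul_cancel_right₀ (Complex.exp_ne_zero _)]
    rfl
  · rw [norm_one, mul_one] at e2
    exact e2.trans ((le_max_right _ _).trans (le_max_left _ _))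
  · rw [norm_one, mul_one] at e3
    exact e3.trans ((le_max_left _ _).trans (le_max_right _ _))

end UniformEvansEstimate

/-! ### Zeros of functions close to 1 - exp((ik - μ) X + L) -/

section ZerosNearTheArc

open Metric

/-- `g` is, up to factors bounded above and below, `1 - exp ((i k - μ) X + L) + O(1/X)` on the disc
of radius `C / X` about `ls`. -/
def IsEvansLike (μ : ℂ → ℂ) (L ls : ℂ) (C K X k : ℝ) (g : ℂ → ℂ) : Prop :=
  ∀ l, ‖l - ls‖ ≤ C / X → ∃ V : ℂ, V ≠ 0 ∧
    ‖g l * V - (1 - Complex.exp ((Complex.I * k - μ l) * X + L))‖ ≤ K / X ∧ ‖V‖ ≤ K ∧ ‖V⁻¹‖ ≤ K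

/-- A function which is analytic at `ls` is approximated by its derivative, uniformly. -/
theorem AnalyticAt.exists_norm_sub_sub_le {μ : ℂ → ℂ} {ls : ℂ} (h : AnalyticAt ℂ μ ls) :
    ∃ c r : ℝ, 0 ≤ c ∧ 0 < r ∧ ∀ s ≤ r, ∀ a b, ‖a - ls‖ ≤ s → ‖b - ls‖ ≤ s →
      ‖μ a - μ b - deriv μ ls * (a - b)‖ ≤ c * s * ‖a - b‖ := by
  obtain ⟨c, hc⟩ := (h.deriv.differentiableAt.isBigO_sub).bound
  have hd : ∀ᶠ z in 𝓝 ls, DifferentiableAt ℂ μ z :=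
    h.eventually_analyticAt.mono fun z hz => hz.differentiableAt
  obtain ⟨r, hr, hball⟩ := nhds_basis_closedBall.eventually_iff.1 (hc.and hd)
  refine ⟨|c|, r, abs_nonneg c, hr, fun s hs a b ha hb => ?_⟩
  have key := (convex_closedBall ls s).norm_image_sub_le_of_norm_hasDerivWithin_le
    (f := fun z => μ z - deriv μ ls * z) (f' := fun z => deriv μ z - deriv μ ls * 1)
    (C := |c| * s) (x := b) (y := a) (fun z hz => ?_) (fun z hz => ?_)
    (mem_closedBall_iff_norm.2 hb) (mem_closedBall_iff_norm.2 ha)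
  · refine le_trans (le_of_eq ?_) key
    congr 1; ring
  · exact ((hball (closedBall_subset_closedBall hs hz)).2.hasDerivAt.sub
      ((hasDerivAt_id z).const_mul _)).hasDerivWithinAt
  · rw [mul_one]
    refine ((hball (closedBall_subset_closedBall hs hz)).1).trans ?_
    have := mem_closedBall_iff_norm.1 hz
    gcongr
    exact le_abs_self c

/-- Solutions of `exp w = 1 + O(η)`. -/
theorem Complex.exists_int_of_norm_one_sub_exp_le {w : ℂ} {η : ℝ} (h : ‖1 - Complex.exp w‖ ≤ η)
    (hη : η ≤ 1 / 2) : ∃ n : ℤ, ‖w - n * (2 * Real.pi * Complex.I)‖ ≤ 3 / 2 * η := by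
  have h1 : ‖Complex.exp w - 1‖ ≤ η := by rwa [norm_sub_rev]
  have h2 := Complex.norm_log_one_add_half_le_self (h1.trans hη)
  rw [add_sub_cancel] at h2
  obtain ⟨n, hn⟩ := Complex.exp_eq_exp_iff_exists_int.1
    (Complex.exp_log (Complex.exp_ne_zero w)).symm
  refine ⟨n, ?_⟩
  rw [hn, add_sub_cancel_right]
  exact h2.trans (by gcongr)

/-- A quantitative form of Hurwitz' theorem. -/
theorem exists_zero_of_lt_norm_sphere {g : ℂ → ℂ} {z₀ : ℂ} {r δ : ℝ} (hr : 0 < r)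
    (hd : ∀ z ∈ closedBall z₀ r, DifferentiableAt ℂ g z) (hδ : ∀ z ∈ sphere z₀ r, δ ≤ ‖g z‖)
    (h0 : ‖g z₀‖ < δ) : ∃ z ∈ closedBall z₀ r, g z = 0 := by
  by_contra! hne
  have hδ0 : 0 < δ := (norm_nonneg _).trans_lt h0
  -- Without a zero, the maximum principle for the reciprocal would force |g z₀| ≥ δ.
  have hcl : DiffContOnCl ℂ (fun z => (g z)⁻¹) (ball z₀ r) := by
    refine ⟨fun z hz => ((hd z (ball_subset_closedBall hz)).inv
      (hne z (ball_subset_closedBall hz))).differentiableWithinAt, fun z hz => ?_⟩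
    have hz' := closure_ball_subset_closedBall hz
    exact ((hd z hz').inv (hne z hz')).continuousAt.continuousWithinAt
  have hle := Complex.norm_le_of_forall_mem_frontier_norm_le isBounded_ball hcl (C := δ⁻¹)
    (fun z hz => ?_) (subset_closure (mem_ball_self hr))
  · rw [norm_inv, inv_le_inv₀ (norm_pos_iff.2 (hne z₀ (mem_closedBall_self hr.le))) hδ0] at hle
    linarith
  · rw [frontier_ball z₀ hr.ne'] at hz
    rw [norm_inv]
    exact inv_anti₀ hδ0 (hδ z hz)

variable {μ : ℂ → ℂ} {lam : ℝ → ℂ} {I : Set ℝ} {ls L : ℂ} {ks : ℝ}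

/-- Zeros are close to shifted lattice points. -/
theorem exists_arcLattice_of_zero (hμ : AnalyticAt ℂ μ ls) (hμ' : deriv μ ls ≠ 0)
    (hval : μ ls = Complex.I * ks) (hI : I ∈ 𝓝 ks) (hlam : DifferentiableAt ℝ lam ks)
    (hls : lam ks = ls)
    (harc : ∀ᶠ l in 𝓝 ls, ∀ κ ∈ I, lam κ = l → μ l = Complex.I * κ) (C K : ℝ) (hC : 0 < C)
    (hK : 0 < K) :
    ∃ C₂ X₀ : ℝ, 0 < C₂ ∧ 0 < X₀ ∧ ∀ (X k : ℝ) (g : ℂ → ℂ), X₀ ≤ X →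
      IsEvansLike μ L ls C K X k g → ∀ l, ‖l - ls‖ ≤ C / X → g l = 0 →
      ∃ m ∈ arcLattice I lam X k, ‖l - (m + L / (deriv μ ls * X))‖ ≤ C₂ / X ^ 2 := by
  obtain ⟨c, r, hc, hr, happ⟩ := hμ.exists_norm_sub_sub_le
  obtain ⟨r₁, hr₁, harc⟩ := nhds_basis_closedBall.eventually_iff.1 harc
  obtain ⟨cl, hcl⟩ := hlam.isBigO_sub.bound
  obtain ⟨r₂, hr₂, hκ⟩ := nhds_basis_closedBall.eventually_iff.1 (hcl.and hI)
  set b := ‖deriv μ ls‖ with hb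
  have hb0 : 0 < b := norm_pos_iff.2 hμ'
  -- c₃ bounds X |κ - ks| for the lattice parameter found below, and C₄ bounds X times the distance
  -- to ls of both l and the lattice point.
  set c₃ := (b + c * r) * C + 3 / 2 * K + ‖L‖ with hc₃
  have hc₃0 : 0 ≤ c₃ := by positivity
  set C₄ := max C (|cl| * c₃) with hC₄
  have hC₄0 : 0 < C₄ := lt_max_of_lt_left hC
  refine ⟨(3 / 2 * K + c * C₄ * (2 * C₄)) / b,
    max (max (2 * K) (C₄ / r)) (max (C₄ / r₁) (max (c₃ / r₂) 1)), by positivity, by positivity,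
    fun X k g hX hg l hl hgl => ?_⟩
  obtain ⟨⟨hX1, hX2⟩, hX3, hX4, hX5⟩ : (2 * K ≤ X ∧ C₄ / r ≤ X) ∧ C₄ / r₁ ≤ X ∧ c₃ / r₂ ≤ X ∧
      1 ≤ X := by simpa only [max_le_iff] using hX
  have hX0 : 0 < X := by linarith
  have hsr : C₄ / X ≤ r := by rw [div_le_iff₀ hX0]; rw [div_le_iff₀ hr] at hX2; linarith
  have hsr₁ : C₄ / X ≤ r₁ := by rw [div_le_iff₀ hX0]; rw [div_le_iff₀ hr₁] at hX3; linarith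
  have hsr₂ : c₃ / X ≤ r₂ := by rw [div_le_iff₀ hX0]; rw [div_le_iff₀ hr₂] at hX4; linarith
  have hlC₄ : ‖l - ls‖ ≤ C₄ / X := hl.trans (by gcongr; exact le_max_left _ _)
  obtain ⟨V, -, hV, -, -⟩ := hg l hl
  rw [hgl, zero_mul, zero_sub, norm_neg] at hV
  obtain ⟨n, hn⟩ := Complex.exists_int_of_norm_one_sub_exp_le hV
    (by rw [div_le_iff₀ hX0]; linarith)
  -- The branch integer n of the logarithm is absorbed by moving k by a multiple of 2π/X; this
  -- selects the lattice point.
  set κ : ℝ := k + (-n : ℤ) * (2 * Real.pi / X) with hκdef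
  have hXC : (X : ℂ) ≠ 0 := by exact_mod_cast hX0.ne'
  set e := (Complex.I * κ - μ l) * X + L with he
  have heq : (Complex.I * k - μ l) * X + L - n * (2 * Real.pi * Complex.I) = e := by
    rw [he, hκdef]; push_cast; field_simp; ring
  rw [heq] at hn
  have hXn : ‖(X : ℂ)‖ = X := by rw [Complex.norm_real, Real.norm_of_nonneg hX0.le]
  have hdiff : Complex.I * κ - μ l = (e - L) / X := by rw [he]; field_simp; ring
  have hκs : |κ - ks| ≤ c₃ / X := by
    have e1 : ((κ - ks : ℝ) : ℂ) * Complex.I =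
        (e - L) / X + (μ l - μ ls - deriv μ ls * (l - ls)) + deriv μ ls * (l - ls) := by
      rw [← hdiff, hval]; push_cast; ring
    have e2 : |κ - ks| = ‖((κ - ks : ℝ) : ℂ) * Complex.I‖ := by
      rw [norm_mul, Complex.norm_I, mul_one, Complex.norm_real, Real.norm_eq_abs]
    have e3 : ‖(e - L) / X‖ ≤ (3 / 2 * K + ‖L‖) / X := by
      rw [norm_div, hXn]
      gcongr
      refine (norm_sub_le _ _).trans (add_le_add (hn.trans ?_) le_rfl)
      have : K / X ≤ K := div_le_self hK.le hX5
      linarith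
    have e4 := happ r le_rfl l ls (hlC₄.trans hsr) (by simpa using hr.le)
    have e5 : c * r * ‖l - ls‖ ≤ c * r * (C / X) := by gcongr
    have e6 : ‖deriv μ ls * (l - ls)‖ ≤ b * (C / X) := by rw [norm_mul]; gcongr
    rw [e2, e1]
    refine (norm_add₃_le.trans (add_le_add (add_le_add e3 (e4.trans e5)) e6)).trans (le_of_eq ?_)
    rw [hc₃]; ring
  obtain ⟨hlamκ, hκI⟩ := hκ (show κ ∈ closedBall ks r₂ by
    rw [mem_closedBall, Real.dist_eq]; exact hκs.trans hsr₂)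
  have hm : ‖lam κ - ls‖ ≤ C₄ / X := by
    rw [hls, Real.norm_eq_abs] at hlamκ
    calc ‖lam κ - ls‖ ≤ |cl| * (c₃ / X) :=
          hlamκ.trans (mul_le_mul (le_abs_self _) hκs (abs_nonneg _) (abs_nonneg _))
      _ = |cl| * c₃ / X := by ring
      _ ≤ _ := by gcongr; exact le_max_right _ _
  have hμm : μ (lam κ) = Complex.I * κ :=
    harc (mem_closedBall_iff_norm.2 (hm.trans hsr₁)) κ hκI rfl
  refine ⟨lam κ, ⟨κ, hκI, ⟨-n, rfl⟩, rfl⟩, ?_⟩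
  have e1 := happ (C₄ / X) hsr l (lam κ) hlC₄ hm
  have e2 : ‖l - lam κ‖ ≤ 2 * C₄ / X := by
    have : l - lam κ = (l - ls) - (lam κ - ls) := by ring
    rw [this]
    refine (norm_sub_le _ _).trans ((add_le_add hlC₄ hm).trans (le_of_eq ?_))
    ring
  -- Subtracting μ(lam κ) = iκ from μ(l) = iκ + (L - e)/X leaves the residue e/X and the
  -- linearization error of μ, both O(1/X²).
  have e3 : deriv μ ls * (l - (lam κ + L / (deriv μ ls * X))) =
      -(e / X) - (μ l - μ (lam κ) - deriv μ ls * (l - lam κ)) := by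
    have : μ l = Complex.I * κ - (e - L) / X := by rw [← hdiff]; ring
    rw [hμm, this]; field_simp; ring
  have e4 : b * ‖l - (lam κ + L / (deriv μ ls * X))‖ ≤
      (3 / 2 * K + c * C₄ * (2 * C₄)) / X ^ 2 := by
    rw [hb, ← norm_mul, e3]
    refine (norm_sub_le _ _).trans ?_
    rw [norm_neg, norm_div, hXn]
    calc ‖e‖ / X + _ ≤ (3 / 2 * (K / X)) / X + c * (C₄ / X) * (2 * C₄ / X) := by
          refine add_le_add (by gcongr) (e1.trans (by gcongr))
      _ = _ := by field_simp
  rw [div_right_comm, le_div_iff₀' hb0]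
  exact e4

/-- There are zeros close to shifted lattice points. -/
theorem exists_zero_of_mem_arcLattice (hμ : AnalyticAt ℂ μ ls) (hμ' : deriv μ ls ≠ 0)
    (harc : ∀ᶠ l in 𝓝 ls, ∀ κ ∈ I, lam κ = l → μ l = Complex.I * κ) (C C' K : ℝ) (hC : 0 < C)
    (hC' : C + ‖L / deriv μ ls‖ + 1 ≤ C') (hK : 0 < K) :
    ∃ C₂ X₀ : ℝ, 0 < C₂ ∧ 0 < X₀ ∧ ∀ (X k : ℝ) (g : ℂ → ℂ), X₀ ≤ X →
      IsEvansLike μ L ls C' K X k g → (∀ l, ‖l - ls‖ ≤ C' / X → DifferentiableAt ℂ g l) →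
      ∀ m ∈ arcLattice I lam X k, ‖m - ls‖ ≤ C / X →
      ∃ l, g l = 0 ∧ ‖l - (m + L / (deriv μ ls * X))‖ ≤ C₂ / X ^ 2 := by
  obtain ⟨c, r, hc, hr, happ⟩ := hμ.exists_norm_sub_sub_le
  obtain ⟨r₁, hr₁, harc⟩ := nhds_basis_closedBall.eventually_iff.1 harc
  set b := ‖deriv μ ls‖ with hb
  have hb0 : 0 < b := norm_pos_iff.2 hμ'
  have hC'0 : 0 < C' := by have := norm_nonneg (L / deriv μ ls); linarith
  -- In the comparison of g V with the linear function, a comes from the nonlinearity of μ, K from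
  -- the Evans error and 1 from exp w - 1 - w. R is then chosen so that on the circle of radius R/X²
  -- the linear term exceeds the error B/X by (K² B + K)/X. After removal of V, with norms of V and
  -- V⁻¹ at most K, this still beats the value at the center.
  set a := c * C' * (2 * C') with ha
  have ha0 : 0 ≤ a := by positivity
  set B := a + K + 1 with hB
  have hB0 : 0 < B := by positivity
  set R := (B + K ^ 2 * B + K) / b with hR
  have hR0 : 0 < R := by positivity
  have hbR : b * R = B + K ^ 2 * B + K := by rw [hR]; field_simp
  refine ⟨R, max (max (C' / r) (C' / r₁)) (max R (max ((b * R + a) ^ 2 + (b * R + a)) 1)), hR0,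
    by positivity, fun X k g hX hg hd m hm hmC => ?_⟩
  obtain ⟨⟨hX1, hX2⟩, hX3, hX4, hX5⟩ : (C' / r ≤ X ∧ C' / r₁ ≤ X) ∧ R ≤ X ∧
      (b * R + a) ^ 2 + (b * R + a) ≤ X ∧ 1 ≤ X := by simpa only [max_le_iff] using hX
  have hX0 : 0 < X := by linarith
  have hsr : C' / X ≤ r := by rw [div_le_iff₀ hX0]; rw [div_le_iff₀ hr] at hX1; linarith
  have hsr₁ : C' / X ≤ r₁ := by rw [div_le_iff₀ hX0]; rw [div_le_iff₀ hr₁] at hX2; linarith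
  have hXC : (X : ℂ) ≠ 0 := by exact_mod_cast hX0.ne'
  have hXn : ‖(X : ℂ)‖ = X := by rw [Complex.norm_real, Real.norm_of_nonneg hX0.le]
  obtain ⟨κ, hκI, ⟨n, hκ⟩, rfl⟩ := hm
  have hmC' : ‖lam κ - ls‖ ≤ C' / X := hmC.trans (by
    gcongr; have := norm_nonneg (L / deriv μ ls); linarith)
  have hμm : μ (lam κ) = Complex.I * κ :=
    harc (mem_closedBall_iff_norm.2 (hmC'.trans hsr₁)) κ hκI rfl
  set z₀ := lam κ + L / (deriv μ ls * X) with hz₀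
  have hdisc : ∀ z, ‖z - z₀‖ ≤ R / X ^ 2 → ‖z - ls‖ ≤ C' / X := fun z hz => by
    have e1 : z - ls = (z - z₀) + (lam κ - ls) + L / deriv μ ls / X := by
      rw [hz₀, div_div]; ring
    have e2 : R / X ^ 2 ≤ 1 / X := by
      rw [div_le_div_iff₀ (by positivity) hX0]; nlinarith
    rw [e1]
    refine (norm_add₃_le.trans (add_le_add (add_le_add (hz.trans e2) hmC) le_rfl)).trans ?_
    rw [norm_div _ (X : ℂ), hXn, ← add_div, ← add_div]
    gcongr
    linarith
  -- the exponent, its linear part and the resulting estimate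
  have hest : ∀ z, ‖z - z₀‖ ≤ R / X ^ 2 → ∃ V : ℂ, V ≠ 0 ∧ ‖V‖ ≤ K ∧ ‖V⁻¹‖ ≤ K ∧
      ‖g z * V - deriv μ ls * X * (z - z₀)‖ ≤ B / X := fun z hz => by
    obtain ⟨V, hV0, hV, hV1, hV2⟩ := hg z (hdisc z hz)
    refine ⟨V, hV0, hV1, hV2, ?_⟩
    set w := -(X * (μ z - μ (lam κ))) + L with hw
    -- κ ≡ k mod 2π/X, so replacing ik by iκ = μ(lam κ) changes the exponent by a multiple of 2πi
    -- and leaves w small.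
    have hexp : Complex.exp ((Complex.I * k - μ z) * X + L) = Complex.exp w := by
      rw [Complex.exp_eq_exp_iff_exists_int]
      refine ⟨-n, ?_⟩
      rw [hw, hμm, hκ]; push_cast; field_simp; ring
    rw [hexp] at hV
    have e1 : w + deriv μ ls * X * (z - z₀) =
        -(X * (μ z - μ (lam κ) - deriv μ ls * (z - lam κ))) := by
      rw [hw, hz₀]; field_simp; ring
    have e2 : ‖w + deriv μ ls * X * (z - z₀)‖ ≤ a / X := by
      have h1 := happ (C' / X) hsr z (lam κ) (hdisc z hz) hmC'
      have h2 : ‖z - lam κ‖ ≤ 2 * C' / X := by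
        have : z - lam κ = (z - ls) - (lam κ - ls) := by ring
        rw [this]
        refine (norm_sub_le _ _).trans ((add_le_add (hdisc z hz) hmC').trans (le_of_eq ?_))
        ring
      rw [e1, norm_neg, norm_mul, hXn]
      calc X * _ ≤ X * (c * (C' / X) * (2 * C' / X)) := by
            refine mul_le_mul_of_nonneg_left (h1.trans (by gcongr)) hX0.le
        _ = a / X := by rw [ha]; field_simp
    have e3 : ‖deriv μ ls * X * (z - z₀)‖ ≤ b * R / X := by
      rw [norm_mul, norm_mul, hXn, ← hb]
      calc b * X * ‖z - z₀‖ ≤ b * X * (R / X ^ 2) := by gcongr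
        _ = _ := by field_simp
    have e4 : ‖w‖ ≤ (b * R + a) / X := by
      have : w = (w + deriv μ ls * X * (z - z₀)) - deriv μ ls * X * (z - z₀) := by ring
      rw [this]
      refine (norm_sub_le _ _).trans ((add_le_add e2 e3).trans (le_of_eq (by ring)))
    have hbRa : 0 ≤ b * R + a := by positivity
    have e5 : ‖w‖ ≤ 1 := e4.trans (by
      rw [div_le_one hX0]; have := sq_nonneg (b * R + a); linarith)
    have e6 : ‖w‖ ^ 2 ≤ 1 / X := by
      refine (pow_le_pow_left₀ (norm_nonneg _) e4 2).trans ?_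
      rw [div_pow, div_le_div_iff₀ (by positivity) hX0]
      nlinarith
    have e7 := Complex.norm_exp_sub_one_sub_id_le e5
    have e8 : g z * V - deriv μ ls * X * (z - z₀) =
        (g z * V - (1 - Complex.exp w)) - (Complex.exp w - 1 - w) -
          (w + deriv μ ls * X * (z - z₀)) := by ring
    rw [e8]
    refine (norm_sub_le _ _).trans ((add_le_add ((norm_sub_le _ _).trans
      (add_le_add hV (e7.trans e6))) e2).trans (le_of_eq ?_))
    rw [hB]; ring
  have hr0 : 0 < R / X ^ 2 := by positivity
  have hzero : ∃ z ∈ closedBall z₀ (R / X ^ 2), g z = 0 := by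
    refine exists_zero_of_lt_norm_sphere (δ := (K ^ 2 * B + K) / (K * X)) hr0
      (fun z hz => hd z (hdisc z (mem_closedBall_iff_norm.1 hz))) (fun z hz => ?_) ?_
    · have hz' : ‖z - z₀‖ = R / X ^ 2 := mem_sphere_iff_norm.1 hz
      obtain ⟨V, hV0, hV1, -, hV⟩ := hest z hz'.le
      have h1 : ‖deriv μ ls * X * (z - z₀)‖ = (B + K ^ 2 * B + K) / X := by
        rw [norm_mul, norm_mul, hXn, ← hb, hz', ← hbR]; field_simp
      have h2 := norm_sub_norm_le (deriv μ ls * X * (z - z₀)) (g z * V)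
      rw [norm_sub_rev, h1, norm_mul] at h2
      have h3 : (K ^ 2 * B + K) / X ≤ ‖g z‖ * K := by
        have h4 : ‖g z‖ * ‖V‖ ≤ ‖g z‖ * K := by gcongr
        have h5 : (B + K ^ 2 * B + K) / X = B / X + (K ^ 2 * B + K) / X := by ring
        linarith
      rwa [mul_comm K X, ← div_div, div_le_iff₀ hK]
    · obtain ⟨V, hV0, -, hV2, hV⟩ := hest z₀ (by simpa using hr0.le)
      rw [sub_self, mul_zero, sub_zero] at hV
      have h1 : ‖g z₀‖ ≤ B / X * K := by
        have : g z₀ = g z₀ * V * V⁻¹ := (mul_inv_cancel_right₀ hV0 _).symm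
        rw [this, norm_mul]
        gcongr
      refine h1.trans_lt ?_
      rw [lt_div_iff₀ (by positivity)]
      have : B / X * K * (K * X) = K ^ 2 * B := by field_simp
      rw [this]; linarith
  obtain ⟨z, hz, hgz⟩ := hzero
  exact ⟨z, hgz, mem_closedBall_iff_norm.1 hz⟩

end ZerosNearTheArc

/-! ### Normalizing the estimate and separating the constants -/

section NormalizedEstimate

/-- Divide by d₁ and absorb d₂/d₁ into the exponent by its principal logarithm. The constant allows
for multiplication of V by d₁ or by its inverse. -/
theorem isEvansLike_of_estimate {μ : ℂ → ℂ} {ls d₁ d₂ : ℂ} {C K X k : ℝ} {g : ℂ → ℂ}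
    (hd₁ : d₁ ≠ 0) (hd₂ : d₂ ≠ 0) (hX : 0 < X) (hK : 0 < K)
    (h : ∀ l, ‖l - ls‖ ≤ C / X → ∃ V : ℂ, V ≠ 0 ∧
      ‖g l * V - (d₁ - Complex.exp (Complex.I * k * X) * Complex.exp (-(X * μ l)) * d₂)‖ ≤ K / X ∧
      ‖V‖ ≤ K ∧ ‖V⁻¹‖ ≤ K) :
    IsEvansLike μ (Complex.log (d₂ / d₁)) ls C (K * (‖d₁‖ + ‖d₁‖⁻¹)) X k g := fun l hl => by
  obtain ⟨V, hV0, hV, hV1, hV2⟩ := h l hl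
  have hn : 0 < ‖d₁‖ := norm_pos_iff.2 hd₁
  refine ⟨V / d₁, div_ne_zero hV0 hd₁, ?_, ?_, ?_⟩
  · have e1 : Complex.exp ((Complex.I * k - μ l) * X + Complex.log (d₂ / d₁)) =
        Complex.exp (Complex.I * k * X) * Complex.exp (-(X * μ l)) * (d₂ / d₁) := by
      rw [Complex.exp_add, Complex.exp_log (div_ne_zero hd₂ hd₁), ← Complex.exp_add]
      congr 2; ring
    have e2 : g l * (V / d₁) - (1 - Complex.exp (Complex.I * k * X) * Complex.exp (-(X * μ l)) *
        (d₂ / d₁)) = (g l * V - (d₁ - Complex.exp (Complex.I * k * X) *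
        Complex.exp (-(X * μ l)) * d₂)) / d₁ := by
      field_simp
    rw [e1, e2, norm_div, div_le_iff₀ hn]
    refine hV.trans ?_
    have : K * (‖d₁‖ + ‖d₁‖⁻¹) / X * ‖d₁‖ = K / X * (‖d₁‖ ^ 2 + 1) := by field_simp
    rw [this]
    exact le_mul_of_one_le_right (by positivity) (by nlinarith)
  · rw [norm_div, div_eq_mul_inv]
    gcongr
    linarith
  · rw [inv_div, norm_div, div_eq_mul_inv, ← norm_inv, mul_comm]
    gcongr
    have : 0 ≤ ‖d₁‖⁻¹ := by positivity
    linarith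

/-- Once X ≥ C₂ the second-order error is at most 1/X, so the constant of the first-order bound does
not see C₂. This is why C₁ can be chosen before C. -/
theorem norm_sub_le_div_of_sq {l m L b : ℂ} {C₂ X : ℝ} (hX : 0 < X) (hC₂ : C₂ ≤ X)
    (h : ‖l - (m + L / (b * X))‖ ≤ C₂ / X ^ 2) : ‖l - m‖ ≤ (‖L / b‖ + 1) / X := by
  have e : l - m = (l - (m + L / (b * X))) + L / b / X := by rw [div_div]; ring
  have h2 : C₂ / X ^ 2 ≤ 1 / X := by
    rw [div_le_div_iff₀ (by positivity) hX]; nlinarith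
  rw [e, add_comm ‖L / b‖, add_div]
  refine (norm_add_le _ _).trans (add_le_add (h.trans h2) (le_of_eq ?_))
  rw [norm_div _ (X : ℂ), Complex.norm_real, Real.norm_of_nonneg hX.le]

end NormalizedEstimate

/-! ### Conclusion: eigenvalues and the shifted arc lattice -/

theorem corollary5p3 {N : ℕ} (M ε₀ : ℝ) (X : ℝ → ℝ)
    (A : ℝ → ℝ → ℂ → Matrix (Fin N) (Fin N) ℂ) (Ainf : ℂ → Matrix (Fin N) (Fin N) ℂ)
    (hA : HomoclinicLimit M ε₀ X A Ainf)
    (I : Set ℝ) (lam : ℝ → ℂ) (ls : ℂ) (ks : ℝ)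
    (harc : IsIsolatedArcPoint M Ainf I lam ls ks)
    (Λ₁ Λ₂ : Set ℂ)
    (hΛ₁ : IsDomainOfHyperbolicity M Ainf Λ₁) (hΛ₂ : IsDomainOfHyperbolicity M Ainf Λ₂)
    (hls₁ : ls ∈ closure Λ₁) (hls₂ : ls ∈ closure Λ₂)
    (hside₁ : ∀ᶠ l in 𝓝[Λ₁] ls, 0 < (centerEigenvalue Ainf ls ks l).re)
    (hside₂ : ∀ᶠ l in 𝓝[Λ₂] ls, (centerEigenvalue Ainf ls ks l).re < 0)
    (d₁ d₂ : ℂ)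
    (hd₁ : d₁ = homoclinicEvansOn (A 0) Ainf Λ₁ ls) (hd₂ : d₂ = homoclinicEvansOn (A 0) Ainf Λ₂ ls)
    (hd₁_ne : d₁ ≠ 0) (hd₂_ne : d₂ ≠ 0) :
    ∃ C₁ : ℝ, 0 < C₁ ∧ ∀ C : ℝ, 0 < C → ∃ C₂ X₀ : ℝ, 0 < C₂ ∧ 0 < X₀ ∧
      ∀ ε ∈ Set.Ioo 0 ε₀, X₀ ≤ X ε → ∀ k : ℝ,
        (∀ l ∈ Metric.ball ls (C / X ε),
          l ∈ gammaEigenvalues (A ε) (X ε) (Complex.exp (Complex.I * k * X ε)) →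
          ∃ m ∈ arcLattice I lam (X ε) k,
            ‖l - m‖ ≤ C₁ / X ε ∧
            ‖l - (m + Complex.log (d₂ / d₁) / (deriv (centerEigenvalue Ainf ls ks) ls * X ε))‖
              ≤ C₂ / X ε ^ 2) ∧
        (∀ m ∈ arcLattice I lam (X ε) k, m ∈ Metric.ball ls (C / X ε) →
          ∃ l ∈ gammaEigenvalues (A ε) (X ε) (Complex.exp (Complex.I * k * X ε)),
            ‖l - m‖ ≤ C₁ / X ε ∧
            ‖l - (m + Complex.log (d₂ / d₁) / (deriv (centerEigenvalue Ainf ls ks) ls * X ε))‖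
              ≤ C₂ / X ε ^ 2) := by
  obtain ⟨α, ρ, hc, hks⟩ := harc.exists_isSimpleCenter
  have hdiff : ∀ᶠ l in 𝓝 ls, DifferentiableAt ℂ Ainf l := by
    filter_upwards [continuous_norm.continuousAt.eventually_lt continuousAt_const harc.norm_lt]
      with l hl
    exact hA.differentiableAt_limit hl
  have hcont := hdiff.self_of_nhds.continuousAt
  obtain ⟨Pp₀, Pm₀, ⟨Pp, Pm, hPp, hPm, hE⟩, hest⟩ :=
    hA.exists_evans_estimate harc.norm_lt hc (by rw [hks]; simp)
  have hce := hc.centerEigenvalue_eventuallyEq hdiff hks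
  have hd₁' : d₁ = evansUnstableSide α ρ (Ainf ls) Pp₀ Pm₀ := by
    rw [hd₁]
    refine homoclinicEvansOn_eq_unstableSide hc hcont hPp hPm hE hls₁ ?_
    filter_upwards [hside₁, hce.filter_mono nhdsWithin_le_nhds] with l h1 h2
    rwa [h2] at h1
  have hd₂' : d₂ = evansStableSide α ρ (Ainf ls) Pp₀ Pm₀ := by
    rw [hd₂]
    refine homoclinicEvansOn_eq_stableSide hc hcont hPp hPm hE hls₂ ?_
    filter_upwards [hside₂, hce.filter_mono nhdsWithin_le_nhds] with l h1 h2
    rwa [h2] at h1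
  rw [← hd₁', ← hd₂'] at hest
  rw [hce.deriv_eq]
  set μ : ℂ → ℂ := fun l => stripEigenvalue α ρ (Ainf l)
  set L := Complex.log (d₂ / d₁)
  have hμ : AnalyticAt ℂ μ ls := hc.analyticAt_stripEigenvalue hdiff
  have hμ' : deriv μ ls ≠ 0 := hc.deriv_ne_zero hdiff harc
  have hlat : ∀ᶠ l in 𝓝 ls, ∀ κ ∈ I, lam κ = l → μ l = Complex.I * κ := by
    filter_upwards [hc.eventually_comp hcont] with l hl κ hκ hlκ
    refine hl.stripEigenvalue_eq_of_imaginary ?_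
    rw [← hlκ]
    exact harc.dispersion κ hκ
  -- C₁ is the length of the shift δ, times X, plus one for the remainder.
  refine ⟨‖L / deriv μ ls‖ + 1, by positivity, fun C hC => ?_⟩
  -- The estimates are used on a larger disc, so that the small circles about shifted lattice points
  -- stay inside.
  set C' := C + ‖L / deriv μ ls‖ + 1 with hC'
  have hC'0 : 0 < C' := by positivity
  have hCC' : C ≤ C' := by have := norm_nonneg (L / deriv μ ls); linarith
  obtain ⟨K, X₁, hK, hX₁, hest⟩ := hest hd₁_ne C' hC'0
  have hK' : 0 < K * (‖d₁‖ + ‖d₁‖⁻¹) := by have := norm_pos_iff.2 hd₁_ne; positivity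
  obtain ⟨C₂, X₂, hC₂, hX₂, hpart₁⟩ := exists_arcLattice_of_zero (L := L) hμ hμ' hks harc.nhds
    harc.differentiable harc.value hlat C' _ hC'0 hK'
  obtain ⟨C₃, X₃, hC₃, hX₃, hpart₂⟩ := exists_zero_of_mem_arcLattice hμ hμ' hlat C C' _ hC hC'.ge hK'
  refine ⟨max C₂ C₃, max (max X₁ X₂) (max X₃ (max C₂ C₃)), lt_max_of_lt_left hC₂,
    lt_max_of_lt_left (lt_max_of_lt_left hX₁), fun ε hε hXε k => ?_⟩
  obtain ⟨⟨h1, h2⟩, h3, h4⟩ : (X₁ ≤ X ε ∧ X₂ ≤ X ε) ∧ X₃ ≤ X ε ∧ max C₂ C₃ ≤ X ε := by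
    simpa only [max_le_iff] using hXε
  have hX0 : 0 < X ε := hX₁.trans_le h1
  obtain ⟨w, hw, hest⟩ := hest ε hε h1
  set γ := Complex.exp (Complex.I * k * X ε)
  -- The factor w⁻¹ is constant in l, so g has the same zeros as the Evans function and is equally
  -- differentiable.
  set g : ℂ → ℂ := fun l => periodicEvans (fun x => A ε x l) (X ε) γ * w⁻¹ with hg
  have hlike : IsEvansLike μ L ls C' (K * (‖d₁‖ + ‖d₁‖⁻¹)) (X ε) k g :=
    isEvansLike_of_estimate hd₁_ne hd₂_ne hX0 hK fun l hl => (hest l hl).2 k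
  have hzero : ∀ l, g l = 0 ↔ l ∈ gammaEigenvalues (A ε) (X ε) γ := fun l => by
    rw [hg, gammaEigenvalues, Set.mem_ofPred_eq]
    exact mul_eq_zero_iff_right (inv_ne_zero hw)
  refine ⟨fun l hl hlγ => ?_, fun m hm hmC => ?_⟩
  · obtain ⟨m, hm, hlm⟩ := hpart₁ (X ε) k g h2 hlike l
      ((mem_ball_iff_norm.1 hl).le.trans (by gcongr)) ((hzero l).2 hlγ)
    have hlm' := hlm.trans (div_le_div_of_nonneg_right (le_max_left C₂ C₃) (by positivity))
    exact ⟨m, hm, norm_sub_le_div_of_sq hX0 h4 hlm', hlm'⟩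
  · obtain ⟨l, hl, hlm⟩ := hpart₂ (X ε) k g h3 hlike
      (fun l hl => (hA.differentiableAt_periodicEvans hε hX0 (hest l hl).1 γ).mul_const _) m hm
      (mem_ball_iff_norm.1 hmC).le
    have hlm' := hlm.trans (div_le_div_of_nonneg_right (le_max_right C₂ C₃) (by positivity))
    exact ⟨l, (hzero l).1 hl, norm_sub_le_div_of_sq hX0 h4 hlm', hlm'⟩
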